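/- **Setting.** Let $N\ge 1$ be an integer and $p>1$. For $\varepsilon>0$ consider the Cauchy problem $$\partial_t^2u-a(t)^2\Delta u+b(t)\partial_tu=|u|^p\quad\text{in }\mathbb R^N\times(0,T),\qquad (u,\partial_tu)(0)=(\varepsilon f,\varepsilon g),\tag{P}$$ for real-valued $(f,g)\in H^2(\mathbb R^N)\times H^1(\mathbb R^N)$. A *strong solution* of (P) in $(0,T)$ is a function $u\in C([0,T);H^2(\mathbb R^N))\cap C^1([0,T);H^1(\mathbb R^N))\cap C^2([0,T);L^2(\mathbb R^N))\cap C([0,T);L^{2p}(\mathbb R^N))$ which satisfies the equation in $L^2(\mathbb R^N)$ for every $t\in[0,T)$, and the initial conditions. The *lifespan* is $$T_\varepsilon=T_\varepsilon(f,g)=\sup\{T>0:\text{there is a strong solution of (P) in }(0,T)\}\in[0,\infty].$$ For $\nu\geq 1$ and $\alpha>-1$ put $$\gamma(\nu,\alpha;p)=2+\Bigl(\nu+1-\frac{3\alpha}{1+\alpha}\Bigr)p-\Bigl(\nu-1+\frac{\alpha}{1+\alpha}\Bigr)p^2,\qquad p_{\rm HWY}(\nu,\alpha)=\sup\{p>1:\gamma(\nu,\alpha;p)>0\}\in(1,\infty].$$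 **Corollary 1.2.** Let $0<a\in C^2([0,\infty))$ and $0\le b\in C^1([0,\infty))\cap L^1((0,\infty))$, and suppose that there are constants $\alpha>-1$, $\beta>1$ and $K\ge1$ such that for all $t\ge0$ $$K^{-1}\le(1+t)^{-\alpha}a(t)\le K,\qquad (1+t)^{1-\alpha}|a'(t)|+(1+t)^{2-\alpha}|a''(t)|\le K,\qquad (1+t)^{\beta}b(t)+(1+t)^{1+\beta}|b'(t)|\le K.$$ Let $p>1$, and if $N\ge5$ let also $p\le\frac{N-2}{N-4}$. Let $(f,g)\in H^2(\mathbb R^N)\times H^1(\mathbb R^N)$ satisfy $f,g\ge0$, $f+g\not\equiv0$ and $\operatorname{supp}f\cup\operatorname{supp}g\subset\{x:|x|<r_0\}$ for some $r_0$. Then $p<p_{\rm HWY}(N,\alpha)$ if and only if $\gamma(N,\alpha;p)>0$, and in this case there are constants $C>0$ and $\varepsilon_0>0$, independent of $\varepsilon$, such that $$T_\varepsilon\le C\,\varepsilon^{-\frac{2p(p-1)}{(1+\alpha)\,\gamma(N,\alpha;p)}}\qquad\text{for all }\varepsilon\in(0,\varepsilon_0].$$ -/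

import Mathlib

open MeasureTheory Set Filter Topology
open scoped ENNReal ContDiff

noncomputable section

namespace SemilinearWave

/-- Euclidean space `ℝ^N`. -/
abbrev Space (N : ℕ) : Type := EuclideanSpace ℝ (Fin N)

/-- The real space `L²(ℝ^N)`. -/
abbrev L2 (N : ℕ) : Type := Lp ℝ 2 (volume : Measure (Space N))

/-- The classical partial derivative `∂φ/∂x_i`. -/
def partialDeriv {N : ℕ} (i : Fin N) (φ : Space N → ℝ) (x : Space N) : ℝ :=
  fderiv ℝ φ x (EuclideanSpace.single i 1)

/-- `v` is the weak partial derivative of `u` in the direction `x_i`. -/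
def HasWeakPartial {N : ℕ} (i : Fin N) (u v : L2 N) : Prop :=
  ∀ φ : Space N → ℝ, ContDiff ℝ ∞ φ → HasCompactSupport φ →
    ∫ x, u x * partialDeriv i φ x = - ∫ x, v x * φ x

section weak_derivative_facts

variable {N : ℕ} {i : Fin N}

theorem integrable_L2_mul (u : L2 N) {φ : Space N → ℝ} (hφ : Continuous φ)
    (hc : HasCompactSupport φ) : Integrable (fun x => u x * φ x) :=
  MemLp.integrable_mul (p := 2) (q := 2) (Lp.memLp u) (hφ.memLp_of_hasCompactSupport hc)

theorem continuous_partialDeriv {φ : Space N → ℝ} (hφ : ContDiff ℝ ∞ φ) :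
    Continuous (partialDeriv i φ) :=
  (hφ.continuous_fderiv (by simp)).clm_apply continuous_const

theorem hasCompactSupport_partialDeriv {φ : Space N → ℝ} (hc : HasCompactSupport φ) :
    HasCompactSupport (partialDeriv i φ) :=
  hc.fderiv_apply ℝ (EuclideanSpace.single i 1)

theorem HasWeakPartial.zero : HasWeakPartial i (0 : L2 N) 0 := by
  intro φ _ _
  have h0 : ∀ ψ : Space N → ℝ, ∫ x, (0 : L2 N) x * ψ x = 0 := by
    intro ψ
    rw [← integral_zero (Space N) ℝ (μ := volume)]
    refine integral_congr_ae ?_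
    filter_upwards [Lp.coeFn_zero ℝ 2 (volume : Measure (Space N))] with x hx
    rw [hx, Pi.zero_apply, zero_mul]
  rw [h0, h0, neg_zero]

theorem HasWeakPartial.add {u v u' v' : L2 N} (h : HasWeakPartial i u v)
    (h' : HasWeakPartial i u' v') : HasWeakPartial i (u + u') (v + v') := by
  intro φ hφ hc
  have key : ∀ (w w' : L2 N) {ψ : Space N → ℝ}, Continuous ψ → HasCompactSupport ψ →
      ∫ x, (w + w') x * ψ x = (∫ x, w x * ψ x) + ∫ x, w' x * ψ x := by
    intro w w' ψ hψ hψc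
    rw [← integral_add (integrable_L2_mul w hψ hψc) (integrable_L2_mul w' hψ hψc)]
    refine integral_congr_ae ?_
    filter_upwards [Lp.coeFn_add w w'] with x hx
    rw [hx, Pi.add_apply, add_mul]
  rw [key u u' (continuous_partialDeriv hφ) (hasCompactSupport_partialDeriv hc),
    key v v' hφ.continuous hc, h φ hφ hc, h' φ hφ hc]
  ring

theorem HasWeakPartial.smul {u v : L2 N} (c : ℝ) (h : HasWeakPartial i u v) :
    HasWeakPartial i (c • u) (c • v) := by
  intro φ hφ hc
  have key : ∀ (w : L2 N) (ψ : Space N → ℝ),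
      ∫ x, (c • w) x * ψ x = c * ∫ x, w x * ψ x := by
    intro w ψ
    rw [← integral_const_mul]
    refine integral_congr_ae ?_
    filter_upwards [Lp.coeFn_smul c w] with x hx
    rw [hx, Pi.smul_apply, smul_eq_mul, mul_assoc]
  rw [key, key, h φ hφ hc]
  ring

end weak_derivative_facts

/-- The Sobolev space `H¹(ℝ^N)`: an element is the tuple `(u, (∂_i u)_i)` of an `L²` function and
its weak partial derivatives in `L²`; the norm (the largest of the `L²` norms of the entries) is
equivalent to the usual one, and the tuple is determined by its first entry. -/
def sobolevH1 (N : ℕ) : Submodule ℝ (L2 N × (Fin N → L2 N)) where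
  carrier := {w | ∀ i, HasWeakPartial i w.1 (w.2 i)}
  zero_mem' := fun _ => HasWeakPartial.zero
  add_mem' := fun h h' i => (h i).add (h' i)
  smul_mem' := fun c _ h i => (h i).smul c

/-- The Sobolev space `H²(ℝ^N)`: an element is the tuple `(u, (∂_i u)_i, (∂_j ∂_i u)_{i,j})` of an
`L²` function and its weak partial derivatives of orders one and two in `L²`; the norm (the largest
of the `L²` norms of the entries) is equivalent to the usual one, and the tuple is determined by its
first entry. -/
def sobolevH2 (N : ℕ) : Submodule ℝ (L2 N × (Fin N → L2 N) × (Fin N → Fin N → L2 N)) where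
  carrier := {w | (∀ i, HasWeakPartial i w.1 (w.2.1 i)) ∧
    ∀ i j, HasWeakPartial j (w.2.1 i) (w.2.2 i j)}
  zero_mem' := ⟨fun _ => HasWeakPartial.zero, fun _ _ => HasWeakPartial.zero⟩
  add_mem' := fun h h' =>
    ⟨fun i => (h.1 i).add (h'.1 i), fun i j => (h.2 i j).add (h'.2 i j)⟩
  smul_mem' := fun c _ h => ⟨fun i => (h.1 i).smul c, fun i j => (h.2 i j).smul c⟩

/-- `H¹(ℝ^N)` as a normed space. -/
abbrev H1 (N : ℕ) : Type := sobolevH1 N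

/-- `H²(ℝ^N)` as a normed space. -/
abbrev H2 (N : ℕ) : Type := sobolevH2 N

/-- The inclusion `H¹ ⊂ L²`. -/
def H1.toL2 {N : ℕ} (w : H1 N) : L2 N := w.1.1

/-- The inclusion `H² ⊂ L²`. -/
def H2.toL2 {N : ℕ} (w : H2 N) : L2 N := w.1.1

/-- The inclusion `H² ⊂ H¹`. -/
def H2.toH1 {N : ℕ} (w : H2 N) : H1 N := ⟨(w.1.1, w.1.2.1), w.2.1⟩

/-- The Laplacian `Δ : H² → L²`. -/
def H2.laplacian {N : ℕ} (w : H2 N) : L2 N := ∑ i, w.1.2.2 i i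

/-- The curve `u` (with values in `H²`) is a strong solution in `(0, T)` of
`∂ₜ²u - a(t)² Δu + b(t) ∂ₜu = |u|^p`, `u(0) = f`, `∂ₜu(0) = g`.
Only the values `u t` for `0 ≤ t < T` matter. -/
structure IsStrongSolution {N : ℕ} (a b : ℝ → ℝ) (p : ℝ) (f : H2 N) (g : H1 N) (T : ℝ)
    (u : ℝ → H2 N) : Prop where
  /-- `u ∈ C([0,T); H²)` -/
  continuous_H2 : ContinuousOn u (Ico 0 T)
  /-- `u ∈ C¹([0,T); H¹)` -/
  contDiff_H1 : ContDiffOn ℝ 1 (fun t => (u t).toH1) (Ico 0 T)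
  /-- `u ∈ C²([0,T); L²)` -/
  contDiff_L2 : ContDiffOn ℝ 2 (fun t => (u t).toL2) (Ico 0 T)
  /-- `u` takes values in `L^{2p}` -/
  memLp : ∀ t ∈ Ico 0 T, MemLp (u t).toL2 (ENNReal.ofReal (2 * p)) volume
  /-- `u : [0,T) → L^{2p}` is continuous -/
  continuous_Lp : ∀ t ∈ Ico 0 T,
    Tendsto (fun s => eLpNorm ((u s).toL2 - (u t).toL2) (ENNReal.ofReal (2 * p)) volume)
      (𝓝[Ico 0 T] t) (𝓝 0)
  /-- the equation, as an equality in `L²` for every `t ∈ [0,T)` -/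
  equation : ∀ t ∈ Ico 0 T,
    (iteratedDerivWithin 2 (fun s => (u s).toL2) (Ico 0 T) t - (a t) ^ 2 • (u t).laplacian
      + b t • derivWithin (fun s => (u s).toL2) (Ico 0 T) t : L2 N)
      =ᵐ[volume] fun x => |(u t).toL2 x| ^ p
  /-- `u(0) = f` -/
  initial_value : u 0 = f
  /-- `∂ₜu(0) = g` -/
  initial_velocity : derivWithin (fun s => (u s).toH1) (Ico 0 T) 0 = g

/-- The lifespan of the solution of the Cauchy problem with initial data `(εf, εg)`: the supremum,
in `[0, ∞]`, of all `T > 0` such that there is a strong solution in `(0, T)`. -/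
def lifespan {N : ℕ} (a b : ℝ → ℝ) (p : ℝ) (f : H2 N) (g : H1 N) (ε : ℝ) : ℝ≥0∞ :=
  sSup (ENNReal.ofReal ''
    {T : ℝ | 0 < T ∧ ∃ u : ℝ → H2 N, IsStrongSolution a b p (ε • f) (ε • g) T u})

/-- `0 < a ∈ C²([0,∞))` and `0 ≤ b ∈ C¹([0,∞)) ∩ L¹((0,∞))`. -/
structure AdmissibleCoeff (a b : ℝ → ℝ) : Prop where
  a_pos : ∀ t, 0 ≤ t → 0 < a t
  a_contDiff : ContDiffOn ℝ 2 a (Ici 0)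
  b_nonneg : ∀ t, 0 ≤ t → 0 ≤ b t
  b_contDiff : ContDiffOn ℝ 1 b (Ici 0)
  b_integrable : IntegrableOn b (Ioi 0)

/-- The quadratic function
`γ(ν, α; p) = 2 + (ν + 1 - 3α/(1+α)) p - (ν - 1 + α/(1+α)) p²`. -/
def gammaHWY (ν α p : ℝ) : ℝ :=
  2 + (ν + 1 - 3 * α / (1 + α)) * p - (ν - 1 + α / (1 + α)) * p ^ 2

/-- The exponent `p_HWY(ν, α) = sup {p > 1 ; γ(ν, α; p) > 0}`, as an extended real number
(it may be `+∞`). -/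
def pHWY (ν α : ℝ) : EReal :=
  sSup ((fun p : ℝ => (p : EReal)) '' {p : ℝ | 1 < p ∧ 0 < gammaHWY ν α p})

end SemilinearWave

end

open SemilinearWave

/-!
A solution is compared with two families of averages, against an exponentially growing eigenfunction
of the Laplacian and against the constant one, and the two resulting bounds for the nonlinear mass
`U(t) = ∫ |u(t)| ^ p` are incompatible for large `t`.

*Finite speed of propagation.* A strong solution vanishes for `|x| > r₀ + ∫₀ᵗ a`
(`IsStrongSolution.ae_eq_zero`). This comes from energies weighted by the square of
`exp (-λ √(η² + |x - x₀|²))`, which grow at most like `exp (2 λ ∫ a)` up to lower order terms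
(`IsStrongSolution.exists_energy_le`), in the limit `λ → ∞`. The nonlinear term is of lower order
because multiplication by `|u| ^ (p - 1)` maps `H¹` to `L²`, with a bound that survives the weight
(`exists_eLpNorm_weight_mul_rpow_le`); this is where `p ≤ (N - 2) / (N - 4)` is used. As a
consequence the equation may be tested with smooth functions of arbitrary growth
(`IsStrongSolution.exists_moment_deriv`).

*Lower bound.* Let `φ` be the positive radial solution of `Δ φ = λ² φ`, which behaves like
`|x| ^ (-(N - 1) / 2) exp (λ |x|)`. The moment `H = ∫ u φ` satisfies `H'' + b H' ≥ λ² a² H`, and so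
it grows at least at the WKB rate `a ^ (-1/2) exp (λ ∫ a)`, provided that `λ` is large
(`exists_growth`). By Hölder's inequality `H ≤ U ^ (1/p) (∫ φ ^ q) ^ (1/q)`, where `q = p / (p - 1)`
and the last integral is over the cone of influence. The exponentials cancel, and what remains is
`U(t) ≥ c ε ^ p t ^ (-p θ)` with `θ = α / 2 + (1 + α) (N - 1) (1 / q - 1 / 2)`
(`exists_mass_lower_bound`).

*Upper bound.* The total mass `F = ∫ u` satisfies `F'' + b F' = U` and
`F ≤ U ^ (1/p) (C t ^ ((1 + α) N)) ^ (1/q)`. Integration against a power of the remaining time shows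
that any lower bound for `U` on `[T / 4, T / 2]` is at most `C T ^ ((1 + α) N - 2 q)`
(`exists_average_le`, `exists_mass_upper_bound`).

Together the bounds give `ε ^ p ≤ C T ^ (-κ)` with `κ = (1 + α) γ(N, α; p) / (2 (p - 1))`, which is
the estimate of the lifespan (`exists_time_le`). The condition `p < p_HWY` amounts to `γ(p) > 0`
because `γ(1) > 0`, and `γ` is either concave or positive on all of `[1, ∞)` (`lt_pHWY_iff`).
-/

namespace SemilinearWave

variable {N : ℕ}

/-! ### Classical partial derivatives and test functions -/

theorem partialDeriv_mul {i : Fin N} {φ ψ : Space N → ℝ} {x : Space N}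
    (hφ : DifferentiableAt ℝ φ x) (hψ : DifferentiableAt ℝ ψ x) :
    partialDeriv i (fun y => φ y * ψ y) x
      = partialDeriv i φ x * ψ x + φ x * partialDeriv i ψ x := by
  unfold partialDeriv
  rw [fderiv_fun_mul hφ hψ]
  simp only [add_apply, smul_apply, smul_eq_mul]
  ring

theorem partialDeriv_add {i : Fin N} {φ ψ : Space N → ℝ} {x : Space N}
    (hφ : DifferentiableAt ℝ φ x) (hψ : DifferentiableAt ℝ ψ x) :
    partialDeriv i (fun y => φ y + ψ y) x = partialDeriv i φ x + partialDeriv i ψ x := by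
  unfold partialDeriv
  rw [fderiv_fun_add hφ hψ]
  rfl

theorem contDiff_partialDeriv {i : Fin N} {φ : Space N → ℝ} (hφ : ContDiff ℝ ∞ φ) :
    ContDiff ℝ ∞ (partialDeriv i φ) :=
  (hφ.fderiv_right (m := ∞) (by simp)).clm_apply contDiff_const

/-! ### Mollification -/

/-- The mollification `ρ ∗ u`. -/
noncomputable def mollify (ρ u : Space N → ℝ) : Space N → ℝ :=
  fun x => ∫ t, ρ t * u (x - t)

theorem mollify_eq_convolution (ρ u : Space N → ℝ) :
    mollify ρ u = convolution ρ u (ContinuousLinearMap.lsmul ℝ ℝ) volume := by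
  ext x
  simp [mollify, convolution_def]

theorem mollify_eq_swap (ρ u : Space N → ℝ) (x : Space N) :
    mollify ρ u x = ∫ y, u y * ρ (x - y) := by
  rw [mollify_eq_convolution, convolution_eq_swap]
  simp [mul_comm]

theorem locallyIntegrable_L2 (u : L2 N) : LocallyIntegrable u :=
  (Lp.memLp u).locallyIntegrable (by norm_num)

theorem contDiff_mollify {ρ : Space N → ℝ} (hρ : ContDiff ℝ ∞ ρ) (hc : HasCompactSupport ρ)
    (u : L2 N) : ContDiff ℝ ∞ (mollify ρ u) := by
  rw [mollify_eq_convolution]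
  exact hc.contDiff_convolution_left _ hρ (locallyIntegrable_L2 u)

/-- Weak derivatives commute with mollification. -/
theorem partialDeriv_mollify {ρ : Space N → ℝ} (hρ : ContDiff ℝ ∞ ρ) (hc : HasCompactSupport ρ)
    {i : Fin N} {u v : L2 N} (h : HasWeakPartial i u v) (x : Space N) :
    partialDeriv i (mollify ρ u) x = mollify ρ v x := by
  have h1 := hc.hasFDerivAt_convolution_left (μ := volume) (ContinuousLinearMap.lsmul ℝ ℝ)
    (hρ.of_le (by simp)) (locallyIntegrable_L2 u) x
  have hcd : Continuous (fderiv ℝ ρ) := hρ.continuous_fderiv (by simp)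
  have h2 : partialDeriv i (mollify ρ u) x = ∫ y, u y * partialDeriv i ρ (x - y) := by
    unfold partialDeriv
    rw [mollify_eq_convolution, h1.fderiv, convolution_eq_swap,
      ContinuousLinearMap.integral_apply]
    · simp [mul_comm]
    · have := (hc.fderiv ℝ).convolutionExists_left
        (L := ContinuousLinearMap.precompL (Space N) (ContinuousLinearMap.lsmul ℝ ℝ))
        (μ := volume) hcd (locallyIntegrable_L2 u) x
      exact this.integrable_swap
  rw [h2, mollify_eq_swap]
  have h3 := h (fun y => ρ (x - y)) (hρ.comp (contDiff_const.sub contDiff_id))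
    (hc.comp_homeomorph (Homeomorph.subLeft x))
  have h4 : ∀ y, partialDeriv i (fun y => ρ (x - y)) y = - partialDeriv i ρ (x - y) := by
    intro y
    have hd : HasFDerivAt (fun y => ρ (x - y)) ((fderiv ℝ ρ (x - y)).comp
        (-(ContinuousLinearMap.id ℝ (Space N)))) y :=
      ((hρ.differentiable (by simp)) (x - y)).hasFDerivAt.comp y
        ((hasFDerivAt_id y).const_sub x)
    unfold partialDeriv
    rw [hd.fderiv]
    simp
  simp only [h4, mul_neg, integral_neg, neg_inj] at h3
  exact h3

/-- If all translates of `u` by vectors of the support of `ρ` are `δ`-close to `u` in `L²`, so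
is `ρ ∗ u`. -/
theorem eLpNorm_mollify_sub_le {ρ : Space N → ℝ} (hρ : Continuous ρ) (hc : HasCompactSupport ρ)
    (h0 : ∀ x, 0 ≤ ρ x) (h1 : ∫ x, ρ x = 1) (u : L2 N) {δ : ℝ≥0∞}
    (hδ : ∀ h, ρ h ≠ 0 → eLpNorm (fun x => u (x - h) - u x) 2 volume ≤ δ) :
    eLpNorm (fun x => mollify ρ u x - u x) 2 volume ≤ δ := by
  have hρi : Integrable ρ := hρ.integrable_of_hasCompactSupport hc
  have hl1 : ∫⁻ h, ENNReal.ofReal (ρ h) = 1 := by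
    rw [← ofReal_integral_eq_lintegral_ofReal hρi (ae_of_all _ h0), h1, ENNReal.ofReal_one]
  have hum : StronglyMeasurable (u : Space N → ℝ) := Lp.stronglyMeasurable u
  have hsm : Measurable fun q : Space N × Space N => u (q.1 - q.2) - u q.1 :=
    (hum.measurable.comp (measurable_fst.sub measurable_snd)).sub
      (hum.measurable.comp measurable_fst)
  have hgm : Measurable fun q : Space N × Space N =>
      ENNReal.ofReal (ρ q.2) * ‖u (q.1 - q.2) - u q.1‖ₑ ^ (2 : ℝ) :=
    (hρ.measurable.comp measurable_snd).ennreal_ofReal.mul (hsm.enorm.pow_const _)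
  have key : ∀ x, ‖mollify ρ u x - u x‖ₑ ^ (2 : ℝ)
      ≤ ∫⁻ h, ENNReal.ofReal (ρ h) * ‖u (x - h) - u x‖ₑ ^ (2 : ℝ) := by
    intro x
    have hi : Integrable fun h => ρ h * u (x - h) := by
      have := hc.convolutionExists_left (μ := volume) (ContinuousLinearMap.lsmul ℝ ℝ) hρ
        (locallyIntegrable_L2 u) x
      simpa [ConvolutionExistsAt] using this
    have e1 : mollify ρ u x - u x = ∫ h, ρ h * (u (x - h) - u x) := by
      simp only [mul_sub]
      rw [integral_sub hi (hρi.mul_const _), integral_mul_const, h1, one_mul]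
      rfl
    have e2 : ‖mollify ρ u x - u x‖ₑ ≤ ∫⁻ h, ENNReal.ofReal (ρ h) * ‖u (x - h) - u x‖ₑ := by
      rw [e1]
      refine (enorm_integral_le_lintegral_enorm _).trans (lintegral_mono fun h => ?_)
      rw [enorm_mul, Real.enorm_of_nonneg (h0 h)]
    have hx : Measurable fun h => ‖u (x - h) - u x‖ₑ :=
      (hsm.comp (measurable_const.prodMk measurable_id)).enorm
    have hr : Measurable fun h => ENNReal.ofReal (ρ h) ^ (1 / 2 : ℝ) :=
      hρ.measurable.ennreal_ofReal.pow_const _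
    have sq : ∀ c : ℝ≥0∞, c ^ (1 / 2 : ℝ) * c ^ (1 / 2 : ℝ) = c := by
      intro c
      rw [← ENNReal.rpow_add_of_nonneg _ _ (by norm_num) (by norm_num)]
      norm_num
    have e3 := ENNReal.lintegral_mul_le_Lp_mul_Lq volume Real.HolderConjugate.two_two
      hr.aemeasurable (hr.mul hx).aemeasurable
    have e4 : ∀ h, ((fun h => ENNReal.ofReal (ρ h) ^ (1 / 2 : ℝ)) *
        fun h => ENNReal.ofReal (ρ h) ^ (1 / 2 : ℝ) * ‖u (x - h) - u x‖ₑ) h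
        = ENNReal.ofReal (ρ h) * ‖u (x - h) - u x‖ₑ := by
      intro h
      simp only [Pi.mul_apply]
      rw [← mul_assoc, sq]
    have e5 : ∀ c : ℝ≥0∞, (c ^ (1 / 2 : ℝ)) ^ (2 : ℝ) = c := by
      intro c
      rw [← ENNReal.rpow_mul]; norm_num
    simp only [Pi.mul_apply] at e3
    simp only [Pi.mul_apply] at e4
    simp_rw [e4, e5, hl1, ENNReal.one_rpow, one_mul,
      ENNReal.mul_rpow_of_nonneg _ _ (zero_le_two (α := ℝ)), e5] at e3
    calc ‖mollify ρ u x - u x‖ₑ ^ (2 : ℝ)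
        ≤ ((∫⁻ h, ENNReal.ofReal (ρ h) * ‖u (x - h) - u x‖ₑ ^ (2 : ℝ)) ^ (1 / 2 : ℝ)) ^ (2 : ℝ) :=
          ENNReal.rpow_le_rpow (e2.trans e3) (by norm_num)
      _ = _ := e5 _
  have tw : ∀ f : Space N → ℝ, eLpNorm f 2 volume ^ (2 : ℝ) = ∫⁻ x, ‖f x‖ₑ ^ (2 : ℝ) := by
    intro f
    rw [eLpNorm_eq_lintegral_rpow_enorm_toReal (by norm_num) (by norm_num), ← ENNReal.rpow_mul]
    simp
  rw [← ENNReal.rpow_le_rpow_iff (z := 2) (by norm_num), tw]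
  calc ∫⁻ x, ‖mollify ρ u x - u x‖ₑ ^ (2 : ℝ)
      ≤ ∫⁻ x, ∫⁻ h, ENNReal.ofReal (ρ h) * ‖u (x - h) - u x‖ₑ ^ (2 : ℝ) :=
        lintegral_mono key
    _ = ∫⁻ h, ∫⁻ x, ENNReal.ofReal (ρ h) * ‖u (x - h) - u x‖ₑ ^ (2 : ℝ) :=
        lintegral_lintegral_swap hgm.aemeasurable
    _ = ∫⁻ h, ENNReal.ofReal (ρ h) * eLpNorm (fun x => u (x - h) - u x) 2 volume ^ (2 : ℝ) := by
        refine lintegral_congr fun h => ?_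
        rw [lintegral_const_mul' _ _ ENNReal.ofReal_ne_top, tw]
    _ ≤ ∫⁻ h, ENNReal.ofReal (ρ h) * δ ^ (2 : ℝ) := by
        refine lintegral_mono fun h => ?_
        by_cases hh : ρ h = 0
        · simp [hh]
        · gcongr
          exact hδ h hh
    _ = δ ^ (2 : ℝ) := by
        rw [lintegral_mul_const _ hρ.measurable.ennreal_ofReal, hl1, one_mul]

/-- Continuity of translations in `L²`. -/
theorem tendsto_eLpNorm_translate_sub (u : L2 N) :
    Tendsto (fun h : Space N => eLpNorm (fun x => u (x - h) - u x) 2 volume) (𝓝 0) (𝓝 0) := by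
  let τ : Space N → C(Space N, Space N) := fun h => ⟨fun x => x - h, by fun_prop⟩
  have hτ : Continuous τ := by
    refine ContinuousMap.continuous_of_continuous_uncurry _ ?_
    change Continuous fun q : Space N × Space N => q.2 - q.1
    fun_prop
  have hm : ∀ h, MeasurePreserving (τ h) volume volume :=
    fun h => measurePreserving_sub_right volume h
  have hc : Continuous fun h => Lp.compMeasurePreserving (τ h) (hm h) u :=
    Continuous.compMeasurePreservingLp continuous_const hτ hm (by norm_num)
  have h0 := (hc.tendsto 0)
  rw [tendsto_iff_dist_tendsto_zero] at h0
  have h0' := ENNReal.tendsto_ofReal h0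
  rw [ENNReal.ofReal_zero] at h0'
  refine h0'.congr fun h => ?_
  rw [← edist_dist, Lp.edist_def]
  refine eLpNorm_congr_ae ?_
  filter_upwards [Lp.coeFn_compMeasurePreserving u (hm h),
    Lp.coeFn_compMeasurePreserving u (hm 0)] with x hx hx0
  simp only [Pi.sub_apply]
  rw [hx, hx0]
  simp [τ]

/-! ### Density of test functions in the Sobolev spaces -/

/-- A smooth bump function supported in the ball of radius `1 / (n + 1)`, of integral one. -/
noncomputable def mollifierBump (N n : ℕ) : ContDiffBump (0 : Space N) where
  rIn := 1 / (2 * (n + 1))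
  rOut := 1 / (n + 1)
  rIn_pos := by positivity
  rIn_lt_rOut := by
    apply one_div_lt_one_div_of_lt <;> [positivity; skip]
    have : (0 : ℝ) ≤ n := n.cast_nonneg
    linarith

/-- The kernels of a standard sequence of mollifiers. -/
noncomputable def mollifier (N n : ℕ) : Space N → ℝ := (mollifierBump N n).normed volume

/-- A smooth bump function equal to `1` on the unit ball. -/
noncomputable def unitBump (N : ℕ) : ContDiffBump (0 : Space N) where
  rIn := 1
  rOut := 2
  rIn_pos := one_pos
  rIn_lt_rOut := one_lt_two

/-- Smooth cutoff functions, equal to `1` on the ball of radius `n + 1`. -/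
noncomputable def cutoff (N n : ℕ) : Space N → ℝ :=
  fun x => unitBump N ((n + 1 : ℝ)⁻¹ • x)

theorem contDiff_mollifier (n : ℕ) : ContDiff ℝ ∞ (mollifier N n) :=
  (mollifierBump N n).contDiff_normed

theorem hasCompactSupport_mollifier (n : ℕ) : HasCompactSupport (mollifier N n) :=
  (mollifierBump N n).hasCompactSupport_normed

theorem contDiff_unitBump : ContDiff ℝ ∞ (unitBump N) := (unitBump N).contDiff

theorem contDiff_cutoff (n : ℕ) : ContDiff ℝ ∞ (cutoff N n) :=
  contDiff_unitBump.comp (contDiff_const_smul _)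

theorem hasCompactSupport_cutoff (n : ℕ) : HasCompactSupport (cutoff N n) :=
  (unitBump N).hasCompactSupport.comp_smul (by positivity)

theorem cutoff_eq_one {n : ℕ} {x : Space N} (hx : ‖x‖ ≤ n + 1) : cutoff N n x = 1 := by
  apply (unitBump N).one_of_mem_closedBall
  have : (0 : ℝ) < n + 1 := by positivity
  rw [mem_closedBall_zero_iff, norm_smul, norm_inv, Real.norm_of_nonneg this.le]
  change _ ≤ (1 : ℝ)
  rw [inv_mul_le_iff₀ this]
  simpa using hx

theorem cutoff_nonneg (n : ℕ) (x : Space N) : 0 ≤ cutoff N n x := (unitBump N).nonneg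

theorem cutoff_le_one (n : ℕ) (x : Space N) : cutoff N n x ≤ 1 := (unitBump N).le_one

theorem partialDeriv_comp_smul {i : Fin N} {φ : Space N → ℝ} (hφ : Differentiable ℝ φ) (c : ℝ)
    (x : Space N) : partialDeriv i (fun y => φ (c • y)) x = c * partialDeriv i φ (c • x) := by
  have hd : HasFDerivAt (fun y : Space N => φ (c • y)) ((fderiv ℝ φ (c • x)).comp
      (c • ContinuousLinearMap.id ℝ (Space N))) x :=
    (hφ (c • x)).hasFDerivAt.comp x ((hasFDerivAt_id x).const_smul c)
  unfold partialDeriv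
  rw [hd.fderiv]
  simp

theorem partialDeriv_cutoff (i : Fin N) (n : ℕ) :
    partialDeriv i (cutoff N n)
      = fun x => (n + 1 : ℝ)⁻¹ * partialDeriv i (unitBump N) ((n + 1 : ℝ)⁻¹ • x) := by
  ext x
  exact partialDeriv_comp_smul (contDiff_unitBump.differentiable (by simp)) _ x

theorem partialDeriv_partialDeriv_cutoff (i j : Fin N) (n : ℕ) (x : Space N) :
    partialDeriv j (partialDeriv i (cutoff N n)) x = (n + 1 : ℝ)⁻¹ * ((n + 1 : ℝ)⁻¹ *
      partialDeriv j (partialDeriv i (unitBump N)) ((n + 1 : ℝ)⁻¹ • x)) := by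
  have hd : Differentiable ℝ (partialDeriv i (unitBump N)) :=
    (contDiff_partialDeriv contDiff_unitBump).differentiable (by simp)
  rw [partialDeriv_cutoff, ← partialDeriv_comp_smul hd]
  unfold partialDeriv
  rw [fderiv_const_mul]
  · simp
  · exact (hd.comp (differentiable_id.const_smul ((n + 1 : ℝ)⁻¹))) x

theorem tendsto_eLpNorm_mollify_sub (u : L2 N) :
    Tendsto (fun n => eLpNorm (fun x => mollify (mollifier N n) u x - u x) 2 volume)
      atTop (𝓝 0) := by
  rw [ENNReal.tendsto_nhds_zero]
  intro δ hδ
  have h := ENNReal.tendsto_nhds_zero.1 (tendsto_eLpNorm_translate_sub u) δ hδ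
  obtain ⟨r, hr, hball⟩ := Metric.eventually_nhds_iff_ball.1 h
  obtain ⟨n₀, hn₀⟩ := exists_nat_one_div_lt hr
  filter_upwards [eventually_ge_atTop n₀] with n hn
  refine eLpNorm_mollify_sub_le (contDiff_mollifier n).continuous (hasCompactSupport_mollifier n)
    (mollifierBump N n).nonneg_normed (mollifierBump N n).integral_normed u fun h hh => hball h ?_
  have h2 : h ∈ Function.support ((mollifierBump N n).normed volume) := hh
  rw [ContDiffBump.support_normed_eq] at h2
  refine Metric.ball_subset_ball ?_ h2
  refine le_trans ?_ hn₀.le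
  change 1 / ((n : ℝ) + 1) ≤ 1 / (n₀ + 1)
  have : (n₀ : ℝ) ≤ n := by exact_mod_cast hn
  gcongr

theorem aestronglyMeasurable_mollify (n : ℕ) (u : L2 N) :
    AEStronglyMeasurable (mollify (mollifier N n) u) volume :=
  (contDiff_mollify (contDiff_mollifier n) (hasCompactSupport_mollifier n) u).continuous
    |>.aestronglyMeasurable

/-- Bounded multipliers converging to `1` do not change `L²` limits. -/
theorem tendsto_eLpNorm_mul_sub {c m : ℕ → Space N → ℝ} (hc : ∀ n, Continuous (c n))
    (hb : ∀ n x, |c n x| ≤ 1) (h1 : ∀ x, Tendsto (fun n => c n x) atTop (𝓝 1))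
    (hm : ∀ n, AEStronglyMeasurable (m n) volume) (u : L2 N)
    (h : Tendsto (fun n => eLpNorm (fun x => m n x - u x) 2 volume) atTop (𝓝 0)) :
    Tendsto (fun n => eLpNorm (fun x => c n x * m n x - u x) 2 volume) atTop (𝓝 0) := by
  have hu := Lp.aestronglyMeasurable u
  have h2 : Tendsto (fun n => eLpNorm (fun x => (c n x - 1) * u x) 2 volume) atTop (𝓝 0) := by
    have tw : ∀ f : Space N → ℝ, eLpNorm f 2 volume = (∫⁻ x, ‖f x‖ₑ ^ (2 : ℝ)) ^ (1 / 2 : ℝ) := by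
      intro f
      rw [eLpNorm_eq_lintegral_rpow_enorm_toReal (by norm_num) (by norm_num)]
      simp
    simp_rw [tw]
    have hz : (0 : ℝ≥0∞) = 0 ^ (1 / 2 : ℝ) := by simp
    rw [hz]
    refine Tendsto.comp (ENNReal.continuous_rpow_const.tendsto 0) ?_
    have hfin : ∫⁻ x, ‖2 * u x‖ₑ ^ (2 : ℝ) ≠ ⊤ := by
      have h3 : MemLp (fun x => 2 * u x) 2 volume := (Lp.memLp u).const_mul 2
      have h4 := lintegral_rpow_enorm_lt_top_of_eLpNorm_lt_top (by norm_num) (by norm_num)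
        h3.eLpNorm_lt_top
      simpa using h4.ne
    have := tendsto_lintegral_of_dominated_convergence' (μ := (volume : Measure (Space N)))
      (F := fun n x => ‖(c n x - 1) * u x‖ₑ ^ (2 : ℝ)) (f := fun _ => 0)
      (fun x => ‖2 * u x‖ₑ ^ (2 : ℝ))
      (fun n => ((((hc n).sub continuous_const).aestronglyMeasurable.mul hu).enorm.pow_const _))
      (fun n => ae_of_all _ fun x => ?_) hfin (ae_of_all _ fun x => ?_)
    · simpa using this
    · dsimp only
      gcongr
      rw [enorm_mul, enorm_mul]
      gcongr
      rw [← ofReal_norm, ← ofReal_norm]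
      apply ENNReal.ofReal_le_ofReal
      have := hb n x
      rw [Real.norm_eq_abs, Real.norm_eq_abs, abs_two]
      have := abs_le.1 this
      rw [abs_le]
      constructor <;> linarith
    · have h5 : Tendsto (fun n => (c n x - 1) * u x) atTop (𝓝 ((1 - 1) * u x)) :=
        ((h1 x).sub_const 1).mul_const _
      have h6 := (ENNReal.continuous_rpow_const (y := 2)).tendsto _ |>.comp
        ((continuous_enorm.tendsto _).comp h5)
      simpa [Function.comp_def] using h6
  refine tendsto_of_tendsto_of_tendsto_of_le_of_le tendsto_const_nhds
    (by simpa using h.add h2) (fun n => zero_le) fun n => ?_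
  have e : (fun x => c n x * m n x - u x)
      = (fun x => c n x * (m n x - u x)) + fun x => (c n x - 1) * u x := by
    ext x; simp only [Pi.add_apply]; ring
  have hcm := (hc n).aestronglyMeasurable (μ := (volume : Measure (Space N)))
  rw [e]
  refine (eLpNorm_add_le (hcm.mul ((hm n).sub hu))
    ((hcm.sub aestronglyMeasurable_const).mul hu) (by norm_num)).trans (add_le_add_left ?_ _)
  refine eLpNorm_mono fun x => ?_
  simp only [Pi.mul_apply, Pi.sub_apply, norm_mul]
  exact mul_le_of_le_one_left (norm_nonneg _) (hb n x)

/-- Multipliers converging uniformly to `0` send `L²` convergent sequences to null sequences. -/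
theorem tendsto_eLpNorm_mul_zero {c m : ℕ → Space N → ℝ} {δ : ℕ → ℝ}
    (hb : ∀ n x, |c n x| ≤ δ n) (hδ : Tendsto δ atTop (𝓝 0))
    (hm : ∀ n, AEStronglyMeasurable (m n) volume) (u : L2 N)
    (h : Tendsto (fun n => eLpNorm (fun x => m n x - u x) 2 volume) atTop (𝓝 0)) :
    Tendsto (fun n => eLpNorm (fun x => c n x * m n x) 2 volume) atTop (𝓝 0) := by
  have hu := Lp.aestronglyMeasurable u
  have h2 : Tendsto (fun n => ENNReal.ofReal (δ n) *
      (eLpNorm (fun x => m n x - u x) 2 volume + eLpNorm u 2 volume)) atTop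
      (𝓝 (ENNReal.ofReal 0 * (0 + eLpNorm u 2 volume))) := by
    refine ENNReal.Tendsto.mul (ENNReal.tendsto_ofReal hδ) (Or.inr ?_)
      (h.add tendsto_const_nhds) (Or.inr (by simp))
    simpa using Lp.eLpNorm_ne_top u
  rw [ENNReal.ofReal_zero, zero_mul] at h2
  refine tendsto_of_tendsto_of_tendsto_of_le_of_le tendsto_const_nhds h2
    (fun n => zero_le) fun n => ?_
  have e : m n = (fun x => m n x - u x) + u := by ext x; simp
  have e2 : eLpNorm (m n) 2 volume
      ≤ eLpNorm (fun x => m n x - u x) 2 volume + eLpNorm u 2 volume := by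
    conv_lhs => rw [e]
    exact eLpNorm_add_le ((hm n).sub hu) hu (by norm_num)
  refine le_trans ?_ (mul_le_mul_right e2 _)
  refine eLpNorm_le_mul_eLpNorm_of_ae_le_mul (ae_of_all _ fun x => ?_) 2
  rw [norm_mul]
  gcongr
  exact hb n x

/-- Smooth compactly supported approximations of a square integrable function. -/
noncomputable def testApprox (n : ℕ) (u : L2 N) : Space N → ℝ :=
  fun x => cutoff N n x * mollify (mollifier N n) u x

theorem contDiff_testApprox (n : ℕ) (u : L2 N) : ContDiff ℝ ∞ (testApprox n u) :=
  (contDiff_cutoff n).mul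
    (contDiff_mollify (contDiff_mollifier n) (hasCompactSupport_mollifier n) u)

theorem hasCompactSupport_testApprox (n : ℕ) (u : L2 N) :
    HasCompactSupport (testApprox n u) :=
  (hasCompactSupport_cutoff n).mul_right

theorem tendsto_cutoff (x : Space N) : Tendsto (fun n => cutoff N n x) atTop (𝓝 1) := by
  obtain ⟨n₀, hn₀⟩ := exists_nat_ge ‖x‖
  refine tendsto_const_nhds.congr' ?_
  filter_upwards [eventually_ge_atTop n₀] with n hn
  have : (n₀ : ℝ) ≤ n := by exact_mod_cast hn
  exact (cutoff_eq_one (by linarith)).symm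

theorem tendsto_testApprox (u : L2 N) :
    Tendsto (fun n => eLpNorm (fun x => testApprox n u x - u x) 2 volume) atTop (𝓝 0) :=
  tendsto_eLpNorm_mul_sub (fun n => (contDiff_cutoff n).continuous)
    (fun n x => by rw [abs_of_nonneg (cutoff_nonneg n x)]; exact cutoff_le_one n x)
    tendsto_cutoff (fun n => aestronglyMeasurable_mollify n u) u (tendsto_eLpNorm_mollify_sub u)

theorem tendsto_const_mul_inv_nat (C : ℝ) :
    Tendsto (fun n : ℕ => C * (n + 1 : ℝ)⁻¹) atTop (𝓝 0) := by
  have := (tendsto_one_div_add_atTop_nhds_zero_nat (𝕜 := ℝ)).const_mul C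
  simpa using this

theorem tendsto_deriv_cutoff_mul (i : Fin N) (u : L2 N) :
    Tendsto (fun n => eLpNorm (fun x => partialDeriv i (cutoff N n) x *
      mollify (mollifier N n) u x) 2 volume) atTop (𝓝 0) := by
  obtain ⟨C, hC⟩ := (continuous_partialDeriv (i := i)
    (contDiff_unitBump (N := N))).bounded_above_of_compact_support
    (hasCompactSupport_partialDeriv (unitBump N).hasCompactSupport)
  refine tendsto_eLpNorm_mul_zero (δ := fun n => C * (n + 1 : ℝ)⁻¹) (fun n x => ?_)
    (tendsto_const_mul_inv_nat C) (fun n => aestronglyMeasurable_mollify n u) u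
    (tendsto_eLpNorm_mollify_sub u)
  have h0 : (0 : ℝ) ≤ (n + 1 : ℝ)⁻¹ := by positivity
  rw [partialDeriv_cutoff, abs_mul, abs_of_nonneg h0, mul_comm]
  exact mul_le_mul_of_nonneg_right (hC _) h0

theorem tendsto_deriv_deriv_cutoff_mul (i j : Fin N) (u : L2 N) :
    Tendsto (fun n => eLpNorm (fun x => partialDeriv j (partialDeriv i (cutoff N n)) x *
      mollify (mollifier N n) u x) 2 volume) atTop (𝓝 0) := by
  obtain ⟨C, hC⟩ := (continuous_partialDeriv (i := j) (contDiff_partialDeriv (i := i)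
    (contDiff_unitBump (N := N)))).bounded_above_of_compact_support
    (hasCompactSupport_partialDeriv (hasCompactSupport_partialDeriv
      (unitBump N).hasCompactSupport))
  refine tendsto_eLpNorm_mul_zero (δ := fun n => C * (n + 1 : ℝ)⁻¹) (fun n x => ?_)
    (tendsto_const_mul_inv_nat C) (fun n => aestronglyMeasurable_mollify n u) u
    (tendsto_eLpNorm_mollify_sub u)
  have h0 : (0 : ℝ) ≤ (n + 1 : ℝ)⁻¹ := by positivity
  have h1 : (n + 1 : ℝ)⁻¹ ≤ 1 := inv_le_one_of_one_le₀ (by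
    have : (0 : ℝ) ≤ n := n.cast_nonneg
    linarith)
  have h2 := hC ((n + 1 : ℝ)⁻¹ • x)
  rw [Real.norm_eq_abs] at h2
  rw [partialDeriv_partialDeriv_cutoff, abs_mul, abs_mul, abs_of_nonneg h0, mul_comm]
  refine mul_le_mul_of_nonneg_right ?_ h0
  exact (mul_le_of_le_one_left (abs_nonneg _) h1).trans h2

theorem partialDeriv_testApprox {i : Fin N} {u v : L2 N} (h : HasWeakPartial i u v) (n : ℕ) :
    partialDeriv i (testApprox n u) = fun x =>
      partialDeriv i (cutoff N n) x * mollify (mollifier N n) u x + testApprox n v x := by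
  ext x
  have h1 := contDiff_mollify (contDiff_mollifier n) (hasCompactSupport_mollifier n) u
  unfold testApprox
  rw [partialDeriv_mul ((contDiff_cutoff n).differentiable (by simp) x)
    (h1.differentiable (by simp) x),
    partialDeriv_mollify (contDiff_mollifier n) (hasCompactSupport_mollifier n) h]

theorem partialDeriv_partialDeriv_testApprox {i j : Fin N} {u v u' w : L2 N}
    (h : HasWeakPartial i u v) (h' : HasWeakPartial j u u') (h2 : HasWeakPartial j v w) (n : ℕ) :
    partialDeriv j (partialDeriv i (testApprox n u)) = fun x =>
      partialDeriv j (partialDeriv i (cutoff N n)) x * mollify (mollifier N n) u x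
        + partialDeriv i (cutoff N n) x * mollify (mollifier N n) u' x
        + (partialDeriv j (cutoff N n) x * mollify (mollifier N n) v x + testApprox n w x) := by
  ext x
  have hu := contDiff_mollify (contDiff_mollifier n) (hasCompactSupport_mollifier n) u
  have hc := contDiff_partialDeriv (i := i) (contDiff_cutoff (N := N) n)
  rw [partialDeriv_testApprox h, partialDeriv_add
    ((hc.mul hu).differentiable (by simp) x)
    ((contDiff_testApprox n v).differentiable (by simp) x),
    partialDeriv_testApprox h2, partialDeriv_mul (hc.differentiable (by simp) x)
      (hu.differentiable (by simp) x),
    partialDeriv_mollify (contDiff_mollifier n) (hasCompactSupport_mollifier n) h']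

theorem tendsto_eLpNorm_add_sub {c m : ℕ → Space N → ℝ}
    (hc : ∀ n, AEStronglyMeasurable (c n) volume)
    (hm : ∀ n, AEStronglyMeasurable (m n) volume) (u : L2 N)
    (h0 : Tendsto (fun n => eLpNorm (c n) 2 volume) atTop (𝓝 0))
    (h : Tendsto (fun n => eLpNorm (fun x => m n x - u x) 2 volume) atTop (𝓝 0)) :
    Tendsto (fun n => eLpNorm (fun x => c n x + m n x - u x) 2 volume) atTop (𝓝 0) := by
  refine tendsto_of_tendsto_of_tendsto_of_le_of_le tendsto_const_nhds
    (by simpa using h0.add h) (fun n => zero_le) fun n => ?_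
  have e : (fun x => c n x + m n x - u x) = c n + fun x => m n x - u x := by
    ext x; simp only [Pi.add_apply]; ring
  rw [e]
  exact eLpNorm_add_le (hc n) ((hm n).sub (Lp.aestronglyMeasurable u)) (by norm_num)

theorem tendsto_partialDeriv_testApprox {i : Fin N} {u v : L2 N} (h : HasWeakPartial i u v) :
    Tendsto (fun n => eLpNorm (fun x => partialDeriv i (testApprox n u) x - v x) 2 volume)
      atTop (𝓝 0) := by
  simp_rw [partialDeriv_testApprox h]
  exact tendsto_eLpNorm_add_sub
    (fun n => (continuous_partialDeriv (contDiff_cutoff n)).aestronglyMeasurable.mul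
      (aestronglyMeasurable_mollify n u))
    (fun n => (contDiff_testApprox n v).continuous.aestronglyMeasurable) v
    (tendsto_deriv_cutoff_mul i u) (tendsto_testApprox v)

theorem tendsto_partialDeriv_partialDeriv_testApprox {i j : Fin N} {u v u' w : L2 N}
    (h : HasWeakPartial i u v) (h' : HasWeakPartial j u u') (h2 : HasWeakPartial j v w) :
    Tendsto (fun n => eLpNorm (fun x =>
      partialDeriv j (partialDeriv i (testApprox n u)) x - w x) 2 volume) atTop (𝓝 0) := by
  simp_rw [partialDeriv_partialDeriv_testApprox h h' h2]
  have m1 : ∀ n, AEStronglyMeasurable (fun x => partialDeriv j (partialDeriv i (cutoff N n)) x *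
      mollify (mollifier N n) u x) volume := fun n =>
    (continuous_partialDeriv (contDiff_partialDeriv
      (contDiff_cutoff n))).aestronglyMeasurable.mul (aestronglyMeasurable_mollify n u)
  have m2 : ∀ (k : Fin N) (y : L2 N) (n : ℕ), AEStronglyMeasurable (fun x =>
      partialDeriv k (cutoff N n) x * mollify (mollifier N n) y x) volume := fun k y n =>
    (continuous_partialDeriv (contDiff_cutoff n)).aestronglyMeasurable.mul
      (aestronglyMeasurable_mollify n y)
  have m3 := fun n => (contDiff_testApprox n w).continuous.aestronglyMeasurable
    (μ := (volume : Measure (Space N)))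
  refine tendsto_eLpNorm_add_sub (fun n => (m1 n).add (m2 i u' n)) (fun n => (m2 j v n).add (m3 n))
    w ?_ (tendsto_eLpNorm_add_sub (m2 j v) m3 w (tendsto_deriv_cutoff_mul j v)
      (tendsto_testApprox w))
  refine tendsto_of_tendsto_of_tendsto_of_le_of_le tendsto_const_nhds
    (by simpa using (tendsto_deriv_deriv_cutoff_mul i j u).add (tendsto_deriv_cutoff_mul i u'))
    (fun n => zero_le) fun n => ?_
  exact eLpNorm_add_le (m1 n) (m2 i u' n) (by norm_num)

/-! ### Multiplication operators and integration by parts -/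

theorem memLp_mul_bounded {m : Space N → ℝ} (hm : Continuous m) {C : ℝ} (hb : ∀ x, |m x| ≤ C)
    (u : L2 N) : MemLp (fun x => m x * u x) 2 volume :=
  MemLp.of_le_mul (g := u) (c := C) (Lp.memLp u)
    (hm.aestronglyMeasurable.mul (Lp.aestronglyMeasurable u)) (ae_of_all _ fun x => by
      rw [norm_mul]; exact mul_le_mul_of_nonneg_right (hb x) (norm_nonneg _))

/-- Multiplication by a bounded continuous function, as an operator on `L²`. -/
noncomputable def mulL2 (m : Space N → ℝ) (hm : Continuous m) (C : ℝ) (hb : ∀ x, |m x| ≤ C) :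
    L2 N →L[ℝ] L2 N :=
  LinearMap.mkContinuous
    { toFun := fun u => (memLp_mul_bounded hm hb u).toLp _
      map_add' := fun u v => by
        rw [← MemLp.toLp_add]
        refine MemLp.toLp_congr _ _ ?_
        filter_upwards [Lp.coeFn_add u v] with x hx
        rw [hx, Pi.add_apply, Pi.add_apply, mul_add]
      map_smul' := fun c u => by
        rw [RingHom.id_apply, ← MemLp.toLp_const_smul]
        refine MemLp.toLp_congr _ _ ?_
        filter_upwards [Lp.coeFn_smul c u] with x hx
        rw [hx, Pi.smul_apply, Pi.smul_apply, smul_eq_mul, smul_eq_mul]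
        ring }
    C (fun u => by
      have hC : 0 ≤ C := (abs_nonneg _).trans (hb 0)
      refine Lp.norm_le_mul_norm_of_ae_le_mul ?_
      filter_upwards [MemLp.coeFn_toLp (memLp_mul_bounded hm hb u)] with x hx
      change ‖(MemLp.toLp (fun x => m x * u x) (memLp_mul_bounded hm hb u) : L2 N) x‖ ≤ _
      rw [hx, norm_mul]
      exact mul_le_mul_of_nonneg_right (hb x) (norm_nonneg _))

theorem coeFn_mulL2 {m : Space N → ℝ} (hm : Continuous m) {C : ℝ} (hb : ∀ x, |m x| ≤ C)
    (u : L2 N) : mulL2 m hm C hb u =ᵐ[volume] fun x => m x * u x :=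
  MemLp.coeFn_toLp (memLp_mul_bounded hm hb u)

theorem inner_L2_eq (u v : L2 N) : inner ℝ u v = ∫ x, u x * v x := by
  rw [L2.inner_def]
  refine integral_congr_ae (ae_of_all _ fun x => ?_)
  simp [mul_comm]

theorem integrable_mul_L2 (u v : L2 N) : Integrable fun x => u x * v x :=
  MemLp.integrable_mul (p := 2) (q := 2) (Lp.memLp u) (Lp.memLp v)

theorem inner_mulL2 {m m' : Space N → ℝ} (hm : Continuous m) {C : ℝ} (hb : ∀ x, |m x| ≤ C)
    (hm' : Continuous m') {C' : ℝ} (hb' : ∀ x, |m' x| ≤ C') (u v : L2 N) :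
    inner ℝ (mulL2 m hm C hb u) (mulL2 m' hm' C' hb' v)
      = ∫ x, m x * m' x * (u x * v x) := by
  rw [inner_L2_eq]
  refine integral_congr_ae ?_
  filter_upwards [coeFn_mulL2 hm hb u, coeFn_mulL2 hm' hb' v] with x h1 h2
  rw [h1, h2]
  ring

theorem norm_mulL2_le_mul {m m' : Space N → ℝ} (hm : Continuous m) {C : ℝ} (hb : ∀ x, |m x| ≤ C)
    (hm' : Continuous m') {C' : ℝ} (hb' : ∀ x, |m' x| ≤ C') {c : ℝ} (h : ∀ x, |m x| ≤ c * |m' x|)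
    (u : L2 N) : ‖mulL2 m hm C hb u‖ ≤ c * ‖mulL2 m' hm' C' hb' u‖ := by
  refine Lp.norm_le_mul_norm_of_ae_le_mul ?_
  filter_upwards [coeFn_mulL2 hm hb u, coeFn_mulL2 hm' hb' u] with x h1 h2
  rw [h1, h2, norm_mul, norm_mul, ← mul_assoc]
  exact mul_le_mul_of_nonneg_right (h x) (norm_nonneg _)

/-- The element of `L²` given by a test function. -/
noncomputable def testL2 (φ : Space N → ℝ) (hφ : ContDiff ℝ ∞ φ) (hc : HasCompactSupport φ) :
    L2 N :=
  (hφ.continuous.memLp_of_hasCompactSupport (p := 2) (μ := volume) hc).toLp φ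

theorem coeFn_testL2 {φ : Space N → ℝ} (hφ : ContDiff ℝ ∞ φ) (hc : HasCompactSupport φ) :
    testL2 φ hφ hc =ᵐ[volume] φ := MemLp.coeFn_toLp _

theorem inner_testL2 {φ : Space N → ℝ} (hφ : ContDiff ℝ ∞ φ) (hc : HasCompactSupport φ)
    (u : L2 N) : inner ℝ u (testL2 φ hφ hc) = ∫ x, u x * φ x := by
  rw [inner_L2_eq]
  refine integral_congr_ae ?_
  filter_upwards [coeFn_testL2 hφ hc] with x hx
  rw [hx]

theorem tendsto_testL2 {φ : ℕ → Space N → ℝ} (hφ : ∀ n, ContDiff ℝ ∞ (φ n))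
    (hc : ∀ n, HasCompactSupport (φ n)) {u : L2 N}
    (h : Tendsto (fun n => eLpNorm (fun x => φ n x - u x) 2 volume) atTop (𝓝 0)) :
    Tendsto (fun n => testL2 (φ n) (hφ n) (hc n)) atTop (𝓝 u) := by
  rw [tendsto_iff_edist_tendsto_0]
  refine h.congr fun n => ?_
  rw [Lp.edist_def]
  refine eLpNorm_congr_ae ?_
  filter_upwards [coeFn_testL2 (hφ n) (hc n)] with x hx
  rw [Pi.sub_apply, hx]

/-- Integration by parts for two functions of `H¹`, with the square of a smooth weight. -/
theorem inner_mulL2_weakPartial {i : Fin N} {u u' v v' : L2 N} (hu : HasWeakPartial i u u')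
    (hv : HasWeakPartial i v v') {σ : Space N → ℝ} (hσ : ContDiff ℝ ∞ σ) {C C' : ℝ}
    (hb : ∀ x, |σ x| ≤ C) (hb' : ∀ x, |partialDeriv i σ x| ≤ C') :
    inner ℝ (mulL2 σ hσ.continuous C hb u) (mulL2 σ hσ.continuous C hb v')
      = - inner ℝ (mulL2 σ hσ.continuous C hb u') (mulL2 σ hσ.continuous C hb v)
        - 2 * inner ℝ (mulL2 (partialDeriv i σ) (continuous_partialDeriv hσ) C' hb' u)
          (mulL2 σ hσ.continuous C hb v) := by
  set W := mulL2 σ hσ.continuous C hb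
  set D := mulL2 (partialDeriv i σ) (continuous_partialDeriv hσ) C' hb'
  have hφ := fun n => contDiff_testApprox n v
  have hc := fun n => hasCompactSupport_testApprox n v
  have hdφ := fun n => contDiff_partialDeriv (i := i) (hφ n)
  have hdc := fun n => hasCompactSupport_partialDeriv (i := i) (hc n)
  have t1 := tendsto_testL2 hφ hc (tendsto_testApprox v)
  have t2 := tendsto_testL2 hdφ hdc (tendsto_partialDeriv_testApprox hv)
  have key : ∀ n, inner ℝ (W u) (W (testL2 _ (hdφ n) (hdc n)))
      = - inner ℝ (W u') (W (testL2 _ (hφ n) (hc n)))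
        - 2 * inner ℝ (D u) (W (testL2 _ (hφ n) (hc n))) := by
    intro n
    set φ := testApprox n v
    rw [inner_mulL2, inner_mulL2, inner_mulL2]
    have cg : ∀ (c : Space N → ℝ) (w : L2 N) {ψ : Space N → ℝ} (hψ : ContDiff ℝ ∞ ψ)
        (hψc : HasCompactSupport ψ), ∫ x, c x * (w x * (testL2 ψ hψ hψc) x)
          = ∫ x, w x * (c x * ψ x) := by
      intro c w ψ hψ hψc
      refine integral_congr_ae ?_
      filter_upwards [coeFn_testL2 hψ hψc] with x hx
      rw [hx]; ring
    rw [cg, cg, cg]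
    have hT : ContDiff ℝ ∞ fun x => σ x * σ x * φ x := (hσ.mul hσ).mul (hφ n)
    have hTc : HasCompactSupport fun x => σ x * σ x * φ x := (hc n).mul_left
    have h1 := hu _ hT hTc
    have h2 : ∀ x, partialDeriv i (fun x => σ x * σ x * φ x) x
        = σ x * σ x * partialDeriv i φ x + 2 * (partialDeriv i σ x * σ x * φ x) := by
      intro x
      have d := hσ.differentiable (by simp) x
      rw [partialDeriv_mul (φ := fun x => σ x * σ x) (d.mul d) ((hφ n).differentiable (by simp) x),
        partialDeriv_mul d d]
      ring
    have i1 := integrable_L2_mul u (φ := fun x => σ x * σ x * partialDeriv i φ x)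
      ((hσ.continuous.mul hσ.continuous).mul (hdφ n).continuous) (hdc n).mul_left
    have i2 := integrable_L2_mul u (φ := fun x => partialDeriv i σ x * σ x * φ x)
      (((continuous_partialDeriv hσ).mul hσ.continuous).mul (hφ n).continuous) (hc n).mul_left
    have h3 : ∫ x, u x * partialDeriv i (fun x => σ x * σ x * φ x) x
        = (∫ x, u x * (σ x * σ x * partialDeriv i φ x))
          + 2 * ∫ x, u x * (partialDeriv i σ x * σ x * φ x) := by
      rw [← integral_const_mul, ← integral_add i1 (i2.const_mul 2)]
      refine integral_congr_ae (ae_of_all _ fun x => ?_)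
      simp only [h2]
      ring
    linarith
  have l1 : Tendsto (fun n => inner ℝ (W u) (W (testL2 _ (hdφ n) (hdc n)))) atTop
      (𝓝 (inner ℝ (W u) (W v'))) :=
    (tendsto_const_nhds (x := W u)).inner ((W.continuous.tendsto _).comp t2)
  have l2 : Tendsto (fun n => - inner ℝ (W u') (W (testL2 _ (hφ n) (hc n)))
        - 2 * inner ℝ (D u) (W (testL2 _ (hφ n) (hc n)))) atTop
      (𝓝 (- inner ℝ (W u') (W v) - 2 * inner ℝ (D u) (W v))) := by
    have a := (W.continuous.tendsto _).comp t1
    exact ((tendsto_const_nhds (x := W u')).inner a).neg.sub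
      (((tendsto_const_nhds (x := D u)).inner a).const_mul 2)
  exact tendsto_nhds_unique l1 (l2.congr fun n => (key n).symm)

/-- Weak derivatives vanish where the function does. -/
theorem HasWeakPartial.ae_eq_zero_of_isOpen {i : Fin N} {u v : L2 N} (h : HasWeakPartial i u v)
    {O : Set (Space N)} (hO : IsOpen O) (hu : ∀ᵐ x : Space N, x ∈ O → u x = 0) :
    ∀ᵐ x : Space N, x ∈ O → v x = 0 := by
  refine hO.ae_eq_zero_of_integral_contDiff_smul_eq_zero
    ((locallyIntegrable_L2 v).locallyIntegrableOn O) fun φ hφ hc hs => ?_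
  have h1 := h φ hφ hc
  have h2 : ∫ x, u x * partialDeriv i φ x = 0 := by
    rw [← integral_zero (Space N) ℝ (μ := volume)]
    refine integral_congr_ae ?_
    filter_upwards [hu] with x hx
    by_cases hxO : x ∈ O
    · rw [hx hxO, zero_mul]
    · have h0 : x ∉ tsupport φ := fun hx => hxO (hs hx)
      have h3 : fderiv ℝ φ x = 0 := image_eq_zero_of_notMem_tsupport
        fun hx => h0 (tsupport_fderiv_subset ℝ hx)
      simp [partialDeriv, h3]
  rw [h2] at h1
  simp only [smul_eq_mul]
  simp_rw [mul_comm (φ _)]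
  linarith

/-! ### Sobolev inequalities for test functions -/

/-- The `L²` norms of `φ` and of its partial derivatives of orders one and two are at most `R`. -/
def H2Bound (R : NNReal) (φ : Space N → ℝ) : Prop :=
  eLpNorm φ 2 volume ≤ R ∧ (∀ i, eLpNorm (partialDeriv i φ) 2 volume ≤ R) ∧
    ∀ i j, eLpNorm (partialDeriv j (partialDeriv i φ)) 2 volume ≤ R

section Fourier

open SchwartzMap LineDeriv FourierTransform

/-- The symbol of `1 - Δ`. -/
theorem fourier_sub_laplacian_apply (f : 𝓢(Space N, ℂ)) (ξ : Space N) :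
    𝓕 (f - ∑ i : Fin N,
        ∂_{EuclideanSpace.single i (1 : ℝ)} (∂_{EuclideanSpace.single i (1 : ℝ)} f)) ξ
      = ((1 + 4 * Real.pi ^ 2 * ‖ξ‖ ^ 2 : ℝ) : ℂ) * 𝓕 f ξ := by
  have hF : ∀ (g : 𝓢(Space N, ℂ)) (i : Fin N),
      𝓕 (∂_{EuclideanSpace.single i (1 : ℝ)} g) ξ = (2 * Real.pi * Complex.I) * (ξ i * 𝓕 g ξ) := by
    intro g i
    have ht : (fun x : Space N =>
        inner ℝ x (EuclideanSpace.single i (1 : ℝ))).HasTemperateGrowth := by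
      fun_prop
    rw [fourier_lineDerivOp_eq]
    have hi : inner ℝ ξ (EuclideanSpace.single i (1 : ℝ)) = ξ i := by
      rw [EuclideanSpace.inner_single_right]; simp
    simp [smulLeftCLM_apply_apply ht, hi]
  have hsum : 𝓕 (f - ∑ i : Fin N, ∂_{EuclideanSpace.single i (1 : ℝ)}
      (∂_{EuclideanSpace.single i (1 : ℝ)} f))
      = 𝓕 f - ∑ i : Fin N, 𝓕 (∂_{EuclideanSpace.single i (1 : ℝ)}
        (∂_{EuclideanSpace.single i (1 : ℝ)} f)) := by
    have := map_sub (fourierCLM ℂ 𝓢(Space N, ℂ)) f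
      (∑ i : Fin N, ∂_{EuclideanSpace.single i (1 : ℝ)} (∂_{EuclideanSpace.single i (1 : ℝ)} f))
    rw [map_sum] at this
    simpa using this
  rw [hsum, sub_apply, sum_apply]
  simp_rw [hF]
  have hn : ((‖ξ‖ ^ 2 : ℝ) : ℂ) = ∑ i, (ξ i : ℂ) * ξ i := by
    rw [EuclideanSpace.real_norm_sq_eq]
    push_cast
    exact Finset.sum_congr rfl fun i _ => by ring
  have h2 : ∀ i : Fin N, (2 * Real.pi * Complex.I) * (ξ i * ((2 * Real.pi * Complex.I) *
      (ξ i * 𝓕 f ξ))) = -(4 * Real.pi ^ 2 * 𝓕 f ξ) * (ξ i * ξ i : ℂ) := by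
    intro i
    linear_combination (4 * Real.pi ^ 2 * (ξ i : ℂ) * ξ i * 𝓕 f ξ) * Complex.I_sq
  simp_rw [h2]
  rw [← Finset.mul_sum, ← hn]
  push_cast
  ring

/-- The embedding `H² ⊂ L^∞` in dimension at most three, for Schwartz functions. -/
theorem exists_norm_le_integral_sub_laplacian (hN : N ≤ 3) : ∃ C : ℝ, 0 ≤ C ∧
    ∀ (f : 𝓢(Space N, ℂ)) (x : Space N), ‖f x‖ ≤ C * (∫ y, ‖(f - ∑ i : Fin N,
      ∂_{EuclideanSpace.single i (1 : ℝ)} (∂_{EuclideanSpace.single i (1 : ℝ)} f)) y‖ ^ (2 : ℝ))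
        ^ (1 / 2 : ℝ) := by
  refine ⟨(∫ y : Space N, (((1 : ℝ) + ‖y‖ ^ 2)⁻¹) ^ (2 : ℝ)) ^ (1 / 2 : ℝ), by positivity,
    fun f x => ?_⟩
  set g := f - ∑ i : Fin N,
    ∂_{EuclideanSpace.single i (1 : ℝ)} (∂_{EuclideanSpace.single i (1 : ℝ)} f)
  have h1 : ‖f x‖ ≤ ∫ ξ, ‖𝓕 f ξ‖ := by
    have e : f x = 𝓕 (𝓕 f) (-x) := by
      have e1 : f = 𝓕⁻ (𝓕 f) := (FourierTransform.fourierInv_fourier_eq f).symm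
      conv_lhs => rw [e1]
      rw [fourierInv_apply_eq]
      simp
    rw [e, ← norm_toLp_one]
    exact norm_fourier_apply_le_toLp_one _ _
  have h2 : ∀ ξ, ‖𝓕 f ξ‖ ≤ (1 + ‖ξ‖ ^ 2)⁻¹ * ‖𝓕 g ξ‖ := by
    intro ξ
    have hp : 0 < 1 + ‖ξ‖ ^ 2 := by positivity
    rw [fourier_sub_laplacian_apply, norm_mul, ← mul_assoc, Complex.norm_real,
      Real.norm_of_nonneg (by positivity)]
    refine le_mul_of_one_le_left (norm_nonneg _) ?_
    rw [inv_mul_eq_div, one_le_div hp]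
    have : 1 ≤ 4 * Real.pi ^ 2 := by nlinarith [Real.pi_gt_three]
    nlinarith [sq_nonneg ‖ξ‖]
  have m2 : MemLp (fun ξ => ‖𝓕 g ξ‖) (ENNReal.ofReal 2) volume := by
    have := ((𝓕 g).memLp 2 volume).norm
    simpa using this
  have m1 : MemLp (fun y : Space N => ((1 : ℝ) + ‖y‖ ^ 2)⁻¹) (ENNReal.ofReal 2) volume := by
    have hc : Continuous fun y : Space N => ((1 : ℝ) + ‖y‖ ^ 2)⁻¹ :=
      Continuous.inv₀ (by fun_prop) fun y => by positivity
    have hi := integrable_rpow_neg_one_add_norm_sq (E := Space N) (μ := volume) (r := 4) (by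
      rw [finrank_euclideanSpace_fin]
      have : (N : ℝ) ≤ 3 := by exact_mod_cast hN
      linarith)
    rw [show ENNReal.ofReal 2 = 2 by simp,
      memLp_two_iff_integrable_sq hc.aestronglyMeasurable]
    refine hi.congr (ae_of_all _ fun y => ?_)
    have hp : 0 < 1 + ‖y‖ ^ 2 := by positivity
    dsimp only
    rw [show (-4 / 2 : ℝ) = ((-2 : ℤ) : ℝ) by norm_num, Real.rpow_intCast, inv_pow, zpow_neg]
    rfl
  have h3 : ∫ ξ, ‖𝓕 g ξ‖ ^ (2 : ℝ) = ∫ y, ‖g y‖ ^ (2 : ℝ) := by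
    have := integral_norm_sq_fourier g
    simpa using this
  rw [← h3]
  have hi1 : Integrable fun ξ => (1 + ‖ξ‖ ^ 2)⁻¹ * ‖𝓕 g ξ‖ := by
    rw [show ENNReal.ofReal 2 = 2 by simp] at m1 m2
    exact MemLp.integrable_mul (p := 2) (q := 2) m1 m2
  calc ‖f x‖ ≤ ∫ ξ, ‖𝓕 f ξ‖ := h1
    _ ≤ ∫ ξ, (1 + ‖ξ‖ ^ 2)⁻¹ * ‖𝓕 g ξ‖ :=
        integral_mono (𝓕 f).integrable.norm hi1 h2
    _ ≤ _ := integral_mul_le_Lp_mul_Lq_of_nonneg Real.HolderConjugate.two_two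
        (ae_of_all _ fun ξ => by positivity) (ae_of_all _ fun ξ => by positivity) m1 m2

/-- The embedding `H² ⊂ L^∞` in dimension at most three, for test functions. -/
theorem exists_abs_le_of_H2Bound (hN : N ≤ 3) (R : NNReal) : ∃ C : ℝ, 0 ≤ C ∧
    ∀ φ : Space N → ℝ, ContDiff ℝ ∞ φ → HasCompactSupport φ → H2Bound R φ →
      ∀ x, |φ x| ≤ C := by
  obtain ⟨C, hC, h⟩ := exists_norm_le_integral_sub_laplacian hN
  refine ⟨C * (R + N * R), by positivity, fun φ hφ hc hR x => ?_⟩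
  let f : 𝓢(Space N, ℂ) := HasCompactSupport.toSchwartzMap (f := fun x => (φ x : ℂ))
    (hc.comp_left Complex.ofReal_zero) (Complex.ofRealCLM.contDiff.comp hφ)
  have hf : ∀ x, f x = (φ x : ℂ) := fun x => rfl
  have hderiv : ∀ (g : 𝓢(Space N, ℂ)) (ψ : Space N → ℝ) (_ : Differentiable ℝ ψ)
      (_ : ∀ x, g x = (ψ x : ℂ)) (i : Fin N) (x : Space N),
      (∂_{EuclideanSpace.single i (1 : ℝ)} g) x = (partialDeriv i ψ x : ℂ) := by
    intro g ψ hψ hg i x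
    rw [lineDerivOp_apply_eq_fderiv]
    have : (g : Space N → ℂ) = fun x => Complex.ofRealCLM (ψ x) := funext hg
    have hd : HasFDerivAt (fun x => Complex.ofRealCLM (ψ x))
        (Complex.ofRealCLM.comp (fderiv ℝ ψ x)) x :=
      Complex.ofRealCLM.hasFDerivAt.comp x (hψ x).hasFDerivAt
    rw [this, hd.fderiv]
    rfl
  have h2 := h f x
  have e : ∀ y, ‖(f - ∑ i : Fin N, ∂_{EuclideanSpace.single i (1 : ℝ)}
      (∂_{EuclideanSpace.single i (1 : ℝ)} f)) y‖
      = ‖φ y - ∑ i, partialDeriv i (partialDeriv i φ) y‖ := by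
    intro y
    rw [sub_apply, sum_apply]
    have : ∀ i : Fin N, (∂_{EuclideanSpace.single i (1 : ℝ)}
        (∂_{EuclideanSpace.single i (1 : ℝ)} f)) y
          = (partialDeriv i (partialDeriv i φ) y : ℂ) := fun i =>
      hderiv _ _ ((contDiff_partialDeriv hφ).differentiable (by simp))
        (hderiv f φ (hφ.differentiable (by simp)) hf i) i y
    simp_rw [this, hf]
    rw [← Complex.ofReal_sum, ← Complex.ofReal_sub, Complex.norm_real]
  simp_rw [e] at h2
  rw [hf, Complex.norm_real, Real.norm_eq_abs] at h2
  refine h2.trans (mul_le_mul_of_nonneg_left ?_ hC)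
  set G : Space N → ℝ := fun y => φ y - ∑ i, partialDeriv i (partialDeriv i φ) y
  have hm : ∀ i : Fin N, MemLp (partialDeriv i (partialDeriv i φ)) 2 volume := fun i =>
    (continuous_partialDeriv (contDiff_partialDeriv hφ)).memLp_of_hasCompactSupport
      (hasCompactSupport_partialDeriv (hasCompactSupport_partialDeriv hc))
  have hmφ : MemLp φ 2 volume := hφ.continuous.memLp_of_hasCompactSupport hc
  have hsm : MemLp (fun y => ∑ i, partialDeriv i (partialDeriv i φ) y) 2 volume :=
    memLp_finsetSum _ fun i _ => hm i
  have hG : MemLp G 2 volume := hmφ.sub hsm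
  have hle : eLpNorm G 2 volume ≤ ((R + N * R : NNReal) : ℝ≥0∞) := by
    refine (eLpNorm_sub_le hmφ.1 hsm.1 (by norm_num)).trans ?_
    push_cast
    refine add_le_add hR.1 ?_
    have : (fun y => ∑ i, partialDeriv i (partialDeriv i φ) y)
        = ∑ i, partialDeriv i (partialDeriv i φ) := by ext; simp
    rw [this]
    refine (eLpNorm_sum_le (fun i _ => (hm i).1) (by norm_num)).trans ?_
    refine (Finset.sum_le_sum fun i _ => hR.2.2 i i).trans ?_
    simp
  have hG2 : eLpNorm G 2 volume = ENNReal.ofReal ((∫ y, ‖G y‖ ^ (2 : ℝ)) ^ (1 / 2 : ℝ)) := by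
    rw [hG.eLpNorm_eq_integral_rpow_norm (by norm_num) (by norm_num)]
    simp
  rw [hG2, ← ENNReal.ofReal_coe_nnreal, ENNReal.ofReal_le_ofReal_iff (NNReal.coe_nonneg _)] at hle
  simpa using hle

end Fourier

theorem norm_fderiv_le_sum (φ : Space N → ℝ) (x : Space N) :
    ‖fderiv ℝ φ x‖ ≤ ∑ i, ‖partialDeriv i φ x‖ := by
  refine ContinuousLinearMap.opNorm_le_bound _ (Finset.sum_nonneg fun i _ => norm_nonneg _)
    fun y => ?_
  have hy : y = ∑ i, y i • EuclideanSpace.single i (1 : ℝ) := by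
    have := (EuclideanSpace.basisFun (Fin N) ℝ).sum_repr y
    simpa using this.symm
  conv_lhs => rw [hy, map_sum]
  refine (norm_sum_le _ _).trans ?_
  rw [Finset.sum_mul]
  refine Finset.sum_le_sum fun i _ => ?_
  rw [map_smul, norm_smul, mul_comm]
  exact mul_le_mul_of_nonneg_left (PiLp.norm_apply_le y i) (norm_nonneg _)

theorem eLpNorm_fderiv_le_sum {φ : Space N → ℝ} (hφ : ContDiff ℝ ∞ φ) {q : ℝ≥0∞} (hq : 1 ≤ q) :
    eLpNorm (fderiv ℝ φ) q volume ≤ ∑ i, eLpNorm (partialDeriv i φ) q volume := by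
  refine (eLpNorm_mono_real (norm_fderiv_le_sum φ)).trans ?_
  have : (fun x => ∑ i, ‖partialDeriv i φ x‖) = ∑ i, fun x => ‖partialDeriv i φ x‖ := by
    ext; simp
  rw [this]
  refine (eLpNorm_sum_le (fun i _ =>
    (continuous_partialDeriv hφ).norm.aestronglyMeasurable) hq).trans ?_
  refine (Finset.sum_le_sum fun i _ => ?_)
  rw [eLpNorm_norm]

/-- The Gagliardo–Nirenberg–Sobolev inequality in terms of partial derivatives. -/
theorem exists_eLpNorm_le_sum_partialDeriv (hN : 0 < N) {q q' : NNReal} (hq : 1 ≤ q)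
    (hq' : (q' : ℝ)⁻¹ = (q : ℝ)⁻¹ - (N : ℝ)⁻¹) : ∃ C : NNReal, ∀ φ : Space N → ℝ,
      ContDiff ℝ ∞ φ → HasCompactSupport φ →
        eLpNorm φ q' volume ≤ C * ∑ i, eLpNorm (partialDeriv i φ) q volume := by
  refine ⟨SNormLESNormFDerivOfEqConst ℝ (volume : Measure (Space N)) q, fun φ hφ hc => ?_⟩
  refine (eLpNorm_le_eLpNorm_fderiv_of_eq volume (hφ.of_le (by simp)) hc hq
    (by rwa [finrank_euclideanSpace_fin]) (by rw [finrank_euclideanSpace_fin, hq']; simp)).trans ?_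
  gcongr
  exact eLpNorm_fderiv_le_sum hφ (by exact_mod_cast hq)

/-- Interpolation between `L²` and `L^q`. -/
theorem eLpNorm_le_of_two_le {f : Space N → ℝ} {A B r q : NNReal} (h2r : 2 ≤ r) (hrq : r ≤ q)
    (hf : Measurable f) (hA : eLpNorm f 2 volume ≤ A) (hB : eLpNorm f q volume ≤ B) :
    eLpNorm f r volume ≤ ((A ^ (2 : ℝ) + B ^ (q : ℝ)) ^ (1 / (r : ℝ)) : NNReal) := by
  have h2r' : (2 : ℝ) ≤ r := by exact_mod_cast h2r
  have hrq' : (r : ℝ) ≤ q := by exact_mod_cast hrq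
  have hr0 : (0 : ℝ) < r := by linarith
  have hq0 : (0 : ℝ) < q := by linarith
  have hrn : r ≠ 0 := by rintro rfl; simp at hr0
  have hqn : q ≠ 0 := by rintro rfl; simp at hq0
  have tw : ∀ s : NNReal, s ≠ 0 → eLpNorm f s volume ^ (s : ℝ) = ∫⁻ x, ‖f x‖ₑ ^ (s : ℝ) := by
    intro s hs
    rw [eLpNorm_eq_lintegral_rpow_enorm_toReal (by simpa using hs) (by simp), ← ENNReal.rpow_mul]
    have : (s : ℝ) ≠ 0 := by exact_mod_cast hs
    simp [this]
  have h1 : eLpNorm f r volume ^ (r : ℝ) ≤ (A : ℝ≥0∞) ^ (2 : ℝ) + (B : ℝ≥0∞) ^ (q : ℝ) := by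
    have hA' : ∫⁻ x, ‖f x‖ₑ ^ (2 : ℝ) ≤ (A : ℝ≥0∞) ^ (2 : ℝ) := by
      have := tw 2 (by norm_num)
      simp only [NNReal.coe_ofNat] at this
      rw [← this]
      exact ENNReal.rpow_le_rpow hA (by norm_num)
    have hB' : ∫⁻ x, ‖f x‖ₑ ^ (q : ℝ) ≤ (B : ℝ≥0∞) ^ (q : ℝ) := by
      rw [← tw q hqn]
      exact ENNReal.rpow_le_rpow hB hq0.le
    rw [tw r hrn]
    calc ∫⁻ x, ‖f x‖ₑ ^ (r : ℝ) ≤ ∫⁻ x, ‖f x‖ₑ ^ (2 : ℝ) + ‖f x‖ₑ ^ (q : ℝ) := by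
          refine lintegral_mono fun x => ?_
          rcases le_total ‖f x‖ₑ 1 with h | h
          · exact (ENNReal.rpow_le_rpow_of_exponent_ge h h2r').trans le_self_add
          · exact (ENNReal.rpow_le_rpow_of_exponent_le h hrq').trans le_add_self
      _ = (∫⁻ x, ‖f x‖ₑ ^ (2 : ℝ)) + ∫⁻ x, ‖f x‖ₑ ^ (q : ℝ) :=
          lintegral_add_left (hf.enorm.pow_const _) _
      _ ≤ _ := add_le_add hA' hB'
  rw [ENNReal.coe_rpow_of_nonneg _ (by positivity), one_div, ENNReal.le_rpow_inv_iff hr0]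
  refine h1.trans_eq ?_
  rw [ENNReal.coe_add, ENNReal.coe_rpow_of_nonneg _ zero_le_two,
    ENNReal.coe_rpow_of_nonneg _ hq0.le]

/-- Multiplication by `|φ|^s` maps `H¹` to `L²` when `φ` is bounded in `H²`, for a suitable
exponent `s ≥ p - 1`, in dimension at least four. -/
theorem exists_eLpNorm_rpow_mul_le (hN : 4 ≤ N) {r s : ℝ} (hr2 : 2 ≤ r)
    (hrq : r ≤ 2 * N / (N - 2)) (hrN : r < N) (hs : s = r / (N - r)) (R : NNReal) :
    ∃ C : NNReal, ∀ φ ψ : Space N → ℝ, ContDiff ℝ ∞ φ → HasCompactSupport φ →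
      ContDiff ℝ ∞ ψ → HasCompactSupport ψ → H2Bound R φ →
      eLpNorm (fun x => |φ x| ^ s * ψ x) 2 volume
        ≤ C * ∑ i, eLpNorm (partialDeriv i ψ) 2 volume := by
  have hN' : (4 : ℝ) ≤ N := by exact_mod_cast hN
  have hs0 : 0 < s := by rw [hs]; apply div_pos <;> linarith
  let q : NNReal := ⟨2 * N / (N - 2), by apply div_nonneg <;> linarith⟩
  have hqc : (q : ℝ) = 2 * N / (N - 2) := rfl
  have hq : (q : ℝ)⁻¹ = ((2 : NNReal) : ℝ)⁻¹ - (N : ℝ)⁻¹ := by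
    have : (N : ℝ) - 2 ≠ 0 := by linarith
    rw [hqc]; push_cast; field_simp
  obtain ⟨C₁, h₁⟩ := exists_eLpNorm_le_sum_partialDeriv (N := N) (by omega) (q := 2)
    (by norm_num) hq
  let r' : NNReal := ⟨r, by linarith⟩
  have hrc : (r' : ℝ) = r := rfl
  let t : NNReal := ⟨N * s, by positivity⟩
  have htc : (t : ℝ) = N * s := rfl
  have ht : (t : ℝ)⁻¹ = (r' : ℝ)⁻¹ - (N : ℝ)⁻¹ := by
    have h1 : (N : ℝ) - r ≠ 0 := by linarith
    have h2 : r ≠ 0 := by linarith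
    have h3 : (N : ℝ) ≠ 0 := by linarith
    rw [htc, hrc, hs]; field_simp
  have hr1 : (1 : NNReal) ≤ r' := by
    rw [← NNReal.coe_le_coe, hrc]; push_cast; linarith
  obtain ⟨C₂, h₂⟩ := exists_eLpNorm_le_sum_partialDeriv (N := N) (by omega) hr1 ht
  let B : NNReal := C₂ * (N * (R ^ (2 : ℝ) + (C₁ * (N * R)) ^ (q : ℝ)) ^ (1 / (r' : ℝ)))
  refine ⟨B ^ s * C₁, fun φ ψ hφ hφc hψ hψc hR => ?_⟩
  have hd : ∀ i, eLpNorm (partialDeriv i φ) r' volume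
      ≤ ((R ^ (2 : ℝ) + (C₁ * (N * R)) ^ (q : ℝ)) ^ (1 / (r' : ℝ)) : NNReal) := by
    intro i
    refine eLpNorm_le_of_two_le ?_ ?_ (continuous_partialDeriv hφ).measurable (hR.2.1 i) ?_
    · rw [← NNReal.coe_le_coe, hrc]; push_cast; linarith
    · rw [← NNReal.coe_le_coe, hrc, hqc]; exact hrq
    · refine (h₁ _ (contDiff_partialDeriv hφ) (hasCompactSupport_partialDeriv hφc)).trans ?_
      push_cast
      gcongr
      refine (Finset.sum_le_sum fun j _ => hR.2.2 i j).trans ?_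
      simp
  have hB : eLpNorm φ t volume ≤ B := by
    refine (h₂ φ hφ hφc).trans ?_
    simp only [B, ENNReal.coe_mul]
    gcongr
    refine (Finset.sum_le_sum fun j _ => hd j).trans ?_
    simp
  have hφs : eLpNorm (fun x => |φ x| ^ s) N volume ≤ (B : ℝ≥0∞) ^ s := by
    have h3 := eLpNorm_norm_rpow (p := (N : ℝ≥0∞)) (μ := (volume : Measure (Space N))) φ hs0
    have h4 : (N : ℝ≥0∞) * ENNReal.ofReal s = t := by
      have : (N : ℝ≥0∞) = ENNReal.ofReal N := by simp
      rw [this, ← ENNReal.ofReal_mul (by positivity), ← htc, ENNReal.ofReal_coe_nnreal]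
    simp only [Real.norm_eq_abs] at h3
    rw [h3, h4]
    exact ENNReal.rpow_le_rpow hB hs0.le
  have : ENNReal.HolderTriple (N : ℝ≥0∞) (q : ℝ≥0∞) 2 := by
    constructor
    have h5 : ((N : NNReal))⁻¹ + q⁻¹ = (2 : NNReal)⁻¹ := by
      rw [← NNReal.coe_inj]; push_cast; rw [hq]; push_cast; ring
    have hN0 : (N : NNReal) ≠ 0 := by
      have : N ≠ 0 := by omega
      exact_mod_cast this
    have hq0 : q ≠ 0 := by
      rw [← NNReal.coe_ne_zero, hqc]
      apply div_ne_zero <;> linarith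
    have h6 : (N : ℝ≥0∞) = ((N : NNReal) : ℝ≥0∞) := by simp
    have h7 : (2 : ℝ≥0∞) = ((2 : NNReal) : ℝ≥0∞) := by simp
    rw [h6, h7, ← ENNReal.coe_inv hN0, ← ENNReal.coe_inv hq0, ← ENNReal.coe_inv two_ne_zero,
      ← ENNReal.coe_add, h5]
  have hcs : Continuous fun x => |φ x| ^ s :=
    hφ.continuous.abs.rpow_const fun x => Or.inr hs0.le
  have h8 := eLpNorm_smul_le_mul_eLpNorm (p := (N : ℝ≥0∞)) (q := (q : ℝ≥0∞)) (r := 2)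
    (μ := (volume : Measure (Space N))) hψ.continuous.aestronglyMeasurable
    hcs.aestronglyMeasurable
  refine h8.trans ?_
  rw [ENNReal.coe_mul, ENNReal.coe_rpow_of_nonneg _ hs0.le, mul_assoc]
  exact mul_le_mul' hφs (h₁ ψ hψ hψc)

/-- The multiplication estimate `‖|φ|^(p-1) ψ‖_{L²} ≤ C ‖ψ‖_{H¹}` for `φ` bounded in `H²`. In
dimension at least five it holds for `p ≤ (N - 2) / (N - 4)`. -/
theorem exists_eLpNorm_rpow_sub_one_mul_le {p : ℝ} (hp : 1 < p)
    (hpN : 5 ≤ N → p ≤ ((N : ℝ) - 2) / ((N : ℝ) - 4)) (R : NNReal) :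
    ∃ C : NNReal, ∀ φ ψ : Space N → ℝ, ContDiff ℝ ∞ φ → HasCompactSupport φ →
      ContDiff ℝ ∞ ψ → HasCompactSupport ψ → H2Bound R φ →
      eLpNorm (fun x => |φ x| ^ (p - 1) * ψ x) 2 volume
        ≤ C * (eLpNorm ψ 2 volume + ∑ i, eLpNorm (partialDeriv i ψ) 2 volume) := by
  rcases Nat.lt_or_ge N 4 with hN | hN
  · obtain ⟨C, hC, h⟩ := exists_abs_le_of_H2Bound (N := N) (by omega) R
    refine ⟨Real.toNNReal (C ^ (p - 1)), fun φ ψ hφ hφc hψ hψc hR => ?_⟩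
    refine le_trans ?_ (mul_le_mul_right le_self_add _)
    refine eLpNorm_le_mul_eLpNorm_of_ae_le_mul (ae_of_all _ fun x => ?_) 2
    rw [norm_mul, Real.norm_of_nonneg (by positivity)]
    exact mul_le_mul_of_nonneg_right (Real.rpow_le_rpow (abs_nonneg _) (h φ hφ hφc hR x)
      (by linarith)) (norm_nonneg _)
  · have hN' : (4 : ℝ) ≤ N := by exact_mod_cast hN
    -- In dimension four, `r / (4 - r)` is arbitrarily large as `r` tends to the excluded value `4`;
    -- in higher dimensions `r = 2 N / (N - 2)` is admissible and gives the largest power.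
    obtain ⟨r, hr2, hrq, hrN, hs⟩ : ∃ r : ℝ, 2 ≤ r ∧ r ≤ 2 * N / (N - 2) ∧ r < N ∧
        p - 1 ≤ r / (N - r) := by
      rcases hN.eq_or_lt with h4 | h5
      · refine ⟨max 2 (4 * (p - 1) / p), le_max_left _ _, ?_, ?_, ?_⟩
        · rw [← h4]; norm_num
          rw [div_le_iff₀ (by linarith)]; linarith
        · rw [← h4]; norm_num
          rw [div_lt_iff₀ (by linarith)]; linarith
        · have hlt : max 2 (4 * (p - 1) / p) < 4 := by
            apply max_lt (by norm_num)
            rw [div_lt_iff₀ (by linarith)]; linarith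
          have hle : 4 * (p - 1) / p ≤ max 2 (4 * (p - 1) / p) := le_max_right _ _
          rw [div_le_iff₀ (by linarith)] at hle
          rw [← h4]; push_cast
          rw [le_div_iff₀ (by linarith)]
          linarith
      · have h5' : (5 : ℝ) ≤ N := by exact_mod_cast h5
        have h6 : (N : ℝ) - 2 ≠ 0 := by linarith
        have h7 : (N : ℝ) - 4 ≠ 0 := by linarith
        have hN0 : (N : ℝ) ≠ 0 := by linarith
        refine ⟨2 * N / (N - 2), ?_, le_rfl, ?_, ?_⟩
        · rw [le_div_iff₀ (by linarith)]; linarith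
        · rw [div_lt_iff₀ (by linarith)]; nlinarith
        · have e : 2 * (N : ℝ) / (N - 2) / (N - 2 * N / (N - 2)) = (N - 2) / (N - 4) - 1 := by
            have : (N : ℝ) - 2 * N / (N - 2) = N * (N - 4) / (N - 2) := by
              field_simp; ring
            rw [this]; field_simp; ring
          rw [e]
          linarith [hpN h5]
    obtain ⟨C, h⟩ := exists_eLpNorm_rpow_mul_le hN hr2 hrq hrN rfl R
    have hs0 : 0 < r / (N - r) := by linarith
    refine ⟨1 + C, fun φ ψ hφ hφc hψ hψc hR => ?_⟩
    have h1 := h φ ψ hφ hφc hψ hψc hR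
    have hcs : Continuous fun x => |φ x| ^ (r / (N - r)) :=
      hφ.continuous.abs.rpow_const fun x => Or.inr hs0.le
    -- `|φ| ^ (p - 1)` is at most `1` where `|φ| ≤ 1`, and at most the higher power elsewhere
    calc eLpNorm (fun x => |φ x| ^ (p - 1) * ψ x) 2 volume
        ≤ eLpNorm (fun x => ‖ψ x‖ + ‖|φ x| ^ (r / (N - r)) * ψ x‖) 2 volume := by
          refine eLpNorm_mono_real fun x => ?_
          have n1 : ∀ e : ℝ, ‖|φ x| ^ e‖ = |φ x| ^ e := fun e =>
            Real.norm_of_nonneg (by positivity)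
          rw [norm_mul, norm_mul, n1, n1]
          rcases le_total |φ x| 1 with h0 | h0
          · have := Real.rpow_le_one (abs_nonneg _) h0 (show 0 ≤ p - 1 by linarith)
            have h2 : 0 ≤ |φ x| ^ (r / (N - r)) * ‖ψ x‖ := by positivity
            nlinarith [norm_nonneg (ψ x)]
          · have := Real.rpow_le_rpow_of_exponent_le h0 hs
            nlinarith [norm_nonneg (ψ x)]
      _ ≤ eLpNorm ψ 2 volume + eLpNorm (fun x => |φ x| ^ (r / (N - r)) * ψ x) 2 volume := by
          refine (eLpNorm_add_le hψ.continuous.norm.aestronglyMeasurable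
            (hcs.mul hψ.continuous).norm.aestronglyMeasurable (by norm_num)).trans ?_
          rw [eLpNorm_norm, eLpNorm_norm]
          rfl
      _ ≤ eLpNorm ψ 2 volume + C * ∑ i, eLpNorm (partialDeriv i ψ) 2 volume := by gcongr
      _ ≤ _ := by
          push_cast
          rw [add_mul, one_mul, mul_add]
          exact add_le_add le_self_add le_add_self

/-! ### The weighted bound for the nonlinearity -/

theorem eventually_eLpNorm_le {φ : ℕ → Space N → ℝ} (hφ : ∀ n, AEStronglyMeasurable (φ n) volume)
    {u : L2 N} {R : NNReal} (hu : ‖u‖ < R)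
    (h : Tendsto (fun n => eLpNorm (fun x => φ n x - u x) 2 volume) atTop (𝓝 0)) :
    ∀ᶠ n in atTop, eLpNorm (φ n) 2 volume ≤ R := by
  have hlt : eLpNorm u 2 volume < R := by
    rw [← ENNReal.toReal_lt_toReal (Lp.eLpNorm_ne_top u) ENNReal.coe_ne_top]
    simpa [Lp.norm_def] using hu
  have h2 : Tendsto (fun n => eLpNorm (fun x => φ n x - u x) 2 volume + eLpNorm u 2 volume) atTop
      (𝓝 (0 + eLpNorm u 2 volume)) := h.add tendsto_const_nhds
  rw [zero_add] at h2
  filter_upwards [h2.eventually_lt_const hlt] with n hn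
  refine le_trans ?_ hn.le
  have e : φ n = (fun x => φ n x - u x) + u := by ext x; simp
  conv_lhs => rw [e]
  exact eLpNorm_add_le ((hφ n).sub (Lp.aestronglyMeasurable u)) (Lp.aestronglyMeasurable u)
    (by norm_num)

theorem eLpNorm_mul_testL2 {φ : Space N → ℝ} (hφ : ContDiff ℝ ∞ φ) (hc : HasCompactSupport φ)
    {m : Space N → ℝ} (hm : Continuous m) {C : ℝ} (hb : ∀ x, |m x| ≤ C) :
    eLpNorm (fun x => m x * φ x) 2 volume
      = ENNReal.ofReal ‖mulL2 m hm C hb (testL2 φ hφ hc)‖ := by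
  rw [ofReal_norm, Lp.enorm_def]
  refine eLpNorm_congr_ae ?_
  filter_upwards [coeFn_mulL2 hm hb (testL2 φ hφ hc), coeFn_testL2 hφ hc] with x h1 h2
  rw [h1, h2]

/-- The weighted multiplication estimate for `|u|^p` with `u` in a ball of `H²`. The constant does
not depend on the weight. -/
theorem exists_eLpNorm_weight_mul_rpow_le {p : ℝ} (hp : 1 < p)
    (hpN : 5 ≤ N → p ≤ ((N : ℝ) - 2) / ((N : ℝ) - 4)) (R : NNReal) :
    ∃ C : ℝ, 0 ≤ C ∧ ∀ u : H2 N, ‖u‖ < R → ∀ (σ : Space N → ℝ) (hσ : ContDiff ℝ ∞ σ) (C₀ C₁ : ℝ)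
      (hb : ∀ x, |σ x| ≤ C₀) (hb' : ∀ i x, |partialDeriv i σ x| ≤ C₁),
      eLpNorm (fun x => σ x * |u.toL2 x| ^ p) 2 volume ≤ ENNReal.ofReal (C *
        (‖mulL2 σ hσ.continuous C₀ hb u.1.1‖ + ∑ i,
          (‖mulL2 (partialDeriv i σ) (continuous_partialDeriv hσ) C₁ (hb' i) u.1.1‖
            + ‖mulL2 σ hσ.continuous C₀ hb (u.1.2.1 i)‖))) := by
  obtain ⟨C, hC⟩ := exists_eLpNorm_rpow_sub_one_mul_le hp hpN R
  refine ⟨C, C.coe_nonneg, fun u hu σ hσ C₀ C₁ hb hb' => ?_⟩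
  set W := mulL2 σ hσ.continuous C₀ hb
  let D := fun i => mulL2 (partialDeriv i σ) (continuous_partialDeriv hσ) C₁ (hb' i)
  change _ ≤ ENNReal.ofReal (C * (‖W u.1.1‖ + ∑ i, (‖D i u.1.1‖ + ‖W (u.1.2.1 i)‖)))
  set φ : ℕ → Space N → ℝ := fun n => testApprox n u.1.1
  have hφ : ∀ n, ContDiff ℝ ∞ (φ n) := fun n => contDiff_testApprox n _
  have hφc : ∀ n, HasCompactSupport (φ n) := fun n => hasCompactSupport_testApprox n _
  have hφ' := fun n i => contDiff_partialDeriv (i := i) (hφ n)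
  have hφc' := fun n i => hasCompactSupport_partialDeriv (i := i) (hφc n)
  have t0 : Tendsto (fun n => eLpNorm (fun x => φ n x - u.1.1 x) 2 volume) atTop (𝓝 0) :=
    tendsto_testApprox u.1.1
  have t1 : ∀ i, Tendsto (fun n => eLpNorm (fun x => partialDeriv i (φ n) x - u.1.2.1 i x) 2
      volume) atTop (𝓝 0) := fun i => tendsto_partialDeriv_testApprox (u.2.1 i)
  have t2 : ∀ i j, Tendsto (fun n => eLpNorm (fun x => partialDeriv j (partialDeriv i (φ n)) x
      - u.1.2.2 i j x) 2 volume) atTop (𝓝 0) := fun i j =>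
    tendsto_partialDeriv_partialDeriv_testApprox (u.2.1 i) (u.2.1 j) (u.2.2 i j)
  have n0 : ‖u.1.1‖ < R := (norm_fst_le u.1).trans_lt hu
  have n1 : ∀ i, ‖u.1.2.1 i‖ < R := fun i =>
    ((norm_le_pi_norm u.1.2.1 i).trans ((norm_fst_le u.1.2).trans (norm_snd_le u.1))).trans_lt hu
  have n2 : ∀ i j, ‖u.1.2.2 i j‖ < R := fun i j =>
    ((norm_le_pi_norm (u.1.2.2 i) j).trans ((norm_le_pi_norm u.1.2.2 i).trans
      ((norm_snd_le u.1.2).trans (norm_snd_le u.1)))).trans_lt hu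
  have hbound : ∀ᶠ n in atTop, H2Bound R (φ n) := by
    have e1 := eventually_all.2 fun i => eventually_eLpNorm_le
      (fun n => (hφ' n i).continuous.aestronglyMeasurable) (n1 i) (t1 i)
    have e2 := eventually_all.2 fun i => eventually_all.2 fun j => eventually_eLpNorm_le
      (fun n => (continuous_partialDeriv (hφ' n i)).aestronglyMeasurable) (n2 i j) (t2 i j)
    filter_upwards [eventually_eLpNorm_le (fun n => (hφ n).continuous.aestronglyMeasurable) n0 t0,
      e1, e2] with n h0 h1 h2 using ⟨h0, h1, h2⟩
  have lim : Tendsto (fun n => (C : ℝ) * (‖W (testL2 _ (hφ n) (hφc n))‖ + ∑ i,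
      (‖D i (testL2 _ (hφ n) (hφc n))‖ + ‖W (testL2 _ (hφ' n i) (hφc' n i))‖))) atTop
      (𝓝 (C * (‖W u.1.1‖ + ∑ i, (‖D i u.1.1‖ + ‖W (u.1.2.1 i)‖)))) := by
    have s0 := tendsto_testL2 hφ hφc t0
    have s1 := fun i => tendsto_testL2 (fun n => hφ' n i) (fun n => hφc' n i) (t1 i)
    refine Tendsto.const_mul _ ((((W.continuous.tendsto _).comp s0).norm).add ?_)
    exact tendsto_finsetSum _ fun i _ =>
      (((D i).continuous.tendsto _).comp s0).norm.add ((W.continuous.tendsto _).comp (s1 i)).norm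
  have hle : ∀ᶠ n in atTop, eLpNorm (fun x => |φ n x| ^ (p - 1) * (σ x * φ n x)) 2 volume
      ≤ ENNReal.ofReal (C * (‖W (testL2 _ (hφ n) (hφc n))‖ + ∑ i,
      (‖D i (testL2 _ (hφ n) (hφc n))‖ + ‖W (testL2 _ (hφ' n i) (hφc' n i))‖))) := by
    filter_upwards [hbound] with n hn
    have h1 := hC (φ n) (fun x => σ x * φ n x) (hφ n) (hφc n) (hσ.mul (hφ n))
      (hφc n).mul_left hn
    refine h1.trans ?_
    rw [ENNReal.ofReal_mul C.coe_nonneg, ENNReal.ofReal_coe_nnreal,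
      ENNReal.ofReal_add (norm_nonneg _) (by positivity),
      ENNReal.ofReal_sum_of_nonneg (fun i _ => by positivity)]
    refine mul_le_mul_right (add_le_add (eLpNorm_mul_testL2 _ _ _ _).le
      (Finset.sum_le_sum fun i _ => ?_)) _
    rw [ENNReal.ofReal_add (norm_nonneg _) (norm_nonneg _), ← eLpNorm_mul_testL2 (hφ n) (hφc n),
      ← eLpNorm_mul_testL2 (hφ' n i) (hφc' n i)]
    have e : partialDeriv i (fun x => σ x * φ n x)
        = (fun x => partialDeriv i σ x * φ n x) + fun x => σ x * partialDeriv i (φ n) x := by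
      ext x
      exact partialDeriv_mul (hσ.differentiable (by simp) x) ((hφ n).differentiable (by simp) x)
    rw [e]
    exact eLpNorm_add_le
      ((continuous_partialDeriv hσ).mul (hφ n).continuous).aestronglyMeasurable
      (hσ.continuous.mul (hφ' n i).continuous).aestronglyMeasurable (by norm_num)
  obtain ⟨ns, hns, hae⟩ := (tendstoInMeasure_of_tendsto_eLpNorm (p := 2) (by norm_num)
    (fun n => (hφ n).continuous.aestronglyMeasurable) (Lp.aestronglyMeasurable u.1.1)
    t0).exists_seq_tendsto_ae
  have habs : eLpNorm (fun x => σ x * |u.toL2 x| ^ p) 2 volume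
      = eLpNorm (fun x => |u.1.1 x| ^ (p - 1) * (σ x * u.1.1 x)) 2 volume := by
    refine eLpNorm_congr_norm_ae (ae_of_all _ fun x => ?_)
    have h0 : |u.1.1 x| ^ p = |u.1.1 x| ^ (p - 1) * |u.1.1 x| := by
      conv_rhs => rw [← Real.rpow_add_one' (abs_nonneg _) (by linarith)]
      rw [sub_add_cancel]
    change ‖σ x * |u.1.1 x| ^ p‖ = _
    rw [h0]
    simp only [norm_mul, Real.norm_eq_abs, abs_abs]
    ring
  rw [habs]
  refine ENNReal.le_of_forall_pos_le_add fun δ hδ _ => ?_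
  have hlt : (C * (‖W u.1.1‖ + ∑ i, (‖D i u.1.1‖ + ‖W (u.1.2.1 i)‖)) : ℝ)
      < C * (‖W u.1.1‖ + ∑ i, (‖D i u.1.1‖ + ‖W (u.1.2.1 i)‖)) + δ := by
    have : (0 : ℝ) < δ := by exact_mod_cast hδ
    linarith
  have hev := hns.tendsto_atTop.eventually (hle.and (lim.eventually_lt_const hlt))
  refine Lp.eLpNorm_le_of_ae_tendsto (u := atTop)
    (f := fun n x => |φ (ns n) x| ^ (p - 1) * (σ x * φ (ns n) x)) ?_ (fun n => ?_) ?_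
  · filter_upwards [hev] with n hn
    refine hn.1.trans ((ENNReal.ofReal_le_ofReal hn.2.le).trans ?_)
    refine ENNReal.ofReal_add_le.trans ?_
    rw [ENNReal.ofReal_coe_nnreal]
  · exact (((hφ _).continuous.abs.rpow_const fun x => Or.inr (by linarith)).mul
      (hσ.continuous.mul (hφ _).continuous)).aestronglyMeasurable
  · filter_upwards [hae] with x hx
    exact (hx.abs.rpow_const (Or.inr (by linarith))).mul (hx.const_mul _)

/-! ### Regularity of strong solutions -/

/-- The inclusion `H¹ ⊂ L²` as a continuous linear map. -/
noncomputable def H1.toL2CLM (N : ℕ) : H1 N →L[ℝ] L2 N :=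
  (ContinuousLinearMap.fst ℝ (L2 N) (Fin N → L2 N)).comp (sobolevH1 N).subtypeL

/-- The weak partial derivative `H¹ → L²` as a continuous linear map. -/
noncomputable def H1.partialCLM {N : ℕ} (i : Fin N) : H1 N →L[ℝ] L2 N :=
  (ContinuousLinearMap.proj i).comp
    ((ContinuousLinearMap.snd ℝ (L2 N) (Fin N → L2 N)).comp (sobolevH1 N).subtypeL)

namespace IsStrongSolution

variable {a b : ℝ → ℝ} {p T : ℝ} {f : H2 N} {g : H1 N} {u : ℝ → H2 N}

theorem hasDerivWithinAt_toH1 (h : IsStrongSolution a b p f g T u) {t : ℝ} (ht : t ∈ Ico 0 T) :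
    HasDerivWithinAt (fun s => (u s).toH1)
      (derivWithin (fun s => (u s).toH1) (Ico 0 T) t) (Ico 0 T) t :=
  (h.contDiff_H1.differentiableOn (by norm_num) t ht).hasDerivWithinAt

theorem hasDerivWithinAt_partial (h : IsStrongSolution a b p f g T u) {t : ℝ}
    (ht : t ∈ Ico 0 T) (i : Fin N) :
    HasDerivWithinAt (fun s => (u s).1.2.1 i)
      ((derivWithin (fun s => (u s).toH1) (Ico 0 T) t).1.2 i) (Ico 0 T) t :=
  (H1.partialCLM i).hasFDerivAt.comp_hasDerivWithinAt t (h.hasDerivWithinAt_toH1 ht)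

theorem hasDerivWithinAt_toL2' (h : IsStrongSolution a b p f g T u) {t : ℝ}
    (ht : t ∈ Ico 0 T) :
    HasDerivWithinAt (fun s => (u s).toL2)
      (derivWithin (fun s => (u s).toH1) (Ico 0 T) t).1.1 (Ico 0 T) t :=
  (H1.toL2CLM N).hasFDerivAt.comp_hasDerivWithinAt t (h.hasDerivWithinAt_toH1 ht)

theorem derivWithin_toL2_eq (h : IsStrongSolution a b p f g T u) {t : ℝ} (ht : t ∈ Ico 0 T) :
    derivWithin (fun s => (u s).toL2) (Ico 0 T) t
      = (derivWithin (fun s => (u s).toH1) (Ico 0 T) t).1.1 :=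
  (h.hasDerivWithinAt_toL2' ht).derivWithin (uniqueDiffOn_Ico 0 T t ht)

theorem hasDerivWithinAt_toL2 (h : IsStrongSolution a b p f g T u) {t : ℝ} (ht : t ∈ Ico 0 T) :
    HasDerivWithinAt (fun s => (u s).toL2) (derivWithin (fun s => (u s).toL2) (Ico 0 T) t)
      (Ico 0 T) t := by
  rw [h.derivWithin_toL2_eq ht]; exact h.hasDerivWithinAt_toL2' ht

theorem contDiffOn_deriv (h : IsStrongSolution a b p f g T u) :
    ContDiffOn ℝ 1 (derivWithin (fun s => (u s).toL2) (Ico 0 T)) (Ico 0 T) :=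
  h.contDiff_L2.derivWithin (uniqueDiffOn_Ico 0 T) (by norm_num)

theorem hasDerivWithinAt_deriv (h : IsStrongSolution a b p f g T u) {t : ℝ} (ht : t ∈ Ico 0 T) :
    HasDerivWithinAt (derivWithin (fun s => (u s).toL2) (Ico 0 T))
      (iteratedDerivWithin 2 (fun s => (u s).toL2) (Ico 0 T) t) (Ico 0 T) t := by
  have := (h.contDiffOn_deriv.differentiableOn (by norm_num) t ht).hasDerivWithinAt
  rwa [iteratedDerivWithin_succ, iteratedDerivWithin_one]

theorem continuousOn_second (h : IsStrongSolution a b p f g T u) :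
    ContinuousOn (iteratedDerivWithin 2 (fun s => (u s).toL2) (Ico 0 T)) (Ico 0 T) :=
  h.contDiff_L2.continuousOn_iteratedDerivWithin (by norm_num) (uniqueDiffOn_Ico 0 T)

theorem hasWeakPartial_deriv (h : IsStrongSolution a b p f g T u) {t : ℝ} (ht : t ∈ Ico 0 T)
    (i : Fin N) : HasWeakPartial i (derivWithin (fun s => (u s).toL2) (Ico 0 T) t)
      ((derivWithin (fun s => (u s).toH1) (Ico 0 T) t).1.2 i) := by
  rw [h.derivWithin_toL2_eq ht]
  exact (derivWithin (fun s => (u s).toH1) (Ico 0 T) t).2 i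

/-- The initial velocity, in `L²`. -/
theorem derivWithin_toL2_zero (h : IsStrongSolution a b p f g T u) (hT : 0 < T) :
    derivWithin (fun s => (u s).toL2) (Ico 0 T) 0 = g.toL2 := by
  rw [h.derivWithin_toL2_eq ⟨le_rfl, hT⟩, h.initial_velocity]
  rfl

end IsStrongSolution

/-! ### Weights concentrated at a point -/

/-- The weight `exp (-λ √(η² + |x - x₀|²))` concentrates at `x₀` as `λ → ∞`; its logarithm is
`λ`-Lipschitz. -/
noncomputable def coneWeight (lam η : ℝ) (x₀ : Space N) (x : Space N) : ℝ :=
  Real.exp (-lam * Real.sqrt (η ^ 2 + ‖x - x₀‖ ^ 2))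

section coneWeight

variable {lam η : ℝ} {x₀ : Space N}

theorem contDiff_coneWeight (hη : 0 < η) : ContDiff ℝ ∞ (coneWeight lam η x₀) := by
  refine Real.contDiff_exp.comp (contDiff_const.mul (ContDiff.sqrt ?_ fun x => by positivity))
  exact contDiff_const.add ((contDiff_id.sub contDiff_const).norm_sq ℝ)

theorem coneWeight_pos (x : Space N) : 0 < coneWeight lam η x₀ x := Real.exp_pos _

theorem coneWeight_le_one (hl : 0 ≤ lam) (x : Space N) : coneWeight lam η x₀ x ≤ 1 := by
  refine Real.exp_le_one_iff.2 ?_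
  rw [neg_mul, neg_nonpos]
  positivity

theorem partialDeriv_coneWeight (hη : 0 < η) (i : Fin N) (x : Space N) :
    partialDeriv i (coneWeight lam η x₀) x
      = -lam * ((x - x₀) i / Real.sqrt (η ^ 2 + ‖x - x₀‖ ^ 2)) * coneWeight lam η x₀ x := by
  have hp : η ^ 2 + ‖x - x₀‖ ^ 2 ≠ 0 := by positivity
  have h1 : HasFDerivAt (fun y : Space N => η ^ 2 + ‖y - x₀‖ ^ 2)
      (2 • (innerSL ℝ (x - x₀)).comp (ContinuousLinearMap.id ℝ (Space N))) x :=
    (((hasFDerivAt_id x).sub_const x₀).norm_sq).const_add _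
  have h2 := ((h1.sqrt hp).const_mul (-lam)).exp
  unfold partialDeriv
  have h3 : coneWeight lam η x₀ = fun x => Real.exp (-lam * Real.sqrt (η ^ 2 + ‖x - x₀‖ ^ 2)) := rfl
  rw [h3, h2.fderiv]
  have h4 : inner ℝ (x - x₀) (EuclideanSpace.single i (1 : ℝ)) = (x - x₀) i := by
    rw [EuclideanSpace.inner_single_right]; simp
  simp only [smul_apply, ContinuousLinearMap.comp_id, innerSL_apply_apply,
    smul_eq_mul, h4, nsmul_eq_mul]
  have h5 : Real.sqrt (η ^ 2 + ‖x - x₀‖ ^ 2) ≠ 0 := by positivity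
  field_simp
  push_cast
  ring

theorem sum_sq_partialDeriv_coneWeight_le (hη : 0 < η) (x : Space N) :
    ∑ i, (partialDeriv i (coneWeight lam η x₀) x) ^ 2 ≤ lam ^ 2 * (coneWeight lam η x₀ x) ^ 2 := by
  have hp : 0 < η ^ 2 + ‖x - x₀‖ ^ 2 := by positivity
  simp_rw [partialDeriv_coneWeight hη, mul_pow, div_pow, Real.sq_sqrt hp.le]
  rw [← Finset.sum_mul, ← Finset.mul_sum, ← Finset.sum_div, ← EuclideanSpace.real_norm_sq_eq,
    neg_sq]
  refine mul_le_mul_of_nonneg_right ?_ (sq_nonneg _)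
  refine mul_le_of_le_one_right (sq_nonneg _) ?_
  rw [div_le_one hp]
  nlinarith [sq_nonneg η]

theorem abs_partialDeriv_coneWeight_le_mul (hη : 0 < η) (hl : 0 ≤ lam) (i : Fin N) (x : Space N) :
    |partialDeriv i (coneWeight lam η x₀) x| ≤ lam * |coneWeight lam η x₀ x| := by
  have h1 := Finset.single_le_sum (f := fun i => (partialDeriv i (coneWeight lam η x₀) x) ^ 2)
    (fun i _ => sq_nonneg _) (Finset.mem_univ i)
  have h2 := h1.trans (sum_sq_partialDeriv_coneWeight_le hη x)
  refine abs_le_of_sq_le_sq' ?_ (by positivity) |> abs_le.2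
  rw [mul_pow, sq_abs]
  exact h2

theorem abs_coneWeight_le (hl : 0 ≤ lam) (x : Space N) : |coneWeight lam η x₀ x| ≤ 1 := by
  rw [abs_of_pos (coneWeight_pos x)]; exact coneWeight_le_one hl x

theorem abs_partialDeriv_coneWeight_le (hη : 0 < η) (hl : 0 ≤ lam) (i : Fin N) (x : Space N) :
    |partialDeriv i (coneWeight lam η x₀) x| ≤ lam :=
  (abs_partialDeriv_coneWeight_le_mul hη hl i x).trans
    (mul_le_of_le_one_right hl (abs_coneWeight_le hl x))

end coneWeight

theorem norm_sq_L2_eq (w : L2 N) : ‖w‖ ^ 2 = ∫ x, w x ^ 2 := by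
  rw [← real_inner_self_eq_norm_sq, inner_L2_eq]
  simp_rw [sq]

theorem coeFn_sum_L2 {ι : Type*} (s : Finset ι) (w : ι → L2 N) :
    (∑ i ∈ s, w i : L2 N) =ᵐ[volume] fun x => ∑ i ∈ s, w i x := by
  classical
  induction s using Finset.induction_on with
  | empty =>
    simp only [Finset.sum_empty]
    exact Lp.coeFn_zero ℝ 2 _
  | insert i s hi ih =>
    simp only [Finset.sum_insert hi]
    filter_upwards [Lp.coeFn_add (w i) (∑ j ∈ s, w j), ih] with x h1 h2
    rw [h1, Pi.add_apply, h2]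

/-- The Cauchy–Schwarz bound for the flux term of the energy identity. -/
theorem norm_sum_mulL2_sq_le {σ : Space N → ℝ} {d : Fin N → Space N → ℝ} (hσ : Continuous σ)
    (hd : ∀ i, Continuous (d i)) {C C' : ℝ} (hb : ∀ x, |σ x| ≤ C) (hb' : ∀ i x, |d i x| ≤ C')
    {lam : ℝ} (hlam : ∀ x, ∑ i, d i x ^ 2 ≤ lam ^ 2 * σ x ^ 2) (w : Fin N → L2 N) :
    ‖∑ i, mulL2 (d i) (hd i) C' (hb' i) (w i)‖ ^ 2
      ≤ lam ^ 2 * ∑ i, ‖mulL2 σ hσ C hb (w i)‖ ^ 2 := by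
  simp_rw [norm_sq_L2_eq]
  have hint : ∀ v : L2 N, Integrable fun x => v x ^ 2 := fun v => by
    simpa [sq] using integrable_mul_L2 v v
  rw [← integral_finsetSum _ (fun i _ => hint _), ← integral_const_mul]
  refine integral_mono_ae (hint _) ((integrable_finsetSum _ fun i _ => hint _).const_mul _) ?_
  have e1 : ∀ᵐ x : Space N, ∀ i, mulL2 (d i) (hd i) C' (hb' i) (w i) x = d i x * w i x :=
    ae_all_iff.2 fun i => coeFn_mulL2 (hd i) (hb' i) (w i)
  have e2 : ∀ᵐ x : Space N, ∀ i, mulL2 σ hσ C hb (w i) x = σ x * w i x :=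
    ae_all_iff.2 fun i => coeFn_mulL2 hσ hb (w i)
  filter_upwards [e1, e2, coeFn_sum_L2 Finset.univ
    (fun i => mulL2 (d i) (hd i) C' (hb' i) (w i))] with x h1 h2 h3
  rw [h3]
  simp only [h1, h2, mul_pow]
  rw [← Finset.mul_sum, ← mul_assoc]
  refine (Finset.sum_mul_sq_le_sq_mul_sq _ _ _).trans ?_
  exact mul_le_mul_of_nonneg_right (hlam x) (Finset.sum_nonneg fun i _ => sq_nonneg _)

/-! ### The weighted energy estimate -/

/-- The weighted energy `‖W v‖² + c² ‖W ∇w‖² + k² ‖W w‖²`. -/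
noncomputable def weightedEnergy (c k : ℝ) (W : L2 N →L[ℝ] L2 N) (w : H2 N) (v : L2 N) : ℝ :=
  ‖W v‖ ^ 2 + c ^ 2 * ∑ i, ‖W (w.1.2.1 i)‖ ^ 2 + k ^ 2 * ‖W w.toL2‖ ^ 2

namespace AdmissibleCoeff

variable {a b : ℝ → ℝ}

theorem hasDerivWithinAt_a (hab : AdmissibleCoeff a b) {t : ℝ} (ht : 0 ≤ t) :
    HasDerivWithinAt a (derivWithin a (Ici 0) t) (Ici 0) t :=
  (hab.a_contDiff.differentiableOn (by norm_num) t ht).hasDerivWithinAt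

theorem hasDerivAt_a (hab : AdmissibleCoeff a b) {t : ℝ} (ht : 0 < t) :
    HasDerivAt a (derivWithin a (Ici 0) t) t :=
  (hab.hasDerivWithinAt_a ht.le).hasDerivAt (Ici_mem_nhds ht)

theorem continuousOn_a (hab : AdmissibleCoeff a b) : ContinuousOn a (Ici 0) :=
  hab.a_contDiff.continuousOn

theorem continuousOn_derivWithin_a (hab : AdmissibleCoeff a b) :
    ContinuousOn (derivWithin a (Ici 0)) (Ici 0) :=
  hab.a_contDiff.continuousOn_derivWithin (uniqueDiffOn_Ici 0) (by norm_num)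

end AdmissibleCoeff

/-- The primitive of a function continuous on the half line is differentiable. -/
theorem hasDerivAt_primitive {c : ℝ → ℝ} (hc : ContinuousOn c (Ici 0)) {t : ℝ} (ht : 0 < t) :
    HasDerivAt (fun s => ∫ r in (0 : ℝ)..s, c r) (c t) t := by
  refine intervalIntegral.integral_hasDerivAt_right ?_ ?_ (hc.continuousAt (Ici_mem_nhds ht))
  · refine (hc.mono fun x hx => ?_).intervalIntegrable
    rw [uIcc_of_le ht.le] at hx
    exact hx.1
  · exact (hc.mono Ioi_subset_Ici_self).stronglyMeasurableAtFilter isOpen_Ioi t ht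

theorem continuousOn_primitive {c : ℝ → ℝ} (hc : ContinuousOn c (Ici 0)) :
    ContinuousOn (fun s => ∫ r in (0 : ℝ)..s, c r) (Ici 0) := by
  intro t ht
  have h1 : IntegrableOn c (Icc 0 (t + 1)) :=
    (hc.mono Icc_subset_Ici_self).integrableOn_compact isCompact_Icc
  have ht' : (0 : ℝ) ≤ t + 1 := by linarith [mem_Ici.1 ht]
  have h2 := intervalIntegral.continuousOn_primitive_interval (a := 0) (b := t + 1) (f := c)
    (μ := volume) (by rwa [uIcc_of_le ht'])
  rw [uIcc_of_le ht'] at h2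
  refine (h2 t ⟨ht, by linarith⟩).mono_of_mem_nhdsWithin ?_
  have := inter_mem_nhdsWithin (Ici (0 : ℝ)) (Iio_mem_nhds (show t < t + 1 by linarith))
  exact mem_of_superset this fun x hx => ⟨hx.1, (mem_Iio.1 hx.2).le⟩

/-- Gronwall's inequality with a variable rate. -/
theorem le_mul_exp_of_deriv_le {E E' R r : ℝ → ℝ} {t₁ : ℝ} (hE : ContinuousOn E (Icc 0 t₁))
    (hE' : ∀ t ∈ Ioo 0 t₁, HasDerivAt E (E' t) t) (hR : ContinuousOn R (Icc 0 t₁))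
    (hR' : ∀ t ∈ Ioo 0 t₁, HasDerivAt R (r t) t) (hR0 : R 0 = 0)
    (hle : ∀ t ∈ Ioo 0 t₁, E' t ≤ r t * E t) {t : ℝ} (ht : t ∈ Icc 0 t₁) :
    E t ≤ E 0 * Real.exp (R t) := by
  have anti : AntitoneOn (fun s => E s * Real.exp (-R s)) (Icc 0 t₁) := by
    refine antitoneOn_of_hasDerivWithinAt_nonpos (convex_Icc 0 t₁)
      (f' := fun s => E' s * Real.exp (-R s) + E s * (Real.exp (-R s) * -r s))
      (hE.mul (Real.continuous_exp.comp_continuousOn hR.neg)) (fun s hs => ?_) fun s hs => ?_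
    · rw [interior_Icc] at hs
      exact ((hE' s hs).mul (hR' s hs).neg.exp).hasDerivWithinAt
    · rw [interior_Icc] at hs
      have := hle s hs
      have he := Real.exp_pos (-R s)
      nlinarith
  have h0 := anti ⟨le_rfl, ht.1.trans ht.2⟩ ht ht.1
  simp only [hR0, neg_zero, Real.exp_zero, mul_one] at h0
  have he := Real.exp_pos (R t)
  have := mul_le_mul_of_nonneg_right h0 he.le
  rwa [mul_assoc, ← Real.exp_add, neg_add_cancel, Real.exp_zero, mul_one] at this

/-- The elementary inequality behind the weighted energy estimate. -/
theorem energy_rate_le {y z S x n c c' k lam M m C q₁ q₂ q₃ d E : ℝ}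
    (hE : E = y ^ 2 + c ^ 2 * S + k ^ 2 * z ^ 2) (hS : 0 ≤ S) (hy : 0 ≤ y)
    (hq₁ : q₁ ≤ y * n) (hn : n ≤ C * Real.sqrt E) (hC : 0 ≤ C) (hq₂ : -q₂ ≤ x * y)
    (hxS : x ^ 2 ≤ lam ^ 2 * S) (hq₃ : q₃ ≤ z * y) (hd : 0 ≤ d) (hm : 0 < m) (hmc : m ≤ c)
    (hc' : c' ≤ M) (hM : 0 ≤ M) (hlam : 0 < lam) (hk : 0 < k) :
    2 * (q₁ - d * y ^ 2) + 2 * c * c' * S + c ^ 2 * (-4 * q₂) + k ^ 2 * (2 * q₃)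
      ≤ (2 * lam * c + (k + (2 * C + 2 * M / m))) * E := by
  have hc : 0 < c := hm.trans_le hmc
  have hcS : 0 ≤ c ^ 2 * S := by positivity
  have hE0 : 0 ≤ E := by rw [hE]; positivity
  have hye : y ≤ Real.sqrt E := Real.le_sqrt_of_sq_le (by rw [hE]; nlinarith [sq_nonneg (k * z)])
  have hee : Real.sqrt E ^ 2 = E := Real.sq_sqrt hE0
  have he0 : 0 ≤ Real.sqrt E := Real.sqrt_nonneg _
  have j1 : y * n ≤ C * E := by
    calc y * n ≤ y * (C * Real.sqrt E) := by gcongr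
      _ ≤ Real.sqrt E * (C * Real.sqrt E) := by gcongr
      _ = C * E := by rw [← hee, Real.sqrt_sq he0]; ring
  have j2 : c * c' * S ≤ M / m * (c ^ 2 * S) := by
    have h2 : 1 ≤ c / m := (one_le_div hm).2 hmc
    calc c * c' * S ≤ c * M * S := by gcongr
      _ = c * M * S * 1 := by ring
      _ ≤ c * M * S * (c / m) := by gcongr
      _ = _ := by ring
  have j3 : 2 * c * (x * y) ≤ lam * (c ^ 2 * S + y ^ 2) := by
    have h1 : 2 * (c * x) * (lam * y) ≤ (c * x) ^ 2 + (lam * y) ^ 2 := two_mul_le_add_sq _ _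
    have h2 : (c * x) ^ 2 ≤ lam ^ 2 * (c ^ 2 * S) := by
      rw [mul_pow]
      calc c ^ 2 * x ^ 2 ≤ c ^ 2 * (lam ^ 2 * S) := by gcongr
        _ = _ := by ring
    refine le_of_mul_le_mul_left ?_ hlam
    nlinarith
  have j4 : 2 * k ^ 2 * (z * y) ≤ k * (k ^ 2 * z ^ 2 + y ^ 2) := by
    have h1 := two_mul_le_add_sq (k * z) y
    nlinarith
  have m1 : M / m * (c ^ 2 * S) ≤ M / m * E := by
    refine mul_le_mul_of_nonneg_left ?_ (by positivity)
    rw [hE]; nlinarith [sq_nonneg y, sq_nonneg (k * z)]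
  have m2 : lam * (c ^ 2 * S + y ^ 2) ≤ lam * E := by
    refine mul_le_mul_of_nonneg_left ?_ hlam.le
    rw [hE]; nlinarith [sq_nonneg (k * z)]
  have m3 : k * (k ^ 2 * z ^ 2 + y ^ 2) ≤ k * E := by
    refine mul_le_mul_of_nonneg_left ?_ hk.le
    rw [hE]; nlinarith
  have n1 : c ^ 2 * (-4 * q₂) ≤ 2 * c * (lam * E) := by
    have h1 : c ^ 2 * (-4 * q₂) = 2 * c * (2 * c * (-q₂)) := by ring
    rw [h1]
    refine mul_le_mul_of_nonneg_left (le_trans ?_ (j3.trans m2)) (by positivity)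
    exact mul_le_mul_of_nonneg_left hq₂ (by positivity)
  have n2 : k ^ 2 * (2 * q₃) ≤ k * E := by
    refine le_trans ?_ (j4.trans m3)
    have := mul_le_mul_of_nonneg_left hq₃ (show 0 ≤ 2 * k ^ 2 by positivity)
    linarith
  have n3 : 0 ≤ d * y ^ 2 := by positivity
  have e1 : (2 * lam * c + (k + (2 * C + 2 * M / m))) * E
      = 2 * c * (lam * E) + k * E + 2 * (C * E) + 2 * (M / m * E) := by ring
  rw [e1]
  linarith

/-- The weighted elliptic identity: the flux through the gradient terms of the energy. -/
theorem IsStrongSolution.sum_inner_partial_eq {a b : ℝ → ℝ} {p T : ℝ} {f : H2 N} {g : H1 N}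
    {u : ℝ → H2 N} (h : IsStrongSolution a b p f g T u) {s : ℝ} (hs : s ∈ Ico 0 T)
    {σ : Space N → ℝ} (hσ : ContDiff ℝ ∞ σ) {C₀ C₁ : ℝ} (hb : ∀ x, |σ x| ≤ C₀)
    (hb' : ∀ i x, |partialDeriv i σ x| ≤ C₁) :
    ∑ i, 2 * inner ℝ (mulL2 σ hσ.continuous C₀ hb ((u s).1.2.1 i)) (mulL2 σ hσ.continuous C₀ hb
        ((derivWithin (fun s => (u s).toH1) (Ico 0 T) s).1.2 i))
      = -2 * inner ℝ (mulL2 σ hσ.continuous C₀ hb (u s).laplacian) (mulL2 σ hσ.continuous C₀ hb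
          (derivWithin (fun s => (u s).toL2) (Ico 0 T) s))
        - 4 * inner ℝ (∑ i, mulL2 (partialDeriv i σ) (continuous_partialDeriv hσ) C₁ (hb' i)
          ((u s).1.2.1 i)) (mulL2 σ hσ.continuous C₀ hb
          (derivWithin (fun s => (u s).toL2) (Ico 0 T) s)) := by
  have h1 := fun i =>
    inner_mulL2_weakPartial ((u s).2.2 i i) (h.hasWeakPartial_deriv hs i) hσ hb (hb' i)
  have h2 : mulL2 σ hσ.continuous C₀ hb (u s).laplacian
      = ∑ i, mulL2 σ hσ.continuous C₀ hb ((u s).1.2.2 i i) := by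
    rw [H2.laplacian, map_sum]
  rw [h2, sum_inner, sum_inner, Finset.mul_sum, Finset.mul_sum, ← Finset.sum_sub_distrib]
  refine Finset.sum_congr rfl fun i _ => ?_
  rw [h1 i]
  ring

/-- The equation, tested against the velocity with the weight. -/
theorem IsStrongSolution.inner_deriv_second_eq {a b : ℝ → ℝ} {p T : ℝ} {f : H2 N} {g : H1 N}
    {u : ℝ → H2 N} (h : IsStrongSolution a b p f g T u) {s : ℝ} (hs : s ∈ Ico 0 T)
    (W : L2 N →L[ℝ] L2 N) :
    ∃ F : L2 N, F =ᵐ[volume] (fun x => |(u s).toL2 x| ^ p) ∧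
      inner ℝ (W (derivWithin (fun s => (u s).toL2) (Ico 0 T) s))
          (W (iteratedDerivWithin 2 (fun s => (u s).toL2) (Ico 0 T) s))
        = a s ^ 2 * inner ℝ (W (u s).laplacian)
            (W (derivWithin (fun s => (u s).toL2) (Ico 0 T) s))
          + (inner ℝ (W (derivWithin (fun s => (u s).toL2) (Ico 0 T) s)) (W F)
            - b s * ‖W (derivWithin (fun s => (u s).toL2) (Ico 0 T) s)‖ ^ 2) := by
  refine ⟨_, h.equation s hs, ?_⟩
  generalize derivWithin (fun s => (u s).toL2) (Ico 0 T) s = V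
  generalize iteratedDerivWithin 2 (fun s => (u s).toL2) (Ico 0 T) s = A
  generalize (u s).laplacian = L
  rw [map_add, map_sub, map_smul, map_smul, inner_add_right, inner_sub_right,
    inner_smul_right, inner_smul_right, real_inner_self_eq_norm_sq, real_inner_comm (W V) (W L)]
  ring

/-- The weighted energy estimate. The point is that the growth rate is `2 λ a`, up to an
arbitrarily small multiple of `λ` and a constant independent of `λ`. -/
theorem IsStrongSolution.exists_energy_le {a b : ℝ → ℝ} {p T : ℝ} {f : H2 N} {g : H1 N}
    {u : ℝ → H2 N} (h : IsStrongSolution a b p f g T u) (hab : AdmissibleCoeff a b) (hp : 1 < p)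
    (hpN : 5 ≤ N → p ≤ ((N : ℝ) - 2) / ((N : ℝ) - 4)) {t₁ : ℝ} (ht₁ : t₁ ∈ Ico 0 T) {κ : ℝ}
    (hκ : 0 < κ) :
    ∃ C₃ : ℝ, ∀ (lam : ℝ) (_ : 1 ≤ lam) (σ : Space N → ℝ) (hσ : ContDiff ℝ ∞ σ) (C₀ C₁ : ℝ)
      (hb : ∀ x, |σ x| ≤ C₀) (_ : ∀ i x, |partialDeriv i σ x| ≤ C₁)
      (_ : ∀ i x, |partialDeriv i σ x| ≤ lam * |σ x|)
      (_ : ∀ x, ∑ i, (partialDeriv i σ x) ^ 2 ≤ lam ^ 2 * σ x ^ 2), ∀ t ∈ Icc 0 t₁,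
      weightedEnergy (a t) (κ * lam) (mulL2 σ hσ.continuous C₀ hb) (u t)
          (derivWithin (fun s => (u s).toL2) (Ico 0 T) t)
        ≤ weightedEnergy (a 0) (κ * lam) (mulL2 σ hσ.continuous C₀ hb) (u 0)
            (derivWithin (fun s => (u s).toL2) (Ico 0 T) 0)
          * Real.exp (2 * lam * (∫ r in (0 : ℝ)..t, a r) + (κ * lam + C₃) * t) := by
  have hsub : Icc 0 t₁ ⊆ Ico 0 T := fun x hx => ⟨hx.1, hx.2.trans_lt ht₁.2⟩
  have hsub' : Icc (0 : ℝ) t₁ ⊆ Ici 0 := Icc_subset_Ici_self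
  obtain ⟨R, hR⟩ : ∃ R : NNReal, ∀ t ∈ Icc 0 t₁, ‖u t‖ < R := by
    obtain ⟨R, hR⟩ := isCompact_Icc.exists_bound_of_continuousOn (h.continuous_H2.mono hsub)
    refine ⟨Real.toNNReal (R + 1), fun t ht => ?_⟩
    have := hR t ht
    rw [Real.coe_toNNReal _ (by linarith [norm_nonneg (u t)])]
    linarith
  obtain ⟨C, hC0, hC⟩ := exists_eLpNorm_weight_mul_rpow_le (N := N) hp hpN R
  obtain ⟨tm, htm, hmin⟩ := isCompact_Icc.exists_isMinOn (nonempty_Icc.2 ht₁.1)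
    (hab.continuousOn_a.mono hsub')
  set am := a tm
  have ham : 0 < am := hab.a_pos tm htm.1
  have hamle : ∀ t ∈ Icc 0 t₁, am ≤ a t := fun t ht => hmin ht
  obtain ⟨M, hM⟩ := isCompact_Icc.exists_bound_of_continuousOn
    (hab.continuousOn_derivWithin_a.mono hsub')
  have hM0 : 0 ≤ M := (norm_nonneg _).trans (hM tm htm)
  set C₂ : ℝ := C * (1 / κ + N * (1 / κ + 1 / am))
  refine ⟨2 * C₂ + 2 * M / am, fun lam hlam σ hσ C₀ C₁ hb hb' hder hsum t ht => ?_⟩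
  set W := mulL2 σ hσ.continuous C₀ hb
  let D := fun i => mulL2 (partialDeriv i σ) (continuous_partialDeriv hσ) C₁ (hb' i)
  set U : ℝ → L2 N := fun s => (u s).toL2
  set V : ℝ → L2 N := derivWithin U (Ico 0 T)
  set A : ℝ → L2 N := iteratedDerivWithin 2 U (Ico 0 T)
  set G : Fin N → ℝ → L2 N := fun i s => (u s).1.2.1 i
  set G' : Fin N → ℝ → L2 N := fun i s => (derivWithin (fun s => (u s).toH1) (Ico 0 T) s).1.2 i
  set k := κ * lam
  have hk : 0 < k := by positivity
  have hU : ∀ s ∈ Ico 0 T, HasDerivWithinAt U (V s) (Ico 0 T) s := fun s hs =>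
    h.hasDerivWithinAt_toL2 hs
  have hV : ∀ s ∈ Ico 0 T, HasDerivWithinAt V (A s) (Ico 0 T) s := fun s hs =>
    h.hasDerivWithinAt_deriv hs
  have hG : ∀ i, ∀ s ∈ Ico 0 T, HasDerivWithinAt (G i) (G' i s) (Ico 0 T) s := fun i s hs =>
    h.hasDerivWithinAt_partial hs i
  have hUc : ContinuousOn U (Icc 0 t₁) := fun s hs =>
    ((hU s (hsub hs)).continuousWithinAt).mono hsub
  have hVc : ContinuousOn V (Icc 0 t₁) := fun s hs =>
    ((hV s (hsub hs)).continuousWithinAt).mono hsub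
  have hGc : ∀ i, ContinuousOn (G i) (Icc 0 t₁) := fun i s hs =>
    ((hG i s (hsub hs)).continuousWithinAt).mono hsub
  have hac : ContinuousOn a (Icc 0 t₁) := hab.continuousOn_a.mono hsub'
  set E : ℝ → ℝ := fun s => ‖W (V s)‖ ^ 2 + a s ^ 2 * ∑ i, ‖W (G i s)‖ ^ 2 + k ^ 2 * ‖W (U s)‖ ^ 2
  set a' := derivWithin a (Ici 0)
  change E t ≤ E 0 * _
  have hEc : ContinuousOn E (Icc 0 t₁) := by
    refine ContinuousOn.add (ContinuousOn.add ?_ (ContinuousOn.mul (hac.pow 2) ?_)) ?_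
    · exact (W.continuous.comp_continuousOn hVc).norm.pow 2
    · exact continuousOn_finsetSum _ fun i _ => (W.continuous.comp_continuousOn (hGc i)).norm.pow 2
    · exact continuousOn_const.mul ((W.continuous.comp_continuousOn hUc).norm.pow 2)
  have hnh : ∀ s ∈ Ioo 0 t₁, Ico 0 T ∈ 𝓝 s := fun s hs =>
    Ico_mem_nhds hs.1 (hs.2.trans ht₁.2)
  have hE' : ∀ s ∈ Ioo 0 t₁, HasDerivAt E (2 * inner ℝ (W (V s)) (W (A s))
      + (2 * a s * a' s * ∑ i, ‖W (G i s)‖ ^ 2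
        + a s ^ 2 * ∑ i, 2 * inner ℝ (W (G i s)) (W (G' i s)))
      + k ^ 2 * (2 * inner ℝ (W (U s)) (W (V s)))) s := by
    intro s hs
    have hs' : s ∈ Ico 0 T := hsub ⟨hs.1.le, hs.2.le⟩
    have d1 := (W.hasFDerivAt.comp_hasDerivAt s ((hV s hs').hasDerivAt (hnh s hs))).norm_sq
    have d2 := (W.hasFDerivAt.comp_hasDerivAt s ((hU s hs').hasDerivAt (hnh s hs))).norm_sq
    have d3 := fun i =>
      (W.hasFDerivAt.comp_hasDerivAt s ((hG i s hs').hasDerivAt (hnh s hs))).norm_sq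
    have d4 : HasDerivAt (fun r => a r ^ 2) (2 * a s * a' s) s := by
      have := (hab.hasDerivAt_a hs.1).fun_pow 2
      simp only [Nat.cast_ofNat, Nat.add_one_sub_one, pow_one] at this
      exact this
    have d5 := HasDerivAt.fun_sum (u := Finset.univ) fun i _ => d3 i
    have := (d1.add (d4.mul d5)).add (d2.const_mul (k ^ 2))
    refine this.congr_deriv ?_
    simp only [Function.comp_apply]
  have key := le_mul_exp_of_deriv_le (E := E)
    (R := fun s => 2 * lam * (∫ r in (0 : ℝ)..s, a r) + (k + (2 * C₂ + 2 * M / am)) * s)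
    (r := fun s => 2 * lam * a s + (k + (2 * C₂ + 2 * M / am))) hEc hE' ?_ ?_ (by simp) ?_ ht
  · exact key
  · exact (continuousOn_const.mul ((continuousOn_primitive hab.continuousOn_a).mono hsub')).add
      (continuousOn_const.mul continuousOn_id)
  · intro s hs
    have := ((hasDerivAt_primitive hab.continuousOn_a hs.1).const_mul (2 * lam)).add
      ((hasDerivAt_id s).const_mul (k + (2 * C₂ + 2 * M / am)))
    exact this.congr_deriv (by ring)
  intro s hs
  have hs₁ : s ∈ Icc 0 t₁ := ⟨hs.1.le, hs.2.le⟩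
  have hs' : s ∈ Ico 0 T := hsub hs₁
  have has : 0 < a s := hab.a_pos s hs.1.le
  have hbs : 0 ≤ b s := hab.b_nonneg s hs.1.le
  obtain ⟨F, hFae, hWA⟩ := h.inner_deriv_second_eq hs' W
  have hWF : ‖W F‖ ≤ C * (‖W (U s)‖ + ∑ i, (‖D i (U s)‖ + ‖W (G i s)‖)) := by
    have h1 := hC (u s) (hR s hs₁) σ hσ C₀ C₁ hb hb'
    have h2 : eLpNorm (W F) 2 volume = eLpNorm (fun x => σ x * |(u s).toL2 x| ^ p) 2 volume := by
      refine eLpNorm_congr_ae ?_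
      filter_upwards [coeFn_mulL2 hσ.continuous hb F, hFae] with x h3 h4
      rw [h3, h4]
    rw [← h2] at h1
    rw [Lp.norm_def]
    exact ENNReal.toReal_le_of_le_ofReal (by positivity) h1
  have hX : ‖∑ i, D i (G i s)‖ ^ 2 ≤ lam ^ 2 * ∑ i, ‖W (G i s)‖ ^ 2 :=
    norm_sum_mulL2_sq_le hσ.continuous (fun i => continuous_partialDeriv hσ) hb hb' hsum _
  have hell := h.sum_inner_partial_eq hs' hσ hb hb'
  have hEs : E s = ‖W (V s)‖ ^ 2 + a s ^ 2 * ∑ i, ‖W (G i s)‖ ^ 2 + k ^ 2 * ‖W (U s)‖ ^ 2 := rfl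
  have hS0 : 0 ≤ ∑ i, ‖W (G i s)‖ ^ 2 := Finset.sum_nonneg fun i _ => sq_nonneg _
  have hcS : 0 ≤ a s ^ 2 * ∑ i, ‖W (G i s)‖ ^ 2 := by positivity
  have hze : k * ‖W (U s)‖ ≤ Real.sqrt (E s) := Real.le_sqrt_of_sq_le (by
    rw [hEs, mul_pow]; nlinarith [sq_nonneg ‖W (V s)‖])
  have hlz : lam * ‖W (U s)‖ ≤ 1 / κ * Real.sqrt (E s) := by
    rw [one_div, inv_mul_eq_div, le_div_iff₀ hκ]
    calc lam * ‖W (U s)‖ * κ = k * ‖W (U s)‖ := by ring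
      _ ≤ _ := hze
  have hz1 : ‖W (U s)‖ ≤ 1 / κ * Real.sqrt (E s) :=
    le_trans (le_mul_of_one_le_left (norm_nonneg _) hlam) hlz
  have hge : ∀ i, ‖W (G i s)‖ ≤ 1 / am * Real.sqrt (E s) := by
    intro i
    rw [one_div, inv_mul_eq_div, le_div_iff₀ ham]
    refine Real.le_sqrt_of_sq_le ?_
    have h1 : ‖W (G i s)‖ ^ 2 ≤ ∑ i, ‖W (G i s)‖ ^ 2 :=
      Finset.single_le_sum (f := fun i => ‖W (G i s)‖ ^ 2) (fun i _ => sq_nonneg _)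
        (Finset.mem_univ i)
    have h2 : am ^ 2 ≤ a s ^ 2 := pow_le_pow_left₀ ham.le (hamle s hs₁) 2
    rw [hEs, mul_pow]
    have h3 : ‖W (G i s)‖ ^ 2 * am ^ 2 ≤ (∑ i, ‖W (G i s)‖ ^ 2) * a s ^ 2 := by gcongr
    nlinarith [sq_nonneg ‖W (V s)‖, sq_nonneg (k * ‖W (U s)‖)]
  have hDe : ∀ i, ‖D i (U s)‖ ≤ 1 / κ * Real.sqrt (E s) := fun i =>
    (norm_mulL2_le_mul _ (hb' i) hσ.continuous hb (hder i) (U s)).trans hlz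
  have hWF' : ‖W F‖ ≤ C₂ * Real.sqrt (E s) := by
    refine hWF.trans ?_
    have h1 : ∑ i, (‖D i (U s)‖ + ‖W (G i s)‖)
        ≤ ∑ _i : Fin N, (1 / κ * Real.sqrt (E s) + 1 / am * Real.sqrt (E s)) :=
      Finset.sum_le_sum fun i _ => add_le_add (hDe i) (hge i)
    rw [Finset.sum_const, Finset.card_univ, Fintype.card_fin, nsmul_eq_mul] at h1
    calc _ ≤ C * (1 / κ * Real.sqrt (E s)
          + N * (1 / κ * Real.sqrt (E s) + 1 / am * Real.sqrt (E s))) := by gcongr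
      _ = C₂ * Real.sqrt (E s) := by simp only [C₂]; ring
  have hrate := energy_rate_le hEs hS0 (norm_nonneg _)
    (real_inner_le_norm (W (V s)) (W F)) hWF' (by positivity : 0 ≤ C₂)
    ((neg_le_abs _).trans (abs_real_inner_le_norm (∑ i, D i (G i s)) (W (V s)))) hX
    (real_inner_le_norm (W (U s)) (W (V s))) hbs ham (hamle s hs₁)
    ((le_abs_self _).trans (hM s hs₁)) hM0 (by linarith : 0 < lam) hk
  refine le_trans (le_of_eq ?_) hrate
  have e2 : ∀ q₁ q₂ q₃ S₁ S₂ q₄ d y : ℝ, q₁ = a s ^ 2 * q₄ + (q₂ - d) →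
      S₂ = -2 * q₄ - 4 * y → 2 * q₁ + (2 * a s * a' s * S₁ + a s ^ 2 * S₂) + k ^ 2 * (2 * q₃)
        = 2 * (q₂ - d) + 2 * a s * a' s * S₁ + a s ^ 2 * (-4 * y) + k ^ 2 * (2 * q₃) := by
    intro q₁ q₂ q₃ S₁ S₂ q₄ d y h1 h2
    rw [h1, h2]; ring
  exact e2 _ _ _ _ _ _ _ _ hWA hell

/-! ### Finite speed of propagation -/

/-- The weight is exponentially small on data supported away from `x₀`. -/
theorem norm_mulL2_coneWeight_le {lam η : ℝ} {x₀ : Space N} (hη : 0 < η) (hl : 0 ≤ lam)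
    {r : ℝ} {w : L2 N} (hw : ∀ᵐ x : Space N, r < ‖x‖ → w x = 0) :
    ‖mulL2 (coneWeight lam η x₀) (contDiff_coneWeight hη).continuous 1 (abs_coneWeight_le hl) w‖
      ≤ Real.exp (-lam * (‖x₀‖ - r)) * ‖w‖ := by
  refine Lp.norm_le_mul_norm_of_ae_le_mul ?_
  filter_upwards [coeFn_mulL2 (contDiff_coneWeight hη).continuous (abs_coneWeight_le hl) w, hw]
    with x h1 h2
  rw [h1, norm_mul]
  rcases lt_or_ge r ‖x‖ with h3 | h3
  · simp [h2 h3]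
  · refine mul_le_mul_of_nonneg_right ?_ (norm_nonneg _)
    rw [Real.norm_of_nonneg (coneWeight_pos x).le, coneWeight]
    refine Real.exp_le_exp.2 ?_
    have h4 : ‖x - x₀‖ ≤ Real.sqrt (η ^ 2 + ‖x - x₀‖ ^ 2) :=
      Real.le_sqrt_of_sq_le (by nlinarith [sq_nonneg η])
    have h5 : ‖x₀‖ - ‖x‖ ≤ ‖x - x₀‖ := by
      rw [norm_sub_rev]; exact norm_sub_norm_le _ _
    nlinarith

/-- The weight controls the mass near `x₀`. -/
theorem setIntegral_ball_le_norm_mulL2_coneWeight {lam η : ℝ} {x₀ : Space N} (hη : 0 < η)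
    (hl : 0 ≤ lam) (w : L2 N) :
    ∫ x in Metric.ball x₀ η, w x ^ 2 ≤ Real.exp (4 * lam * η) *
      ‖mulL2 (coneWeight lam η x₀) (contDiff_coneWeight hη).continuous 1
        (abs_coneWeight_le hl) w‖ ^ 2 := by
  rw [norm_sq_L2_eq, ← integral_const_mul]
  have hint : ∀ v : L2 N, Integrable fun x => v x ^ 2 := fun v => by
    simpa [sq] using integrable_mul_L2 v v
  set W := mulL2 (coneWeight lam η x₀) (contDiff_coneWeight hη).continuous 1
        (abs_coneWeight_le hl) w with hW
  refine le_trans ?_ (setIntegral_le_integral (s := Metric.ball x₀ η)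
    ((hint W).const_mul _) (ae_of_all _ fun x => by positivity))
  refine integral_mono_ae (hint w).integrableOn ((hint W).const_mul _).integrableOn ?_
  have h0 : ∀ᵐ x ∂(volume.restrict (Metric.ball x₀ η)), W x = coneWeight lam η x₀ x * w x :=
    ae_restrict_of_ae (coeFn_mulL2 (contDiff_coneWeight hη).continuous (abs_coneWeight_le hl) w)
  filter_upwards [h0, ae_restrict_mem Metric.isOpen_ball.measurableSet] with x h1 h2
  rw [h1, mul_pow, ← mul_assoc]
  refine le_mul_of_one_le_left (sq_nonneg _) ?_
  rw [coneWeight, ← Real.exp_nat_mul, ← Real.exp_add]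
  refine Real.one_le_exp ?_
  rw [mem_ball_iff_norm] at h2
  have h4 : Real.sqrt (η ^ 2 + ‖x - x₀‖ ^ 2) ≤ 2 * η := by
    refine Real.sqrt_le_iff.2 ⟨by positivity, ?_⟩
    nlinarith [norm_nonneg (x - x₀)]
  push_cast
  nlinarith

/-- A square-integrable function whose mass near each point of a set vanishes is zero there. -/
theorem ae_eq_zero_of_setIntegral_ball {w : L2 N} {O : Set (Space N)}
    (h : ∀ x₀ ∈ O, ∃ η > 0, ∫ x in Metric.ball x₀ η, w x ^ 2 ≤ 0) :
    ∀ᵐ x : Space N, x ∈ O → w x = 0 := by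
  have hint : Integrable fun x => w x ^ 2 := by simpa [sq] using integrable_mul_L2 w w
  rw [ae_iff]
  refine measure_null_of_locally_null _ fun x₀ hx₀ => ?_
  have hx₀' : x₀ ∈ O := by
    by_contra hc
    exact hx₀ fun hx => absurd hx hc
  obtain ⟨η, hη, h1⟩ := h x₀ hx₀'
  refine ⟨_, inter_mem_nhdsWithin _ (Metric.ball_mem_nhds x₀ hη), ?_⟩
  have h2 : ∫ x in Metric.ball x₀ η, w x ^ 2 = 0 :=
    le_antisymm h1 (integral_nonneg fun x => sq_nonneg _)
  rw [setIntegral_eq_zero_iff_of_nonneg_ae (ae_of_all _ fun x => sq_nonneg _)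
    hint.integrableOn] at h2
  have h3 := (ae_restrict_iff' Metric.isOpen_ball.measurableSet).1 h2
  refine measure_mono_null ?_ (ae_iff.1 h3)
  rintro x ⟨h4, h5⟩ h6
  refine h4 fun _ => ?_
  have := h6 h5
  simpa using this

/-- Finite speed of propagation: a strong solution with data supported in `{|x| ≤ r₀}` vanishes
outside the cone `{|x| ≤ r₀ + ∫₀ᵗ a}`. -/
theorem IsStrongSolution.ae_eq_zero {a b : ℝ → ℝ} {p T : ℝ} {f : H2 N} {g : H1 N}
    {u : ℝ → H2 N} (h : IsStrongSolution a b p f g T u) (hab : AdmissibleCoeff a b) (hp : 1 < p)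
    (hpN : 5 ≤ N → p ≤ ((N : ℝ) - 2) / ((N : ℝ) - 4)) {r₀ : ℝ}
    (hsupp : ∀ᵐ x : Space N, r₀ ≤ ‖x‖ → f.toL2 x = 0 ∧ g.toL2 x = 0) {t : ℝ} (ht : t ∈ Ico 0 T) :
    ∀ᵐ x : Space N, r₀ + (∫ r in (0 : ℝ)..t, a r) < ‖x‖ → (u t).toL2 x = 0 := by
  have hT : 0 < T := ht.1.trans_lt ht.2
  set A := ∫ r in (0 : ℝ)..t, a r with hA
  refine ae_eq_zero_of_setIntegral_ball (O := {x : Space N | r₀ + A < ‖x‖}) fun x₀ hx₀ => ?_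
  set gap := ‖x₀‖ - r₀ - A with hgap
  have hgap0 : 0 < gap := by
    have : r₀ + A < ‖x₀‖ := hx₀
    simp only [hgap]; linarith
  have ht0 : 0 ≤ t := ht.1
  -- The three losses in the exponent, namely `κ λ t`, `4 λ η`, and the growth `2 λ ∫ a` of the
  -- energy, must leave something of the gain `2 λ (|x₀| - r₀)` due to the weight of the data.
  set κ := gap / (2 * (t + 1)) with hκd
  have hκ : 0 < κ := by positivity
  have hκt : κ * t ≤ gap / 2 := by
    rw [hκd, div_mul_eq_mul_div, div_le_div_iff₀ (by positivity) (by positivity)]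
    nlinarith
  set η := gap / 8 with hηd
  have hη : 0 < η := by positivity
  refine ⟨η, hη, ?_⟩
  obtain ⟨C, hC⟩ := h.exists_energy_le hab hp hpN ht hκ
  -- the data vanish outside the ball, together with the gradient
  have hf0 : ∀ᵐ x : Space N, r₀ < ‖x‖ → f.toL2 x = 0 := by
    filter_upwards [hsupp] with x hx h1 using (hx h1.le).1
  have hg0 : ∀ᵐ x : Space N, r₀ < ‖x‖ → g.toL2 x = 0 := by
    filter_upwards [hsupp] with x hx h1 using (hx h1.le).2
  have hfi : ∀ i, ∀ᵐ x : Space N, r₀ < ‖x‖ → f.1.2.1 i x = 0 := fun i =>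
    (f.2.1 i).ae_eq_zero_of_isOpen (O := {x : Space N | r₀ < ‖x‖})
      (isOpen_lt continuous_const continuous_norm) hf0
  set E₀ := ‖g.toL2‖ ^ 2 + a 0 ^ 2 * ∑ i, ‖f.1.2.1 i‖ ^ 2 + κ ^ 2 * ‖f.toL2‖ ^ 2 with hE₀
  have hE₀0 : 0 ≤ E₀ := by
    have : 0 ≤ ∑ i, ‖f.1.2.1 i‖ ^ 2 := Finset.sum_nonneg fun i _ => sq_nonneg _
    positivity
  have main : ∀ lam : ℝ, 1 ≤ lam → κ ^ 2 * ∫ x in Metric.ball x₀ η, (u t).toL2 x ^ 2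
      ≤ E₀ * Real.exp (C * t) * Real.exp (-gap * lam) := by
    intro lam hlam
    have hl : 0 ≤ lam := by linarith
    have h1 := hC lam hlam (coneWeight lam η x₀) (contDiff_coneWeight hη) 1 lam
      (abs_coneWeight_le hl) (abs_partialDeriv_coneWeight_le hη hl)
      (abs_partialDeriv_coneWeight_le_mul hη hl) (sum_sq_partialDeriv_coneWeight_le hη) t
      ⟨ht0, le_rfl⟩
    have h2 := setIntegral_ball_le_norm_mulL2_coneWeight (x₀ := x₀) hη hl (u t).toL2
    rw [h.derivWithin_toL2_zero hT, h.initial_value] at h1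
    have w1 := norm_mulL2_coneWeight_le (x₀ := x₀) hη hl hf0
    have w2 := norm_mulL2_coneWeight_le (x₀ := x₀) hη hl hg0
    have w3 := fun i => norm_mulL2_coneWeight_le (x₀ := x₀) hη hl (hfi i)
    set W := mulL2 (coneWeight lam η x₀) (contDiff_coneWeight hη).continuous 1
        (abs_coneWeight_le hl) with hW
    set q := Real.exp (-lam * (‖x₀‖ - r₀)) with hq
    have hq0 : 0 < q := Real.exp_pos _
    have h3 : weightedEnergy (a 0) (κ * lam) W f g.toL2 ≤ lam ^ 2 * q ^ 2 * E₀ := by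
      have v1 : ‖W f.toL2‖ ^ 2 ≤ q ^ 2 * ‖f.toL2‖ ^ 2 := by
        rw [← mul_pow]; exact pow_le_pow_left₀ (norm_nonneg _) w1 2
      have v2 : ‖W g.toL2‖ ^ 2 ≤ q ^ 2 * ‖g.toL2‖ ^ 2 := by
        rw [← mul_pow]; exact pow_le_pow_left₀ (norm_nonneg _) w2 2
      have v3 : ∑ i, ‖W (f.1.2.1 i)‖ ^ 2 ≤ q ^ 2 * ∑ i, ‖f.1.2.1 i‖ ^ 2 := by
        rw [Finset.mul_sum]
        refine Finset.sum_le_sum fun i _ => ?_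
        rw [← mul_pow]; exact pow_le_pow_left₀ (norm_nonneg _) (w3 i) 2
      have hl1 : 1 ≤ lam ^ 2 := one_le_pow₀ hlam
      have hS : 0 ≤ ∑ i, ‖f.1.2.1 i‖ ^ 2 := Finset.sum_nonneg fun i _ => sq_nonneg _
      unfold weightedEnergy
      calc ‖W g.toL2‖ ^ 2 + a 0 ^ 2 * ∑ i, ‖W (f.1.2.1 i)‖ ^ 2 + (κ * lam) ^ 2 * ‖W f.toL2‖ ^ 2
          ≤ q ^ 2 * ‖g.toL2‖ ^ 2 + a 0 ^ 2 * (q ^ 2 * ∑ i, ‖f.1.2.1 i‖ ^ 2)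
            + (κ * lam) ^ 2 * (q ^ 2 * ‖f.toL2‖ ^ 2) := by gcongr
        _ = 1 * (q ^ 2 * (‖g.toL2‖ ^ 2 + a 0 ^ 2 * ∑ i, ‖f.1.2.1 i‖ ^ 2))
            + lam ^ 2 * (q ^ 2 * (κ ^ 2 * ‖f.toL2‖ ^ 2)) := by ring
        _ ≤ lam ^ 2 * (q ^ 2 * (‖g.toL2‖ ^ 2 + a 0 ^ 2 * ∑ i, ‖f.1.2.1 i‖ ^ 2))
            + lam ^ 2 * (q ^ 2 * (κ ^ 2 * ‖f.toL2‖ ^ 2)) := by gcongr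
        _ = lam ^ 2 * q ^ 2 * E₀ := by rw [hE₀]; ring
    have h4 : (κ * lam) ^ 2 * ‖W (u t).toL2‖ ^ 2
        ≤ weightedEnergy (a t) (κ * lam) W (u t)
          (derivWithin (fun s => (u s).toL2) (Ico 0 T) t) := by
      unfold weightedEnergy
      have : 0 ≤ ∑ i, ‖W ((u t).1.2.1 i)‖ ^ 2 := Finset.sum_nonneg fun i _ => sq_nonneg _
      have := mul_nonneg (sq_nonneg (a t)) this
      nlinarith [sq_nonneg ‖W (derivWithin (fun s => (u s).toL2) (Ico 0 T) t)‖]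
    have h5 : lam ^ 2 * (κ ^ 2 * ‖W (u t).toL2‖ ^ 2) ≤ lam ^ 2 * (q ^ 2 * E₀
        * Real.exp (2 * lam * A + (κ * lam + C) * t)) := by
      calc lam ^ 2 * (κ ^ 2 * ‖W (u t).toL2‖ ^ 2) = (κ * lam) ^ 2 * ‖W (u t).toL2‖ ^ 2 := by ring
        _ ≤ _ := h4.trans h1
        _ ≤ lam ^ 2 * q ^ 2 * E₀ * Real.exp (2 * lam * A + (κ * lam + C) * t) := by gcongr
        _ = _ := by ring
    have h6 := le_of_mul_le_mul_left h5 (by positivity)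
    have hexp : Real.exp (4 * lam * η) * q ^ 2 * Real.exp (2 * lam * A + (κ * lam + C) * t)
        ≤ Real.exp (C * t) * Real.exp (-gap * lam) := by
      rw [hq, ← Real.exp_nat_mul, ← Real.exp_add, ← Real.exp_add, ← Real.exp_add]
      refine Real.exp_le_exp.2 ?_
      have e1 : ‖x₀‖ - r₀ = gap + A := by rw [hgap]; ring
      have e2 : η = gap / 8 := rfl
      rw [e1, e2]
      have := mul_le_mul_of_nonneg_left hκt hl
      push_cast
      nlinarith
    calc κ ^ 2 * ∫ x in Metric.ball x₀ η, (u t).toL2 x ^ 2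
        ≤ κ ^ 2 * (Real.exp (4 * lam * η) * ‖W (u t).toL2‖ ^ 2) := by gcongr
      _ = Real.exp (4 * lam * η) * (κ ^ 2 * ‖W (u t).toL2‖ ^ 2) := by ring
      _ ≤ Real.exp (4 * lam * η) * (q ^ 2 * E₀
        * Real.exp (2 * lam * A + (κ * lam + C) * t)) := by gcongr
      _ = E₀ * (Real.exp (4 * lam * η) * q ^ 2
        * Real.exp (2 * lam * A + (κ * lam + C) * t)) := by ring
      _ ≤ E₀ * (Real.exp (C * t) * Real.exp (-gap * lam)) := by gcongr
      _ = _ := by ring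
  -- the estimate is uniform in `λ`, and its right side tends to zero
  have hlim : Tendsto (fun lam : ℝ => E₀ * Real.exp (C * t) * Real.exp (-gap * lam)) atTop
      (𝓝 (E₀ * Real.exp (C * t) * 0)) := by
    refine Tendsto.const_mul _ (Real.tendsto_exp_atBot.comp ?_)
    exact tendsto_id.const_mul_atTop_of_neg (by linarith)
  have h7 := ge_of_tendsto hlim (eventually_atTop.2 ⟨1, main⟩)
  rw [mul_zero] at h7
  by_contra! hc
  have : 0 < κ ^ 2 * ∫ x in Metric.ball x₀ η, (u t).toL2 x ^ 2 := by positivity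
  linarith

/-! ### Moments of a solution against smooth functions -/

/-- A square-integrable function vanishing outside a ball does not see a cutoff. -/
theorem mul_cutoff_mul_ae_eq {w : Space N → ℝ} {R : ℝ} {n : ℕ} (hn : R ≤ n)
    (hw : ∀ᵐ x : Space N, R < ‖x‖ → w x = 0) (φ : Space N → ℝ) :
    (fun x => w x * (cutoff N n x * φ x)) =ᵐ[volume] fun x => w x * φ x := by
  filter_upwards [hw] with x hx
  rcases lt_or_ge R ‖x‖ with h | h
  · simp [hx h]
  · rw [cutoff_eq_one (by linarith), one_mul]

theorem integrable_mul_of_ae_eq_zero {w : L2 N} {R : ℝ}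
    (hw : ∀ᵐ x : Space N, R < ‖x‖ → w x = 0) {φ : Space N → ℝ} (hφ : Continuous φ) :
    Integrable fun x => w x * φ x := by
  obtain ⟨n, hn⟩ := exists_nat_ge R
  exact (integrable_L2_mul w ((contDiff_cutoff n).continuous.mul hφ)
    ((hasCompactSupport_cutoff n).mul_right)).congr (mul_cutoff_mul_ae_eq hn hw φ)

/-- The Laplacian moves to the test function. -/
theorem H2.integral_laplacian_mul (w : H2 N) {ψ : Space N → ℝ} (hψ : ContDiff ℝ ∞ ψ)
    (hc : HasCompactSupport ψ) :
    ∫ x, w.laplacian x * ψ x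
      = ∫ x, w.toL2 x * ∑ i : Fin N, partialDeriv i (partialDeriv i ψ) x := by
  have hc' : ∀ i : Fin N, HasCompactSupport (partialDeriv i ψ) := fun i =>
    hasCompactSupport_partialDeriv hc
  have h1 : ∀ i : Fin N, ∫ x, w.1.2.2 i i x * ψ x
      = ∫ x, w.toL2 x * partialDeriv i (partialDeriv i ψ) x := by
    intro i
    have e1 := w.2.2 i i ψ hψ hc
    have e2 := w.2.1 i (partialDeriv i ψ) (contDiff_partialDeriv hψ) (hc' i)
    rw [H2.toL2, e2, e1, neg_neg]
  simp_rw [Finset.mul_sum]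
  rw [integral_finsetSum _ fun i _ => integrable_L2_mul w.toL2
      (continuous_partialDeriv (contDiff_partialDeriv hψ)) (hasCompactSupport_partialDeriv (hc' i)),
    ← Finset.sum_congr rfl fun i _ => h1 i,
    ← integral_finsetSum _ fun i _ => integrable_L2_mul (w.1.2.2 i i) hψ.continuous hc]
  refine integral_congr_ae ?_
  filter_upwards [coeFn_sum_L2 Finset.univ (fun i => w.1.2.2 i i)] with x hx
  rw [H2.laplacian, hx, Finset.sum_mul]

theorem partialDeriv_congr_of_eventuallyEq {i : Fin N} {φ ψ : Space N → ℝ} {x : Space N}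
    (h : φ =ᶠ[𝓝 x] ψ) : partialDeriv i φ =ᶠ[𝓝 x] partialDeriv i ψ := by
  filter_upwards [h.eventuallyEq_nhds] with y hy
  unfold partialDeriv
  rw [hy.fderiv_eq]

theorem laplacian_cutoff_mul {φ : Space N → ℝ} {n : ℕ} {x : Space N} (hx : ‖x‖ < n + 1) :
    ∑ i : Fin N, partialDeriv i (partialDeriv i fun y => cutoff N n y * φ y) x
      = ∑ i : Fin N, partialDeriv i (partialDeriv i φ) x := by
  have h1 : (fun y => cutoff N n y * φ y) =ᶠ[𝓝 x] φ := by
    filter_upwards [(isOpen_lt continuous_norm continuous_const).mem_nhds hx] with y hy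
    rw [cutoff_eq_one (le_of_lt hy), one_mul]
  exact Finset.sum_congr rfl fun i _ =>
    (partialDeriv_congr_of_eventuallyEq (partialDeriv_congr_of_eventuallyEq h1)).eq_of_nhds

namespace IsStrongSolution

variable {a b : ℝ → ℝ} {p T : ℝ} {f : H2 N} {g : H1 N} {u : ℝ → H2 N}

theorem exists_L2_rpow (h : IsStrongSolution a b p f g T u) {t : ℝ} (ht : t ∈ Ico 0 T) :
    ∃ F : L2 N, F =ᵐ[volume] fun x => |(u t).toL2 x| ^ p := ⟨_, h.equation t ht⟩

theorem integrable_rpow_mul (h : IsStrongSolution a b p f g T u) (hp : 1 < p) {t : ℝ}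
    (ht : t ∈ Ico 0 T) {R : ℝ} (hR : ∀ᵐ x : Space N, R < ‖x‖ → (u t).toL2 x = 0)
    {φ : Space N → ℝ} (hφ : Continuous φ) :
    Integrable fun x => |(u t).toL2 x| ^ p * φ x := by
  obtain ⟨F, hF⟩ := h.exists_L2_rpow ht
  have h1 : ∀ᵐ x : Space N, R < ‖x‖ → F x = 0 := by
    filter_upwards [hR, hF] with x h2 h3 h4
    rw [h3, h2 h4, abs_zero, Real.zero_rpow (by linarith)]
  refine (integrable_mul_of_ae_eq_zero h1 hφ).congr ?_
  filter_upwards [hF] with x hx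
  rw [hx]

/-- The weak form of the equation. -/
theorem integral_second_mul (h : IsStrongSolution a b p f g T u) {t : ℝ} (ht : t ∈ Ico 0 T)
    {ψ : Space N → ℝ} (hψ : ContDiff ℝ ∞ ψ) (hc : HasCompactSupport ψ) :
    inner ℝ (iteratedDerivWithin 2 (fun s => (u s).toL2) (Ico 0 T) t) (testL2 ψ hψ hc)
        + b t * inner ℝ (derivWithin (fun s => (u s).toL2) (Ico 0 T) t) (testL2 ψ hψ hc)
      = a t ^ 2 * (∫ x, (u t).toL2 x * ∑ i : Fin N, partialDeriv i (partialDeriv i ψ) x)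
        + ∫ x, |(u t).toL2 x| ^ p * ψ x := by
  have h1 := h.equation t ht
  have h2 : inner ℝ (iteratedDerivWithin 2 (fun s => (u s).toL2) (Ico 0 T) t
      - (a t) ^ 2 • (u t).laplacian
      + b t • derivWithin (fun s => (u s).toL2) (Ico 0 T) t) (testL2 ψ hψ hc)
      = ∫ x, |(u t).toL2 x| ^ p * ψ x := by
    rw [inner_testL2]
    refine integral_congr_ae ?_
    filter_upwards [h1] with x hx
    rw [hx]
  rw [← h2, ← H2.integral_laplacian_mul _ hψ hc, ← inner_testL2 hψ hc, inner_add_left,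
    inner_sub_left, real_inner_smul_left, real_inner_smul_left]
  ring

/-- The moment of a strong solution against a smooth eigenfunction of the Laplacian (of arbitrary
growth, by finite speed of propagation) solves an ordinary differential equation. -/
theorem exists_moment_deriv (h : IsStrongSolution a b p f g T u)
    (hp : 1 < p) {t₁ : ℝ} (ht₁ : t₁ ∈ Ico 0 T) {R : ℝ}
    (hR : ∀ t ∈ Icc 0 t₁, ∀ᵐ x : Space N, R < ‖x‖ → (u t).toL2 x = 0)
    (hg : ∀ᵐ x : Space N, R < ‖x‖ → g.toL2 x = 0) {φ : Space N → ℝ} (hφ : ContDiff ℝ ∞ φ) {c : ℝ}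
    (hlap : ∀ x, ∑ i : Fin N, partialDeriv i (partialDeriv i φ) x = c * φ x) :
    ∃ H₁ H₂ : ℝ → ℝ, ContinuousOn H₂ (Icc 0 t₁) ∧
      (∀ t ∈ Icc 0 t₁,
        HasDerivWithinAt (fun s => ∫ x, (u s).toL2 x * φ x) (H₁ t) (Icc 0 t₁) t) ∧
      (∀ t ∈ Icc 0 t₁, HasDerivWithinAt H₁ (H₂ t) (Icc 0 t₁) t) ∧
      (∀ t ∈ Icc 0 t₁, H₂ t + b t * H₁ t
        = a t ^ 2 * (c * ∫ x, (u t).toL2 x * φ x) + ∫ x, |(u t).toL2 x| ^ p * φ x) ∧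
      H₁ 0 = ∫ x, g.toL2 x * φ x := by
  have hsub : Icc 0 t₁ ⊆ Ico 0 T := fun x hx => ⟨hx.1, hx.2.trans_lt ht₁.2⟩
  obtain ⟨n, hn⟩ := exists_nat_ge R
  set ψ : Space N → ℝ := fun x => cutoff N n x * φ x with hψd
  have hψ : ContDiff ℝ ∞ ψ := (contDiff_cutoff n).mul hφ
  have hc : HasCompactSupport ψ := (hasCompactSupport_cutoff n).mul_right
  set Ψ := testL2 ψ hψ hc
  have hu : ∀ t ∈ Icc 0 t₁, ∫ x, (u t).toL2 x * φ x = inner ℝ (u t).toL2 Ψ := fun t ht => by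
    rw [inner_testL2]
    exact (integral_congr_ae (mul_cutoff_mul_ae_eq hn (hR t ht) φ)).symm
  have hinner : ∀ (w : ℝ → L2 N) (w' : L2 N) (t : ℝ), t ∈ Icc 0 t₁ →
      HasDerivWithinAt w w' (Ico 0 T) t →
      HasDerivWithinAt (fun s => inner ℝ (w s) Ψ) (inner ℝ w' Ψ) (Icc 0 t₁) t := by
    intro w w' t _ hw
    have := (hw.mono hsub).inner ℝ (hasDerivWithinAt_const t (Icc 0 t₁) Ψ)
    simpa using this
  refine ⟨fun t => inner ℝ (derivWithin (fun s => (u s).toL2) (Ico 0 T) t) Ψ,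
    fun t => inner ℝ (iteratedDerivWithin 2 (fun s => (u s).toL2) (Ico 0 T) t) Ψ,
    (h.continuousOn_second.mono hsub).inner continuousOn_const, fun t ht => ?_, fun t ht => ?_,
    fun t ht => ?_, ?_⟩
  · exact (hinner _ _ t ht (h.hasDerivWithinAt_toL2 (hsub ht))).congr hu (hu t ht)
  · exact hinner _ _ t ht (h.hasDerivWithinAt_deriv (hsub ht))
  · have h1 := h.integral_second_mul (hsub ht) hψ hc
    rw [h1]
    congr 1
    · congr 1
      rw [← integral_const_mul]
      refine integral_congr_ae ?_
      filter_upwards [hR t ht] with x hx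
      rcases lt_or_ge R ‖x‖ with h2 | h2
      · simp [hx h2]
      · rw [hψd, laplacian_cutoff_mul (by linarith), hlap]
        ring
    · refine integral_congr_ae (mul_cutoff_mul_ae_eq hn ?_ φ)
      filter_upwards [hR t ht] with x h2 h4
      rw [h2 h4, abs_zero, Real.zero_rpow (by linarith)]
  · have hT : 0 < T := ht₁.1.trans_lt ht₁.2
    simp only [h.derivWithin_toL2_zero hT]
    rw [inner_testL2]
    exact integral_congr_ae (mul_cutoff_mul_ae_eq hn hg φ)

end IsStrongSolution

/-! ### A radial eigenfunction of the Laplacian -/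

/-- The entire function `∑ zⁿ / (n! Γ(n + s))`; up to elementary factors this is a modified Bessel
function of order `s - 1`. -/
noncomputable def besselSeries (s z : ℝ) : ℝ := ∑' n : ℕ, z ^ n / (n.factorial * Real.Gamma (n + s))

section besselSeries

variable {s : ℝ}

theorem Gamma_mul_pow_le (hs : 0 < s) (n : ℕ) : Real.Gamma s * s ^ n ≤ Real.Gamma (n + s) := by
  induction n with
  | zero => simp
  | succ n ih =>
    have h1 : (0 : ℝ) < n + s := by positivity
    have h2 : ((n + 1 : ℕ) : ℝ) + s = (n + s) + 1 := by push_cast; ring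
    have h3 := Real.Gamma_pos_of_pos hs
    rw [h2, Real.Gamma_add_one h1.ne', pow_succ, ← mul_assoc, mul_comm]
    have h4 : s ≤ n + s := by linarith [n.cast_nonneg (α := ℝ)]
    gcongr

theorem summable_besselSeries (hs : 0 < s) (z : ℝ) :
    Summable fun n : ℕ => z ^ n / (n.factorial * Real.Gamma (n + s)) := by
  have hG := Real.Gamma_pos_of_pos hs
  refine Summable.of_norm_bounded
    ((Real.summable_pow_div_factorial (|z| / s)).mul_left (Real.Gamma s)⁻¹) fun n => ?_
  have h1 := Gamma_mul_pow_le hs n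
  have h2 : 0 < Real.Gamma s * s ^ n := by positivity
  have h3 : (0 : ℝ) < n.factorial := by exact_mod_cast n.factorial_pos
  have h4 : 0 < Real.Gamma (n + s) := h2.trans_le h1
  rw [norm_div, norm_pow, Real.norm_eq_abs, Real.norm_of_nonneg (by positivity)]
  calc |z| ^ n / (n.factorial * Real.Gamma (n + s))
      ≤ |z| ^ n / (n.factorial * (Real.Gamma s * s ^ n)) := by gcongr
    _ = _ := by rw [div_pow]; field_simp

theorem besselSeries_pos (hs : 0 < s) {z : ℝ} (hz : 0 ≤ z) : 0 < besselSeries s z := by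
  have hG : ∀ n : ℕ, 0 < Real.Gamma (n + s) := fun n => Real.Gamma_pos_of_pos (by positivity)
  refine (summable_besselSeries hs z).tsum_pos (fun n => ?_) 0 ?_
  · have := hG n
    positivity
  · have := hG 0
    simp only [pow_zero]
    positivity

theorem deriv_besselSeries_term (s z : ℝ) (n : ℕ) :
    ((n + 1 : ℕ) : ℝ) * z ^ n / ((n + 1).factorial * Real.Gamma ((n + 1 : ℕ) + s))
      = z ^ n / (n.factorial * Real.Gamma (n + (s + 1))) := by
  have h1 : ((n + 1 : ℕ) : ℝ) + s = n + (s + 1) := by push_cast; ring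
  have h3 : (n.factorial : ℝ) ≠ 0 := by exact_mod_cast n.factorial_ne_zero
  rw [h1, Nat.factorial_succ]
  push_cast
  rw [mul_assoc, mul_div_mul_left _ _ (by positivity)]

theorem hasDerivAt_besselSeries (hs : 0 < s) (z : ℝ) :
    HasDerivAt (besselSeries s) (besselSeries (s + 1) z) z := by
  set r := |z| + 1
  have hr : 0 < r := by positivity
  have h0 : (0 : ℝ) ∈ Metric.ball (0 : ℝ) r := Metric.mem_ball_self hr
  have hz : z ∈ Metric.ball (0 : ℝ) r := by simp [r]
  have hsum : ∀ y : ℝ, Summable fun n : ℕ =>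
      (n : ℝ) * y ^ (n - 1) / (n.factorial * Real.Gamma (n + s)) := fun y => by
    rw [← summable_nat_add_iff 1]
    refine (summable_besselSeries (s := s + 1) (by linarith) y).congr fun n => ?_
    exact (deriv_besselSeries_term s y n).symm
  have key := hasDerivAt_tsum_of_isPreconnected (hsum r) Metric.isOpen_ball
    (convex_ball (0 : ℝ) r).isPreconnected
    (g := fun (n : ℕ) (y : ℝ) => y ^ n / (n.factorial * Real.Gamma (n + s)))
    (g' := fun (n : ℕ) (y : ℝ) => (n : ℝ) * y ^ (n - 1) / (n.factorial * Real.Gamma (n + s)))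
    (fun n y _ => (hasDerivAt_pow n y).div_const _) (fun n y hy => ?_) h0
    (summable_besselSeries hs 0) hz
  · refine key.congr_deriv ?_
    rw [(hsum z).tsum_eq_zero_add]
    simp only [CharP.cast_eq_zero, zero_mul, zero_div, zero_add, Nat.add_sub_cancel]
    exact tsum_congr fun n => deriv_besselSeries_term s z n
  · have hG : 0 < Real.Gamma (n + s) := Real.Gamma_pos_of_pos (by positivity)
    rw [mem_ball_zero_iff, Real.norm_eq_abs] at hy
    rw [norm_div, norm_mul, norm_pow, Real.norm_eq_abs y, Real.norm_of_nonneg n.cast_nonneg,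
      Real.norm_of_nonneg (by positivity : (0 : ℝ) ≤ n.factorial * Real.Gamma (n + s))]
    gcongr

theorem contDiff_besselSeries (hs : 0 < s) : ContDiff ℝ ∞ (besselSeries s) := by
  refine contDiff_infty.2 fun n => ?_
  induction n generalizing s with
  | zero => exact contDiff_zero.2 (continuous_iff_continuousAt.2 fun z =>
      (hasDerivAt_besselSeries hs z).continuousAt)
  | succ n ih =>
    push_cast
    rw [contDiff_succ_iff_deriv]
    refine ⟨fun z => (hasDerivAt_besselSeries hs z).differentiableAt, by simp, ?_⟩
    have : deriv (besselSeries s) = besselSeries (s + 1) :=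
      funext fun z => (hasDerivAt_besselSeries hs z).deriv
    rw [this]
    exact ih (by linarith)

/-- The second-order equation `z F'' + s F' = F`. -/
theorem besselSeries_recurrence (hs : 0 < s) (z : ℝ) :
    z * besselSeries (s + 1 + 1) z + s * besselSeries (s + 1) z = besselSeries s z := by
  have hs1 : 0 < s + 1 := by linarith
  have hs2 : 0 < s + 1 + 1 := by linarith
  have h1s : Summable fun n : ℕ => n * z ^ n / (n.factorial * Real.Gamma (n + (s + 1))) := by
    rw [← summable_nat_add_iff 1]
    refine ((summable_besselSeries hs2 z).mul_left z).congr fun n => ?_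
    rw [← deriv_besselSeries_term, pow_succ]
    ring
  have h1 : z * besselSeries (s + 1 + 1) z
      = ∑' n : ℕ, n * z ^ n / (n.factorial * Real.Gamma (n + (s + 1))) := by
    rw [besselSeries, ← tsum_mul_left, h1s.tsum_eq_zero_add]
    simp only [CharP.cast_eq_zero, zero_mul, zero_div, zero_add]
    refine tsum_congr fun n => ?_
    rw [← deriv_besselSeries_term, pow_succ]
    ring
  rw [h1, besselSeries, ← tsum_mul_left,
    ← h1s.tsum_add ((summable_besselSeries hs1 z).mul_left s), besselSeries]
  refine tsum_congr fun n => ?_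
  have h2 : (0 : ℝ) < n + s := by positivity
  have h3 := Real.Gamma_pos_of_pos h2
  have h4 : (n.factorial : ℝ) ≠ 0 := by exact_mod_cast n.factorial_ne_zero
  rw [← add_assoc, Real.Gamma_add_one h2.ne']
  field_simp

end besselSeries

/-- The exponential growth of the radial eigenfunction, with the power gained from the dispersion
of the factor `r ^ ((n - 1) / 2)`. The quantity differentiated in the proof is `z = y + y'` for
`y = r ^ (k / 2) G`, which solves `y'' = (1 + O(r⁻²)) y`. -/
theorem exists_besselSeries_le {k : ℝ} (hk : 0 ≤ k) :
    ∃ C : ℝ, 0 < C ∧ ∀ r : ℝ, 0 ≤ r →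
      besselSeries ((k + 1) / 2) (r ^ 2 / 4) ≤ C * (1 + r) ^ (-(k / 2)) * Real.exp r := by
  set s := (k + 1) / 2 with hsd
  have hs : 0 < s := by positivity
  set G : ℝ → ℝ := fun r => besselSeries s (r ^ 2 / 4) with hG
  set D : ℝ → ℝ := fun r => r / 2 * besselSeries (s + 1) (r ^ 2 / 4) with hD
  have hGpos : ∀ r, 0 < G r := fun r => besselSeries_pos hs (by positivity)
  have hDnn : ∀ r, 0 ≤ r → 0 ≤ D r := fun r hr => by
    have := besselSeries_pos (show 0 < s + 1 by linarith) (show 0 ≤ r ^ 2 / 4 by positivity)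
    positivity
  have hq : ∀ r : ℝ, HasDerivAt (fun r : ℝ => r ^ 2 / 4) (r / 2) r := fun r => by
    have := (hasDerivAt_pow 2 r).div_const 4
    refine this.congr_deriv ?_
    norm_num
    ring
  have hG' : ∀ r, HasDerivAt G (D r) r := fun r => by
    have := (hasDerivAt_besselSeries hs (r ^ 2 / 4)).comp r (hq r)
    refine this.congr_deriv ?_
    simp only [hD]
    ring
  have hD' : ∀ r, 0 < r → HasDerivAt D (G r - k / r * D r) r := fun r hr => by
    have h1 := (hasDerivAt_besselSeries (show 0 < s + 1 by linarith) (r ^ 2 / 4)).comp r (hq r)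
    have h2 := ((hasDerivAt_id r).div_const 2).mul h1
    refine h2.congr_deriv ?_
    have h3 := besselSeries_recurrence hs (r ^ 2 / 4)
    simp only [hD, hG, ← h3, Function.comp_apply, id]
    have : s = (k + 1) / 2 := rfl
    field_simp
    rw [this]
    ring
  set Z : ℝ → ℝ := fun r =>
    r ^ (k / 2) * ((1 + k / 2 * r⁻¹) * G r + D r) * Real.exp (-r + k ^ 2 / 4 * r⁻¹) with hZ
  have hZ' : ∀ r, 0 < r → HasDerivAt Z (-(r ^ (k / 2) * (k / 2 / r ^ 2 * G r + k ^ 2 / 4 / r ^ 2 *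
      (k / 2 * r⁻¹ * G r + D r)) * Real.exp (-r + k ^ 2 / 4 * r⁻¹))) r := fun r hr => by
    have e1 : HasDerivAt (fun r : ℝ => r ^ (k / 2)) (k / 2 * r⁻¹ * r ^ (k / 2)) r := by
      refine (Real.hasDerivAt_rpow_const (p := k / 2) (Or.inl hr.ne')).congr_deriv ?_
      rw [Real.rpow_sub_one hr.ne']
      ring
    have e2 := hasDerivAt_inv hr.ne'
    have e3 := (((e2.const_mul (k / 2)).const_add 1).mul (hG' r)).add (hD' r hr)
    have e4 := ((hasDerivAt_id r).neg.add (e2.const_mul (k ^ 2 / 4))).exp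
    refine ((e1.mul e3).mul e4).congr_deriv ?_
    simp only [Pi.add_apply, Pi.mul_apply, Pi.neg_apply, id]
    field_simp
    ring
  have hanti : AntitoneOn Z (Ici 1) := by
    refine antitoneOn_of_hasDerivWithinAt_nonpos (convex_Ici 1) (fun r hr =>
      (hZ' r (by linarith [mem_Ici.1 hr])).continuousAt.continuousWithinAt)
      (fun r hr => (hZ' r ?_).hasDerivWithinAt) fun r hr => ?_
    · rw [interior_Ici] at hr
      linarith [mem_Ioi.1 hr]
    · rw [interior_Ici] at hr
      have hr0 : 0 < r := by linarith [mem_Ioi.1 hr]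
      have := hGpos r
      have := hDnn r hr0.le
      rw [neg_nonpos]
      positivity
  obtain ⟨B, hB⟩ := (isCompact_Icc (a := (0 : ℝ)) (b := 1)).exists_bound_of_continuousOn
    (f := fun r => G r) fun r _ => (hG' r).continuousAt.continuousWithinAt
  have hZ1 : 0 < Z 1 := by
    have := hGpos 1
    have := hDnn 1 zero_le_one
    simp only [hZ]
    positivity
  have hB0 : 0 < B := (norm_pos_iff.2 (hGpos 0).ne').trans_le (hB 0 ⟨le_rfl, zero_le_one⟩)
  have h2k : ∀ r : ℝ, 0 ≤ r → r ≤ 1 → 1 ≤ 2 ^ (k / 2) * (1 + r) ^ (-(k / 2)) := by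
    intro r h0 h1
    rw [Real.rpow_neg (by positivity), ← div_eq_mul_inv, one_le_div (by positivity)]
    exact Real.rpow_le_rpow (by positivity) (by linarith) (by positivity)
  refine ⟨2 ^ (k / 2) * (B + Z 1), by positivity, fun r hr => ?_⟩
  rcases le_or_gt r 1 with h1 | h1
  · calc G r ≤ B := (le_abs_self _).trans (hB r ⟨hr, h1⟩)
      _ ≤ (B + Z 1) * 1 * 1 := by linarith
      _ ≤ (B + Z 1) * (2 ^ (k / 2) * (1 + r) ^ (-(k / 2))) * Real.exp r := by
        gcongr
        · exact h2k r hr h1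
        · exact Real.one_le_exp hr
      _ = _ := by ring
  · have h2 := hanti (mem_Ici.2 le_rfl) (mem_Ici.2 h1.le) h1.le
    have hr0 : 0 < r := by linarith
    have h3 : r ^ (k / 2) * G r * Real.exp (-r) ≤ Z r := by
      simp only [hZ]
      have := hGpos r
      have := hDnn r hr
      have h4 : G r ≤ (1 + k / 2 * r⁻¹) * G r + D r := by
        have : 0 ≤ k / 2 * r⁻¹ * G r := by positivity
        linarith
      gcongr
      have : 0 ≤ k ^ 2 / 4 * r⁻¹ := by positivity
      linarith
    have h4 : G r = r ^ (-(k / 2)) * Real.exp r * (r ^ (k / 2) * G r * Real.exp (-r)) := by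
      rw [Real.rpow_neg hr, Real.exp_neg]
      have : r ^ (k / 2) ≠ 0 := by positivity
      field_simp
    have h5 : r ^ (-(k / 2)) ≤ 2 ^ (k / 2) * (1 + r) ^ (-(k / 2)) := by
      rw [Real.rpow_neg hr, Real.rpow_neg (by linarith), ← div_eq_mul_inv,
        le_div_iff₀ (by positivity), inv_mul_le_iff₀ (by positivity),
        ← Real.mul_rpow hr (by norm_num)]
      exact Real.rpow_le_rpow (by linarith) (by linarith) (by positivity)
    calc G r = r ^ (-(k / 2)) * Real.exp r * (r ^ (k / 2) * G r * Real.exp (-r)) := h4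
      _ ≤ (2 ^ (k / 2) * (1 + r) ^ (-(k / 2))) * Real.exp r * (B + Z 1) := by
        gcongr
        · have := hGpos r
          positivity
        · linarith
      _ = _ := by ring

/-- A positive radial solution of `Δ φ = λ² φ`. -/
noncomputable def eigenfunction (N : ℕ) (lam : ℝ) (x : Space N) : ℝ :=
  besselSeries (N / 2) (lam ^ 2 / 4 * ‖x‖ ^ 2)

section eigenfunction

variable {lam : ℝ}

theorem eigenfunction_pos (hN : 1 ≤ N) (x : Space N) : 0 < eigenfunction N lam x := by
  have : (0 : ℝ) < N := by exact_mod_cast hN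
  exact besselSeries_pos (by positivity) (by positivity)

theorem contDiff_eigenfunction (hN : 1 ≤ N) : ContDiff ℝ ∞ (eigenfunction N lam) := by
  have : (0 : ℝ) < N := by exact_mod_cast hN
  exact (contDiff_besselSeries (by positivity)).comp (contDiff_const.mul (contDiff_norm_sq ℝ))

theorem partialDeriv_besselSeries_norm_sq {s c : ℝ} (hs : 0 < s) (i : Fin N) (x : Space N) :
    partialDeriv i (fun x : Space N => besselSeries s (c * ‖x‖ ^ 2)) x
      = 2 * c * x i * besselSeries (s + 1) (c * ‖x‖ ^ 2) := by
  have h1 : HasFDerivAt (fun y : Space N => c * ‖y‖ ^ 2)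
      (c • (2 • (innerSL ℝ x).comp (ContinuousLinearMap.id ℝ (Space N)))) x :=
    ((hasFDerivAt_id x).norm_sq).const_mul c
  have h2 := (hasDerivAt_besselSeries hs (c * ‖x‖ ^ 2)).comp_hasFDerivAt x h1
  unfold partialDeriv
  have h3 := h2.fderiv
  simp only [Function.comp_def] at h3
  rw [h3]
  have h4 : inner ℝ x (EuclideanSpace.single i (1 : ℝ)) = x i := by
    rw [EuclideanSpace.inner_single_right]; simp
  simp only [smul_apply, ContinuousLinearMap.comp_id, innerSL_apply_apply,
    smul_eq_mul, h4, nsmul_eq_mul]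
  push_cast
  ring

theorem partialDeriv_coord (i : Fin N) (x : Space N) :
    partialDeriv i (fun y : Space N => y i) x = 1 := by
  unfold partialDeriv
  have : (fun y : Space N => y i) = (EuclideanSpace.proj i : Space N →L[ℝ] ℝ) := rfl
  rw [this, ContinuousLinearMap.fderiv]
  simp

theorem laplacian_eigenfunction (hN : 1 ≤ N) (x : Space N) :
    ∑ i : Fin N, partialDeriv i (partialDeriv i (eigenfunction N lam)) x
      = lam ^ 2 * eigenfunction N lam x := by
  have hN' : (0 : ℝ) < N := by exact_mod_cast hN
  set s : ℝ := N / 2 with hsd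
  set c := lam ^ 2 / 4
  have hs : 0 < s := by positivity
  have h1 : ∀ i : Fin N, partialDeriv i (eigenfunction N lam)
      = fun x => (2 * c * besselSeries (s + 1) (c * ‖x‖ ^ 2)) * x i := fun i => by
    ext x
    exact (partialDeriv_besselSeries_norm_sq hs i x).trans (by ring)
  have hd : Differentiable ℝ fun x : Space N => besselSeries (s + 1) (c * ‖x‖ ^ 2) :=
    ((contDiff_besselSeries (show 0 < s + 1 by linarith)).comp
      (contDiff_const.mul (contDiff_norm_sq ℝ))).differentiable (by simp)
  have h2 : ∀ i : Fin N, partialDeriv i (partialDeriv i (eigenfunction N lam)) x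
      = 4 * c ^ 2 * besselSeries (s + 1 + 1) (c * ‖x‖ ^ 2) * x i ^ 2
        + 2 * c * besselSeries (s + 1) (c * ‖x‖ ^ 2) := fun i => by
    have hx : DifferentiableAt ℝ (fun y : Space N => y i) x :=
      (EuclideanSpace.proj (𝕜 := ℝ) i : Space N →L[ℝ] ℝ).differentiableAt
    rw [h1, partialDeriv_mul ((hd x).const_mul _) hx, partialDeriv_coord]
    have : partialDeriv i (fun x : Space N => 2 * c * besselSeries (s + 1) (c * ‖x‖ ^ 2)) x
        = 2 * c * partialDeriv i (fun x : Space N => besselSeries (s + 1) (c * ‖x‖ ^ 2)) x := by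
      unfold partialDeriv
      rw [fderiv_const_mul (hd x)]
      simp
    rw [this, partialDeriv_besselSeries_norm_sq (by linarith)]
    ring
  simp_rw [h2]
  rw [Finset.sum_add_distrib, ← Finset.mul_sum, ← EuclideanSpace.real_norm_sq_eq,
    Finset.sum_const, Finset.card_univ, Fintype.card_fin, nsmul_eq_mul]
  have h3 := besselSeries_recurrence hs (c * ‖x‖ ^ 2)
  have h4 : (N : ℝ) = 2 * s := by rw [hsd]; ring
  have h5 : eigenfunction N lam x = besselSeries s (c * ‖x‖ ^ 2) := rfl
  have h6 : lam ^ 2 = 4 * c := by simp only [c]; ring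
  rw [h5, ← h3, h4, h6]
  ring

/-- Growth of the eigenfunction in `L^q` of balls. -/
theorem exists_setIntegral_eigenfunction_le (hN : 1 ≤ N) {q : ℝ} (hq : 1 < q) (hlam : 1 ≤ lam)
    (hlq : (N - 1 : ℝ) * |1 - q / 2| ≤ lam / 2) :
    ∃ C : ℝ, 0 < C ∧ ∀ R : ℝ, 0 ≤ R →
      ∫ x in Metric.closedBall (0 : Space N) R, eigenfunction N lam x ^ q
        ≤ C * (1 + R) ^ ((N - 1 : ℝ) * (1 - q / 2)) * Real.exp (q * lam * R) := by
  have hN' : (1 : ℝ) ≤ N := by exact_mod_cast hN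
  set k : ℝ := N - 1 with hk
  have hk0 : 0 ≤ k := by simp only [hk]; linarith
  obtain ⟨C, hC, hle⟩ := exists_besselSeries_le hk0
  have hl0 : 0 < lam := by linarith
  have hq0 : 0 < q := by linarith
  set e := k * (1 - q / 2) with he
  have hpt : ∀ x : Space N, eigenfunction N lam x ^ q
      ≤ C ^ q * ((1 + ‖x‖) ^ (-(k / 2) * q) * Real.exp (q * lam * ‖x‖)) := fun x => by
    have h1 : eigenfunction N lam x ≤ C * (1 + ‖x‖) ^ (-(k / 2)) * Real.exp (lam * ‖x‖) := by
      have h2 := hle (lam * ‖x‖) (by positivity)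
      have h3 : eigenfunction N lam x = besselSeries ((k + 1) / 2) ((lam * ‖x‖) ^ 2 / 4) := by
        rw [eigenfunction, hk]
        congr 1 <;> ring
      rw [h3]
      refine h2.trans ?_
      gcongr ?_ * _
      refine mul_le_mul_of_nonneg_left (Real.rpow_le_rpow_of_nonpos (by positivity) ?_ ?_) hC.le
      · exact add_le_add_right (le_mul_of_one_le_left (norm_nonneg _) hlam) 1
      · linarith
    calc eigenfunction N lam x ^ q ≤ (C * (1 + ‖x‖) ^ (-(k / 2)) * Real.exp (lam * ‖x‖)) ^ q :=
          Real.rpow_le_rpow (eigenfunction_pos hN x).le h1 hq0.le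
      _ = _ := by
        rw [Real.mul_rpow (by positivity) (by positivity), Real.mul_rpow hC.le (by positivity),
          ← Real.rpow_mul (by positivity), ← Real.exp_mul, mul_assoc]
        congr 3
        ring
  have : Nontrivial (Space N) := by
    have : Nonempty (Fin N) := ⟨⟨0, hN⟩⟩
    infer_instance
  set w : ℝ := volume.real (Metric.ball (0 : Space N) 1)
  have hw : 0 ≤ w := measureReal_nonneg
  set B : ℝ → ℝ := fun r => (1 + r) ^ (-(k / 2) * q) * Real.exp (q * lam * r) with hB
  have hBc : ContinuousOn B (Ici 0) := fun r hr => by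
    have : (1 : ℝ) + r ≠ 0 := by linarith [mem_Ici.1 hr]
    refine ContinuousAt.continuousWithinAt ?_
    exact ((continuousAt_const.add continuousAt_id).rpow_const (Or.inl this)).mul
      (Real.continuous_exp.continuousAt.comp (continuousAt_const.mul continuousAt_id))
  refine ⟨C ^ q * (N * w * (2 / (q * lam))) + 1, by positivity, fun R hR => ?_⟩
  -- the one-dimensional integral, by comparison with the derivative of `(1 + r) ^ e * exp (q λ r)`
  have hone : ∫ r in (0 : ℝ)..R, (1 + r) ^ e * Real.exp (q * lam * r)
      ≤ 2 / (q * lam) * ((1 + R) ^ e * Real.exp (q * lam * R)) := by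
    have hd : ∀ r, 0 ≤ r → HasDerivAt (fun r => 2 / (q * lam) * ((1 + r) ^ e
        * Real.exp (q * lam * r))) ((2 / (q * lam) * (e / (1 + r) + q * lam))
        * ((1 + r) ^ e * Real.exp (q * lam * r))) r := fun r hr => by
      have h1r : (1 : ℝ) + r ≠ 0 := by positivity
      have e1 := ((hasDerivAt_id r).const_add 1).rpow_const (p := e) (Or.inl h1r)
      have e2 := ((hasDerivAt_id r).const_mul (q * lam)).exp
      refine ((e1.mul e2).const_mul (2 / (q * lam))).congr_deriv ?_
      simp only [id]
      rw [Real.rpow_sub_one h1r]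
      field_simp
    have hcont : ∀ d : ℝ → ℝ, ContinuousOn d (Icc 0 R) → ContinuousOn (fun r => d r *
        ((1 + r) ^ e * Real.exp (q * lam * r))) (Icc 0 R) := fun d hdc r hr => by
      have h1r : (1 : ℝ) + r ≠ 0 := by linarith [hr.1]
      exact (hdc r hr).mul (ContinuousAt.continuousWithinAt
        (((continuousAt_const.add continuousAt_id).rpow_const (Or.inl h1r)).mul
        (Real.continuous_exp.continuousAt.comp (continuousAt_const.mul continuousAt_id))))
    have hc1 : ContinuousOn (fun r : ℝ => 2 / (q * lam) * (e / (1 + r) + q * lam)) (Icc 0 R) :=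
      continuousOn_const.mul ((continuousOn_const.div (continuousOn_const.add continuousOn_id)
        fun r hr => by
          have : (0 : ℝ) < 1 + r := by linarith [hr.1]
          exact this.ne').add continuousOn_const)
    have hI2 := (hcont _ hc1).intervalIntegrable_of_Icc (μ := volume) hR
    have hI1 := (hcont _ (continuousOn_const (c := (1 : ℝ)))).intervalIntegrable_of_Icc
      (μ := volume) hR
    simp only [one_mul] at hI1
    have hFTC := intervalIntegral.integral_eq_sub_of_hasDerivAt (a := 0) (b := R)
      (fun r hr => hd r (by rw [uIcc_of_le hR] at hr; exact hr.1)) hI2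
    have hmono := intervalIntegral.integral_mono_on hR hI1 hI2 (fun r hr => ?_)
    · refine hmono.trans (hFTC.le.trans ?_)
      have : 0 ≤ 2 / (q * lam) * ((1 + (0 : ℝ)) ^ e * Real.exp (q * lam * 0)) := by positivity
      linarith
    · refine le_mul_of_one_le_left (by have := hr.1; positivity) ?_
      have h1r : 1 ≤ 1 + r := by linarith [hr.1]
      have h1 : -(lam / 2) ≤ e / (1 + r) := by
        have h2 : |e / (1 + r)| ≤ |e| := by
          rw [abs_div, abs_of_pos (by linarith : 0 < 1 + r)]
          exact div_le_self (abs_nonneg _) h1r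
        have h3 : |e| ≤ lam / 2 := by rwa [he, abs_mul, abs_of_nonneg hk0]
        linarith [neg_abs_le (e / (1 + r))]
      rw [div_mul_eq_mul_div, one_le_div (by positivity)]
      nlinarith
  have hpolar : ∫ x in Metric.closedBall (0 : Space N) R, B ‖x‖
      ≤ N * w * ∫ r in (0 : ℝ)..R, (1 + r) ^ e * Real.exp (q * lam * r) := by
    have h1 : ∫ x in Metric.closedBall (0 : Space N) R, B ‖x‖
        = ∫ x : Space N, (Iic R).indicator B ‖x‖ := by
      rw [← integral_indicator measurableSet_closedBall]
      congr 1
      ext x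
      simp only [indicator, mem_closedBall_zero_iff, mem_Iic]
    have h2 : (fun y : ℝ => y ^ (N - 1) • (Iic R).indicator B y)
        = (Iic R).indicator fun y => y ^ (N - 1) * B y := by
      ext y
      by_cases hy : y ∈ Iic R <;> simp [hy]
    rw [h1, integral_fun_norm_addHaar volume ((Iic R).indicator B), finrank_euclideanSpace,
      Fintype.card_fin, nsmul_eq_mul, smul_eq_mul, ← mul_assoc, h2,
      setIntegral_indicator measurableSet_Iic, Ioi_inter_Iic, intervalIntegral.integral_of_le hR]
    refine mul_le_mul_of_nonneg_left ?_ (by positivity)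
    have hIcc : ∀ d : ℝ → ℝ, ContinuousOn d (Ici 0) → IntegrableOn d (Ioc 0 R) := fun d hd =>
      ((hd.mono Icc_subset_Ici_self).integrableOn_compact isCompact_Icc).mono_set
        Ioc_subset_Icc_self
    refine setIntegral_mono_on (hIcc _ ((continuous_id.pow (N - 1)).continuousOn.mul hBc))
      (hIcc _ fun r hr => ?_) measurableSet_Ioc fun r hr => ?_
    · have : (1 : ℝ) + r ≠ 0 := by linarith [mem_Ici.1 hr]
      refine ContinuousAt.continuousWithinAt ?_
      exact ((continuousAt_const.add continuousAt_id).rpow_const (Or.inl this)).mul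
        (Real.continuous_exp.continuousAt.comp (continuousAt_const.mul continuousAt_id))
    · have h1r : 0 < 1 + r := by linarith [hr.1]
      have h3 : r ^ (N - 1) ≤ (1 + r) ^ k := by
        have h4 : k = ((N - 1 : ℕ) : ℝ) := by rw [Nat.cast_sub hN]; simp [hk]
        rw [h4, Real.rpow_natCast]
        exact pow_le_pow_left₀ hr.1.le (by linarith) _
      calc r ^ (N - 1) * B r ≤ (1 + r) ^ k * B r := by gcongr
        _ = _ := by
          rw [hB, ← mul_assoc, ← Real.rpow_add h1r]
          congr 2
          rw [he]
          ring
  have hint1 : IntegrableOn (fun x : Space N => eigenfunction N lam x ^ q)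
      (Metric.closedBall 0 R) :=
    ((contDiff_eigenfunction hN).continuous.rpow_const fun x =>
      Or.inl (eigenfunction_pos hN x).ne').continuousOn.integrableOn_compact
      (isCompact_closedBall 0 R)
  have hint2 : IntegrableOn (fun x : Space N => C ^ q * B ‖x‖) (Metric.closedBall 0 R) :=
    (continuousOn_const.mul (hBc.comp continuous_norm.continuousOn
      fun x _ => norm_nonneg x)).integrableOn_compact (isCompact_closedBall 0 R)
  calc ∫ x in Metric.closedBall (0 : Space N) R, eigenfunction N lam x ^ q
      ≤ ∫ x in Metric.closedBall (0 : Space N) R, C ^ q * B ‖x‖ :=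
        setIntegral_mono hint1 hint2 hpt
    _ = C ^ q * ∫ x in Metric.closedBall (0 : Space N) R, B ‖x‖ := integral_const_mul _ _
    _ ≤ C ^ q * (N * w * (2 / (q * lam) * ((1 + R) ^ e * Real.exp (q * lam * R)))) := by
        gcongr
        exact hpolar.trans (by gcongr)
    _ = C ^ q * (N * w * (2 / (q * lam))) * ((1 + R) ^ e * Real.exp (q * lam * R)) := by ring
    _ ≤ (C ^ q * (N * w * (2 / (q * lam))) + 1) * ((1 + R) ^ e * Real.exp (q * lam * R)) := by
        gcongr
        linarith
    _ = _ := by ring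

end eigenfunction

/-! ### Growth of supersolutions of the reduced wave equation -/

/-- Two-sided power bounds for the propagation speed and its derivatives. -/
structure SpeedBounds (a : ℝ → ℝ) (α K : ℝ) : Prop where
  lower : ∀ t, 0 ≤ t → K⁻¹ * (1 + t) ^ α ≤ a t
  upper : ∀ t, 0 ≤ t → a t ≤ K * (1 + t) ^ α
  deriv : ∀ t, 0 ≤ t → |derivWithin a (Ici 0) t| ≤ K * (1 + t) ^ (α - 1)
  deriv_two : ∀ t, 0 ≤ t → |iteratedDerivWithin 2 a (Ici 0) t| ≤ K * (1 + t) ^ (α - 2)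

theorem monotoneOn_of_hasDerivWithinAt_Icc {f f' : ℝ → ℝ} {s t : ℝ}
    (hf : ∀ x ∈ Icc s t, HasDerivWithinAt f (f' x) (Icc s t) x)
    (hf' : ∀ x ∈ Ioo s t, 0 ≤ f' x) : MonotoneOn f (Icc s t) := by
  refine monotoneOn_of_hasDerivWithinAt_nonneg (convex_Icc s t) (f' := f')
    (fun x hx => (hf x hx).continuousWithinAt) (fun x hx => ?_) fun x hx => ?_
  · exact (hf x (interior_subset hx)).mono interior_subset
  · rw [interior_Icc] at hx
    exact hf' x hx

theorem hasDerivWithinAt_primitive {c : ℝ → ℝ} (hc : ContinuousOn c (Ici 0)) {t : ℝ}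
    (ht : 0 ≤ t) : HasDerivWithinAt (fun s => ∫ r in (0 : ℝ)..s, c r) (c t) (Ici 0) t := by
  rcases ht.eq_or_lt with rfl | ht
  · refine intervalIntegral.integral_hasDerivWithinAt_right (t := Ioi 0) (by simp) ?_ ?_
    · exact ⟨Ioi 0, self_mem_nhdsWithin,
        (hc.mono Ioi_subset_Ici_self).aestronglyMeasurable measurableSet_Ioi⟩
    · exact (hc 0 self_mem_Ici).mono Ioi_subset_Ici_self
  · exact (hasDerivAt_primitive hc ht).hasDerivWithinAt

/-- A solution of `H'' + b H' ≥ c H` with nonnegative data stays nonnegative and nondecreasing. -/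
theorem nonneg_of_supersolution {H H₁ H₂ b c : ℝ → ℝ} {t₁ : ℝ}
    (hH : ∀ t ∈ Icc 0 t₁, HasDerivWithinAt H (H₁ t) (Icc 0 t₁) t)
    (hH₁ : ∀ t ∈ Icc 0 t₁, HasDerivWithinAt H₁ (H₂ t) (Icc 0 t₁) t)
    (hb : ContinuousOn b (Ici 0)) (hb0 : ∀ t, 0 ≤ t → 0 ≤ b t)
    (hc : ContinuousOn c (Icc 0 t₁)) (hc0 : ∀ t ∈ Icc 0 t₁, 0 ≤ c t)
    (hle : ∀ t ∈ Icc 0 t₁, c t * H t ≤ H₂ t + b t * H₁ t) (h0 : 0 ≤ H 0) (h1 : 0 ≤ H₁ 0)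
    {t : ℝ} (ht : t ∈ Icc 0 t₁) : 0 ≤ H t ∧ 0 ≤ H₁ t := by
  obtain ⟨C, hC⟩ := isCompact_Icc.exists_bound_of_continuousOn hc
  have hC0 : 0 ≤ C := (norm_nonneg _).trans (hC t ht)
  set L := 1 + C
  have hL : 0 < L := by positivity
  set m : ℝ → ℝ := fun s => Real.exp (∫ r in (0 : ℝ)..s, b r) with hm
  have hm0 : ∀ s, 0 < m s := fun s => Real.exp_pos _
  have hm' : ∀ s ∈ Icc 0 t₁, HasDerivWithinAt m (m s * b s) (Icc 0 t₁) s := fun s hs =>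
    ((hasDerivWithinAt_primitive hb hs.1).mono Icc_subset_Ici_self).exp
  have he' : ∀ s, HasDerivAt (fun s => Real.exp (L * s)) (Real.exp (L * s) * L) s := fun s => by
    simpa using ((hasDerivAt_id s).const_mul L).exp
  -- a small multiple of `exp (L t)` makes all the inequalities strict
  have key : ∀ δ : ℝ, 0 < δ → ∀ s ∈ Icc 0 t₁, 0 < H s + δ * Real.exp (L * s) ∧
      0 < H₁ s + δ * (Real.exp (L * s) * L) := by
    intro δ hδ
    set Hδ : ℝ → ℝ := fun s => H s + δ * Real.exp (L * s) with hHδ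
    set G : ℝ → ℝ := fun s => m s * (H₁ s + δ * (Real.exp (L * s) * L)) with hG
    have hHδ' : ∀ s ∈ Icc 0 t₁,
        HasDerivWithinAt Hδ (H₁ s + δ * (Real.exp (L * s) * L)) (Icc 0 t₁) s := fun s hs =>
      (hH s hs).add ((he' s).const_mul δ).hasDerivWithinAt
    have hG' : ∀ s ∈ Icc 0 t₁, HasDerivWithinAt G (m s * b s * (H₁ s + δ * (Real.exp (L * s) * L))
        + m s * (H₂ s + δ * (Real.exp (L * s) * L * L))) (Icc 0 t₁) s := fun s hs =>
      (hm' s hs).mul ((hH₁ s hs).add (((he' s).mul_const L).const_mul δ).hasDerivWithinAt)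
    have hmono : ∀ s ∈ Icc 0 t₁, (∀ r ∈ Ioo 0 s, 0 < G r) → ∀ r ∈ Icc 0 s, 0 < Hδ r := by
      intro s hs hpos r hr
      have hss : Icc 0 s ⊆ Icc 0 t₁ := Icc_subset_Icc_right hs.2
      have := monotoneOn_of_hasDerivWithinAt_Icc (s := 0) (t := s)
        (fun x hx => (hHδ' x (hss hx)).mono hss)
        (fun x hx => (pos_of_mul_pos_right (hpos x hx) (hm0 x).le).le)
        ⟨le_rfl, hs.1⟩ hr hr.1
      have h00 : 0 < Hδ 0 := by
        simp only [hHδ, mul_zero, Real.exp_zero, mul_one]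
        linarith
      linarith
    have hGpos : ∀ s ∈ Icc 0 t₁, 0 < G s := by
      by_contra! hcon
      have hcl : IsCompact {s ∈ Icc 0 t₁ | G s ≤ 0} := by
        have hGc : ContinuousOn G (Icc 0 t₁) := fun s hs => (hG' s hs).continuousWithinAt
        exact isCompact_Icc.of_isClosed_subset
          (hGc.preimage_isClosed_of_isClosed isClosed_Icc isClosed_Iic) (sep_subset _ _)
      obtain ⟨s, ⟨hs, hGs⟩, hmin⟩ := hcl.exists_isLeast (by
        obtain ⟨s, hs, h⟩ := hcon
        exact ⟨s, hs, h⟩)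
      have hbelow : ∀ r ∈ Ioo 0 s, 0 < G r := fun r hr => by
        by_contra! hr'
        exact absurd (hmin ⟨⟨hr.1.le, hr.2.le.trans hs.2⟩, hr'⟩) (not_le.2 hr.2)
      have hss : Icc 0 s ⊆ Icc 0 t₁ := Icc_subset_Icc_right hs.2
      have hG0 : 0 < G 0 := by
        simp only [hG, mul_zero, Real.exp_zero, one_mul]
        have := hm0 0
        positivity
      have := monotoneOn_of_hasDerivWithinAt_Icc (s := 0) (t := s)
        (fun x hx => (hG' x (hss hx)).mono hss) (fun x hx => ?_)
        ⟨le_rfl, hs.1⟩ ⟨hs.1, le_rfl⟩ hs.1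
      · linarith
      · have hx' : x ∈ Icc 0 t₁ := hss ⟨hx.1.le, hx.2.le⟩
        have h2 := hmono s hs hbelow x ⟨hx.1.le, hx.2.le⟩
        have h3 := hle x hx'
        have h4 : c x ≤ L ^ 2 := by
          have := (le_abs_self _).trans (hC x hx')
          nlinarith
        have h5 : 0 ≤ c x * Hδ x := mul_nonneg (hc0 x hx') h2.le
        have hE := Real.exp_pos (L * x)
        have hbx := hb0 x hx.1.le
        have h6 : c x * (δ * Real.exp (L * x)) ≤ L ^ 2 * (δ * Real.exp (L * x)) := by gcongr
        have h7 : 0 ≤ b x * (δ * (Real.exp (L * x) * L)) := by positivity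
        have h8 : m x * b x * (H₁ x + δ * (Real.exp (L * x) * L))
            + m x * (H₂ x + δ * (Real.exp (L * x) * L * L))
            = m x * ((H₂ x + b x * H₁ x) + b x * (δ * (Real.exp (L * x) * L))
              + L ^ 2 * (δ * Real.exp (L * x))) := by ring
        rw [h8]
        refine mul_nonneg (hm0 x).le ?_
        have h9 : c x * Hδ x = c x * H x + c x * (δ * Real.exp (L * x)) := by
          simp only [hHδ]; ring
        linarith
    intro s hs
    exact ⟨hmono s hs (fun r hr => hGpos r ⟨hr.1.le, hr.2.le.trans hs.2⟩) s ⟨hs.1, le_rfl⟩,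
      pos_of_mul_pos_right (hGpos s hs) (hm0 s).le⟩
  have hE := Real.exp_pos (L * t)
  constructor
  · refine le_of_forall_pos_le_add fun ε hε => ?_
    have := (key (ε / Real.exp (L * t)) (by positivity) t ht).1
    rw [div_mul_cancel₀ _ hE.ne'] at this
    exact this.le
  · refine le_of_forall_pos_le_add fun ε hε => ?_
    have := (key (ε / (Real.exp (L * t) * L)) (by positivity) t ht).2
    rw [div_mul_cancel₀ _ (by positivity)] at this
    exact this.le

/-- The pointwise bounds behind the choice `w = λ a + a' / (2 a) - ρ` of an approximate solution of
the Riccati equation `w' - w² + b w + λ² a² = 0`. Here `e` and `q` stand for the powers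
`(1 + t) ^ α` and `(1 + t)⁻¹`, and the correction is `ρ = q² / e`. -/
theorem riccati_le {e q c c₁ c₂ lam K α b : ℝ} (he : 0 < e) (hq : 0 < q) (hqe : q ≤ e)
    (hK : 1 ≤ K) (hα : -1 < α) (hc : K⁻¹ * e ≤ c) (hc₁ : |c₁| ≤ K * (e * q))
    (hc₂ : |c₂| ≤ K * (e * q ^ 2)) (hb : 0 ≤ b) (hl₁ : K * (K ^ 2 / 2 + 2) ≤ lam)
    (hl₂ : K * (K ^ 2 / 2 + K ^ 4 / 2 + (2 + α) + (K ^ 2 / 2 + 1) ^ 2) ≤ lam) :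
    q ≤ lam * c + c₁ / (2 * c) - q ^ 2 / e ∧
    0 ≤ (lam * c₁ + (c₂ / (2 * c) - c₁ ^ 2 / (2 * c ^ 2)) + (2 + α) * (q ^ 3 / e))
      - (lam * c + c₁ / (2 * c) - q ^ 2 / e) ^ 2 + b * (lam * c + c₁ / (2 * c) - q ^ 2 / e)
      + lam ^ 2 * c ^ 2 := by
  have hK0 : 0 < K := by linarith
  have hc0 : 0 < c := lt_of_lt_of_le (by positivity) hc
  have hec : e ≤ K * c := by rwa [inv_mul_le_iff₀ hK0] at hc
  have hlam : 0 < lam := lt_of_lt_of_le (by positivity) hl₁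
  set d := c₁ / (2 * c) with hd
  set ρ := q ^ 2 / e with hρ
  have hρ0 : 0 ≤ ρ := by positivity
  have hρq : ρ ≤ q := by
    rw [hρ, div_le_iff₀ he]
    nlinarith
  have hdq : |d| ≤ K ^ 2 / 2 * q := by
    rw [hd, abs_div, abs_of_pos (by positivity : 0 < 2 * c), div_le_iff₀ (by positivity)]
    calc |c₁| ≤ K * (e * q) := hc₁
      _ ≤ K * (K * c * q) := by gcongr
      _ = _ := by ring
  have hc₂q : |c₂ / (2 * c)| ≤ K ^ 2 / 2 * q ^ 2 := by
    rw [abs_div, abs_of_pos (by positivity : 0 < 2 * c), div_le_iff₀ (by positivity)]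
    calc |c₂| ≤ K * (e * q ^ 2) := hc₂
      _ ≤ K * (K * c * q ^ 2) := by gcongr
      _ = _ := by ring
  have hlc : ∀ B, K * B ≤ lam → 0 ≤ B → B * e ≤ lam * c := fun B hB hB0 => by
    calc B * e ≤ B * (K * c) := by gcongr
      _ = K * B * c := by ring
      _ ≤ lam * c := by gcongr
  have hw : q ≤ lam * c + d - ρ := by
    have h1 := hlc _ hl₁ (by positivity)
    have h2 := neg_abs_le d
    have h3 : (K ^ 2 / 2 + 2) * q ≤ (K ^ 2 / 2 + 2) * e := by gcongr
    linarith
  refine ⟨hw, ?_⟩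
  set B := K ^ 2 / 2 + K ^ 4 / 2 + (2 + α) + (K ^ 2 / 2 + 1) ^ 2 with hB
  have h2α : 0 < 2 + α := by linarith
  have h1 : B * q ^ 2 ≤ lam * c * ρ := by
    calc B * q ^ 2 = B * e * ρ := by rw [hρ]; field_simp
      _ ≤ lam * c * ρ := mul_le_mul_of_nonneg_right (hlc _ hl₂ (by positivity)) hρ0
  have h2 : d ^ 2 ≤ (K ^ 2 / 2 * q) ^ 2 := by
    rw [← sq_abs]
    exact pow_le_pow_left₀ (abs_nonneg _) hdq 2
  have h3 : (d - ρ) ^ 2 ≤ ((K ^ 2 / 2 + 1) * q) ^ 2 := by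
    rw [← sq_abs]
    refine pow_le_pow_left₀ (abs_nonneg _) ?_ 2
    have := abs_sub d ρ
    rw [abs_of_nonneg hρ0] at this
    linarith
  have h4 : 0 ≤ b * (lam * c + d - ρ) := mul_nonneg hb (hq.le.trans hw)
  have h5 : 0 ≤ (2 + α) * (q ^ 3 / e) := by positivity
  have h6 := neg_abs_le (c₂ / (2 * c))
  have h7 : c₁ ^ 2 / (2 * c ^ 2) = 2 * d ^ 2 := by rw [hd]; field_simp
  have h8 : lam * c₁ = 2 * (lam * c) * d := by rw [hd]; field_simp
  have h9 : 0 ≤ (2 + α) * q ^ 2 := by positivity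
  have h10 : 0 ≤ lam * c * ρ := by positivity
  rw [h7, h8]
  nlinarith

section growth

variable {a b : ℝ → ℝ} {α K : ℝ}

theorem AdmissibleCoeff.integral_le (hab : AdmissibleCoeff a b) {t : ℝ} (ht : 0 ≤ t) :
    ∫ r in (0 : ℝ)..t, b r ≤ ∫ r in Ioi (0 : ℝ), b r := by
  rw [intervalIntegral.integral_of_le ht]
  exact setIntegral_mono_set hab.b_integrable
    ((ae_restrict_iff' measurableSet_Ioi).2 (ae_of_all _ fun x hx => hab.b_nonneg x (le_of_lt hx)))
    Ioc_subset_Ioi_self.eventuallyLE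

theorem AdmissibleCoeff.hasDerivWithinAt_deriv_a (hab : AdmissibleCoeff a b) {t : ℝ}
    (ht : 0 ≤ t) : HasDerivWithinAt (derivWithin a (Ici 0)) (iteratedDerivWithin 2 a (Ici 0) t)
      (Ici 0) t := by
  have h1 : ContDiffOn ℝ 1 (derivWithin a (Ici 0)) (Ici 0) :=
    hab.a_contDiff.derivWithin (uniqueDiffOn_Ici 0) (by norm_num)
  have := (h1.differentiableOn (by norm_num) t ht).hasDerivWithinAt
  rwa [iteratedDerivWithin_succ, iteratedDerivWithin_one]

theorem SpeedBounds.lower_inv (hs : SpeedBounds a α K) (hα : -1 < α) (hK : 1 ≤ K) {t : ℝ}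
    (ht : 0 ≤ t) : K⁻¹ * (1 + t)⁻¹ ≤ a t := by
  refine le_trans ?_ (hs.lower t ht)
  gcongr
  rw [← Real.rpow_neg_one]
  exact Real.rpow_le_rpow_of_exponent_le (by linarith) hα.le

theorem AdmissibleCoeff.monotone_primitive (hab : AdmissibleCoeff a b) {s t : ℝ} (hs : 0 ≤ s)
    (hst : s ≤ t) : ∫ r in (0 : ℝ)..s, a r ≤ ∫ r in (0 : ℝ)..t, a r := by
  have hI : ∀ x y : ℝ, 0 ≤ x → x ≤ y → IntervalIntegrable a volume x y := fun x y hx hxy =>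
    (hab.continuousOn_a.mono fun z hz => hx.trans hz.1).intervalIntegrable_of_Icc hxy
  rw [← intervalIntegral.integral_add_adjacent_intervals (hI 0 s le_rfl hs) (hI s t hs hst)]
  have : 0 ≤ ∫ r in s..t, a r := intervalIntegral.integral_nonneg hst fun r hr =>
    (hab.a_pos r (hs.trans hr.1)).le
  linarith

theorem SpeedBounds.le_primitive_one (hs : SpeedBounds a α K) (hab : AdmissibleCoeff a b)
    (hα : -1 < α) (hK : 1 ≤ K) : K⁻¹ / 2 ≤ ∫ r in (0 : ℝ)..1, a r := by
  have hK0 : 0 < K := by linarith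
  have h1 : ∫ _r in (0 : ℝ)..1, K⁻¹ / 2 ≤ ∫ r in (0 : ℝ)..1, a r := by
    refine intervalIntegral.integral_mono_on zero_le_one (by simp)
      ((hab.continuousOn_a.mono Icc_subset_Ici_self).intervalIntegrable_of_Icc zero_le_one)
      fun t ht => le_trans ?_ (hs.lower_inv hα hK ht.1)
    rw [div_eq_mul_inv]
    have := ht.1
    gcongr
    linarith [ht.2]
  simpa using h1

/-- Exponential growth of supersolutions of `H'' + b H' = λ² a² H`, at the rate predicted by the WKB
approximation `a ^ (-1/2) exp (λ ∫ a)`. -/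
theorem exists_growth (hab : AdmissibleCoeff a b) (hs : SpeedBounds a α K) (hα : -1 < α)
    (hK : 1 ≤ K) :
    ∃ lam₀ : ℝ, ∀ lam, lam₀ ≤ lam → ∃ c : ℝ, 0 < c ∧ ∀ (t₁ : ℝ) (H H₁ H₂ : ℝ → ℝ),
      (∀ t ∈ Icc 0 t₁, HasDerivWithinAt H (H₁ t) (Icc 0 t₁) t) →
      (∀ t ∈ Icc 0 t₁, HasDerivWithinAt H₁ (H₂ t) (Icc 0 t₁) t) →
      (∀ t ∈ Icc 0 t₁, lam ^ 2 * a t ^ 2 * H t ≤ H₂ t + b t * H₁ t) → 0 ≤ H 0 → 0 ≤ H₁ 0 →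
      ∀ t ∈ Icc 1 t₁, c * (H 0 + H₁ 0) * ((Real.sqrt (a t))⁻¹ *
        Real.exp (lam * ∫ r in (0 : ℝ)..t, a r)) ≤ H t := by
  have hK0 : 0 < K := by linarith
  have hα1 : 0 < 1 + α := by linarith
  set L₁ := K * (K ^ 2 / 2 + 2)
  set L₂ := K * (K ^ 2 / 2 + K ^ 4 / 2 + (2 + α) + (K ^ 2 / 2 + 1) ^ 2)
  set L₃ := K * (1 + 2 * (1 + α)⁻¹)
  refine ⟨max L₁ (max L₂ L₃), fun lam hlam => ?_⟩
  have hl₁ : L₁ ≤ lam := (le_max_left _ _).trans hlam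
  have hl₂ : L₂ ≤ lam := (le_max_left _ _).trans ((le_max_right _ _).trans hlam)
  have hl₃ : L₃ ≤ lam := (le_max_right _ _).trans ((le_max_right _ _).trans hlam)
  have hl0 : 0 < lam := lt_of_lt_of_le (by positivity) hl₁
  set M := Real.exp (∫ r in Ioi (0 : ℝ), b r) with hM
  have hM0 : 0 < M := Real.exp_pos _
  have ha0 : 0 < a 0 := hab.a_pos 0 le_rfl
  set sa := Real.sqrt (a 0) with hsa
  have hsa0 : 0 < sa := Real.sqrt_pos.2 ha0
  refine ⟨Real.exp (-(1 + α)⁻¹) / (4 * lam * sa * M), by positivity,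
    fun t₁ H H₁ H₂ hH hH₁ hle h0 h10 t ht => ?_⟩
  have hsub : Icc 0 t₁ ⊆ Ici 0 := Icc_subset_Ici_self
  have hac := hab.continuousOn_a
  have hnn : ∀ s ∈ Icc 0 t₁, 0 ≤ H s ∧ 0 ≤ H₁ s := fun s hs =>
    nonneg_of_supersolution hH hH₁ hab.b_contDiff.continuousOn hab.b_nonneg
      (continuousOn_const.mul ((hac.mono hsub).pow 2))
      (fun _ _ => mul_nonneg (sq_nonneg _) (sq_nonneg _)) hle h0 h10 hs
  -- the coefficients of the approximate solution
  set a' := derivWithin a (Ici 0)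
  set a'' := iteratedDerivWithin 2 a (Ici 0)
  have ha' : ∀ s ∈ Icc 0 t₁, HasDerivWithinAt a (a' s) (Icc 0 t₁) s := fun s hs =>
    (hab.hasDerivWithinAt_a hs.1).mono hsub
  have ha'' : ∀ s ∈ Icc 0 t₁, HasDerivWithinAt a' (a'' s) (Icc 0 t₁) s := fun s hs =>
    (hab.hasDerivWithinAt_deriv_a hs.1).mono hsub
  set A : ℝ → ℝ := fun s => ∫ r in (0 : ℝ)..s, a r with hA
  have hA' : ∀ s ∈ Icc 0 t₁, HasDerivWithinAt A (a s) (Icc 0 t₁) s := fun s hs =>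
    (hasDerivWithinAt_primitive hac hs.1).mono hsub
  set m : ℝ → ℝ := fun s => Real.exp (∫ r in (0 : ℝ)..s, b r) with hm
  have hm0 : ∀ s, 0 < m s := fun s => Real.exp_pos _
  have hmM : ∀ s, 0 ≤ s → m s ≤ M := fun s hs => Real.exp_le_exp.2 (hab.integral_le hs)
  have hm' : ∀ s ∈ Icc 0 t₁, HasDerivWithinAt m (m s * b s) (Icc 0 t₁) s := fun s hs =>
    ((hasDerivWithinAt_primitive hab.b_contDiff.continuousOn hs.1).mono hsub).exp
  -- The correction `ρ` makes the Riccati defect nonnegative and has a bounded primitive `P`, so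
  -- that it changes the growth rate only by a constant factor.
  set ρ : ℝ → ℝ := fun s => (1 + s) ^ (-2 - α) with hρ
  set P : ℝ → ℝ := fun s => (1 + α)⁻¹ * (1 - (1 + s) ^ (-1 - α)) with hP
  have hρ' : ∀ s ∈ Icc 0 t₁, HasDerivWithinAt ρ ((-2 - α) * (1 + s) ^ (-3 - α)) (Icc 0 t₁) s :=
    fun s hs => by
      have h1 : (1 : ℝ) + s ≠ 0 := by linarith [hs.1]
      refine ((((hasDerivAt_id s).const_add 1).rpow_const (Or.inl h1)).congr_deriv
        ?_).hasDerivWithinAt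
      simp only [id]
      ring_nf
  have hP' : ∀ s ∈ Icc 0 t₁, HasDerivWithinAt P (ρ s) (Icc 0 t₁) s := fun s hs => by
    have h1 : (1 : ℝ) + s ≠ 0 := by linarith [hs.1]
    have h2 := (((hasDerivAt_id s).const_add 1).rpow_const (p := -1 - α) (Or.inl h1))
    refine ((h2.const_sub 1).const_mul (1 + α)⁻¹ |>.congr_deriv ?_).hasDerivWithinAt
    simp only [id, hρ]
    have h3 : -1 - α - 1 = -2 - α := by ring
    rw [h3]
    field_simp
    ring
  have hP0 : ∀ s ∈ Icc 0 t₁, P s ≤ (1 + α)⁻¹ := fun s hs => by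
    have : 0 ≤ (1 + s) ^ (-1 - α) := Real.rpow_nonneg (by linarith [hs.1]) _
    have h2 : (0 : ℝ) ≤ (1 + α)⁻¹ := by positivity
    simp only [hP]
    nlinarith
  set w : ℝ → ℝ := fun s => lam * a s + a' s / (2 * a s) - ρ s with hw
  set w' : ℝ → ℝ := fun s => lam * a' s + (a'' s / (2 * a s) - a' s ^ 2 / (2 * a s ^ 2))
    + (2 + α) * (1 + s) ^ (-3 - α) with hw'
  have hwd : ∀ s ∈ Icc 0 t₁, HasDerivWithinAt w (w' s) (Icc 0 t₁) s := fun s hs => by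
    have has := hab.a_pos s hs.1
    have := (((ha' s hs).const_mul lam).add ((ha'' s hs).div ((ha' s hs).const_mul 2)
      (by positivity))).sub (hρ' s hs)
    refine this.congr_deriv ?_
    simp only [hw']
    field_simp
    ring
  have hric : ∀ s ∈ Icc 0 t₁, (1 + s)⁻¹ ≤ w s ∧
      0 ≤ w' s - w s ^ 2 + b s * w s + lam ^ 2 * a s ^ 2 := fun s hs' => by
    have h1 : (0 : ℝ) < 1 + s := by linarith [hs'.1]
    have h2 : (1 : ℝ) ≤ 1 + s := by linarith [hs'.1]
    have r1 : ρ s = ((1 + s)⁻¹) ^ 2 / (1 + s) ^ α := by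
      simp only [hρ]
      rw [Real.rpow_sub h1, Real.rpow_neg h1.le, Real.rpow_two, inv_pow]
    have r2 : (1 + s) ^ (-3 - α) = ((1 + s)⁻¹) ^ 3 / (1 + s) ^ α := by
      rw [Real.rpow_sub h1, Real.rpow_neg h1.le, inv_pow, ← Real.rpow_natCast]
      norm_num
    have r3 : (1 + s) ^ (α - 1) = (1 + s) ^ α * (1 + s)⁻¹ := by
      rw [Real.rpow_sub_one h1.ne', div_eq_mul_inv]
    have r4 : (1 + s) ^ (α - 2) = (1 + s) ^ α * ((1 + s)⁻¹) ^ 2 := by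
      rw [Real.rpow_sub h1, Real.rpow_two, inv_pow, div_eq_mul_inv]
    have := riccati_le (e := (1 + s) ^ α) (q := (1 + s)⁻¹) (c := a s) (c₁ := a' s) (c₂ := a'' s)
      (by positivity) (by positivity) (by
        rw [← Real.rpow_neg_one]
        exact Real.rpow_le_rpow_of_exponent_le h2 hα.le) hK hα (hs.lower s hs'.1)
      (by rw [← r3]; exact hs.deriv s hs'.1) (by rw [← r4]; exact hs.deriv_two s hs'.1)
      (hab.b_nonneg s hs'.1) hl₁ hl₂
    rw [← r1, ← r2] at this
    exact this
  -- the comparison function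
  set E : ℝ → ℝ := fun s => Real.sqrt (a s) * Real.exp (lam * A s - P s) with hE
  have hE0 : ∀ s ∈ Icc 0 t₁, 0 < E s := fun s hs =>
    mul_pos (Real.sqrt_pos.2 (hab.a_pos s hs.1)) (Real.exp_pos _)
  have hX' : ∀ s ∈ Icc 0 t₁, HasDerivWithinAt (fun s => Real.exp (lam * A s - P s))
      (Real.exp (lam * A s - P s) * (lam * a s - ρ s)) (Icc 0 t₁) s := fun s hs =>
    (((hA' s hs).const_mul lam).sub (hP' s hs)).exp
  have hE' : ∀ s ∈ Icc 0 t₁, HasDerivWithinAt E (w s * E s) (Icc 0 t₁) s := fun s hs => by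
    have has := hab.a_pos s hs.1
    refine (((ha' s hs).sqrt has.ne').mul (hX' s hs)).congr_deriv ?_
    simp only [hw, hE]
    have h1 : Real.sqrt (a s) ≠ 0 := (Real.sqrt_pos.2 has).ne'
    have h2 : a s = Real.sqrt (a s) ^ 2 := (Real.sq_sqrt has.le).symm
    have h3 : a' s / (2 * a s) * Real.sqrt (a s) = a' s / (2 * Real.sqrt (a s)) := by
      rw [div_mul_eq_mul_div, div_eq_div_iff (by positivity) (by positivity)]
      nth_rewrite 3 [h2]
      ring
    rw [← h3]
    ring
  have hA0 : A 0 = 0 := by simp [hA]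
  have hP00 : P 0 = 0 := by simp [hP]
  have ht0 : (0 : ℝ) ≤ t := zero_le_one.trans ht.1
  have ht₁ : t ∈ Icc 0 t₁ := ⟨ht0, ht.2⟩
  have h0t : (0 : ℝ) ∈ Icc 0 t₁ := ⟨le_rfl, ht0.trans ht.2⟩
  set y : ℝ → ℝ := fun s => H₁ s + w s * H s with hy
  -- `y = H' + w H` satisfies `y' + b y ≥ w y`, and `E` satisfies `E' = w E`
  have hmono : MonotoneOn (fun s => y s * m s / E s) (Icc 0 t₁) := by
    refine monotoneOn_of_hasDerivWithinAt_Icc (fun s hs => (((hH₁ s hs).add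
      ((hwd s hs).mul (hH s hs))).mul (hm' s hs)).div (hE' s hs) (hE0 s hs).ne') fun s hs => ?_
    have hs' : s ∈ Icc 0 t₁ := ⟨hs.1.le, hs.2.le⟩
    have e0 := hE0 s hs'
    have e1 := hm0 s
    have e2 := hnn s hs'
    have e3 := hric s hs'
    have e4 := hle s hs'
    have e5 : 0 ≤ (H₂ s + b s * H₁ s - lam ^ 2 * a s ^ 2 * H s)
        + (w' s - w s ^ 2 + b s * w s + lam ^ 2 * a s ^ 2) * H s :=
      add_nonneg (by linarith) (mul_nonneg e3.2 e2.1)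
    refine div_nonneg (le_of_le_of_eq (mul_nonneg (mul_nonneg e5 e1.le) e0.le) ?_) (sq_nonneg _)
    simp only [Pi.add_apply, Pi.mul_apply]
    ring
  set y₀ := H 0 + H₁ 0 with hy₀
  have hy₀0 : 0 ≤ y₀ := add_nonneg h0 h10
  have hyy₀ : y₀ ≤ y 0 := by
    have h1 := (hric 0 h0t).1
    rw [add_zero, inv_one] at h1
    simp only [hy, hy₀]
    nlinarith
  set c₁ := y₀ / (sa * M) with hc₁
  have hc₁0 : 0 ≤ c₁ := by positivity
  have hylow : ∀ s ∈ Icc 0 t₁, c₁ * E s ≤ y s := fun s hs => by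
    have h1 := hmono h0t hs hs.1
    have h2 : m 0 = 1 := by simp [hm]
    have h3 : E 0 = sa := by simp [hE, hA0, hP00, hsa]
    simp only [h2, h3, mul_one] at h1
    have h4 : y₀ / sa ≤ y s * m s / E s := le_trans (by gcongr) h1
    rw [le_div_iff₀ (hE0 s hs)] at h4
    have hys : 0 ≤ y s := add_nonneg (hnn s hs).2 (mul_nonneg
      ((inv_nonneg.2 (by linarith [hs.1])).trans (hric s hs).1) (hnn s hs).1)
    have h5 : y s * m s ≤ y s * M := mul_le_mul_of_nonneg_left (hmM s hs.1) hys
    have h6 : c₁ * E s = y₀ / sa * E s / M := by rw [hc₁]; field_simp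
    rw [h6, div_le_iff₀ hM0]
    exact h4.trans h5
  -- `(H E)' = y E ≥ c₁ E²`, and `E² = a X²` is nearly the derivative of `X² / (2 λ)`
  have hΦ : MonotoneOn (fun s => H s * E s - c₁ / (2 * lam) *
      (Real.exp (lam * A s - P s) * Real.exp (lam * A s - P s))) (Icc 0 t₁) := by
    refine monotoneOn_of_hasDerivWithinAt_Icc (fun s hs => ((hH s hs).mul (hE' s hs)).sub
      (((hX' s hs).mul (hX' s hs)).const_mul (c₁ / (2 * lam)))) fun s hs => ?_
    have hs' : s ∈ Icc 0 t₁ := ⟨hs.1.le, hs.2.le⟩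
    have e0 := hE0 s hs'
    have e1 := mul_le_mul_of_nonneg_right (hylow s hs') e0.le
    have hρ0 : 0 ≤ ρ s := Real.rpow_nonneg (by linarith [hs.1]) _
    set X := Real.exp (lam * A s - P s) with hX
    have hX0 : 0 < X := Real.exp_pos _
    have e2 : E s * E s = a s * (X * X) := by
      have := Real.mul_self_sqrt (hab.a_pos s hs.1.le).le
      simp only [hE]
      rw [mul_mul_mul_comm, this]
    have e3 : c₁ / (2 * lam) * (X * (lam * a s - ρ s) * X + X * (X * (lam * a s - ρ s)))
        = c₁ * (a s * (X * X)) - c₁ / lam * (ρ s * (X * X)) := by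
      field_simp
      ring
    have e4 : 0 ≤ c₁ / lam * (ρ s * (X * X)) := by positivity
    rw [e3]
    rw [mul_assoc, e2] at e1
    simp only [hy] at e1
    linarith
  have h1 := hΦ h0t ht₁ ht0
  simp only [hA0, hP00, mul_zero, sub_zero, Real.exp_zero, mul_one] at h1
  set X := Real.exp (lam * A t - P t) with hX
  have hX0 : 0 < X := Real.exp_pos _
  have hX2 : 2 ≤ X * X := by
    have h2 := hs.le_primitive_one hab hα hK
    have h3 := hab.monotone_primitive zero_le_one ht.1
    have h4 : L₃ * (K⁻¹ / 2) ≤ lam * A t := by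
      have : K⁻¹ / 2 ≤ A t := h2.trans h3
      gcongr
    have h5 : L₃ * (K⁻¹ / 2) = 1 / 2 + (1 + α)⁻¹ := by
      simp only [L₃]
      field_simp
    have h6 := hP0 t ht₁
    rw [hX, ← Real.exp_add]
    refine le_trans ?_ (Real.add_one_le_exp _)
    linarith
  have hHE : c₁ / (4 * lam) * (X * X) ≤ H t * E t := by
    have h2 : 0 ≤ H 0 * E 0 := mul_nonneg h0 (hE0 0 h0t).le
    have h3 : 0 ≤ c₁ / (2 * lam) := by positivity
    have h4 : c₁ / (4 * lam) = c₁ / (2 * lam) / 2 := by field_simp; ring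
    rw [h4]
    nlinarith
  have hsat : 0 < Real.sqrt (a t) := Real.sqrt_pos.2 (hab.a_pos t ht0)
  have hH2 : c₁ / (4 * lam) * ((Real.sqrt (a t))⁻¹ * X) ≤ H t := by
    have h2 : H t * E t = H t * Real.sqrt (a t) * X := by simp only [hE]; ring
    rw [h2, ← mul_assoc] at hHE
    have h3 := le_of_mul_le_mul_right hHE hX0
    rw [mul_left_comm, inv_mul_le_iff₀ hsat]
    linarith
  refine le_trans ?_ hH2
  have h7 : Real.exp (-(1 + α)⁻¹) * Real.exp (lam * A t) ≤ X := by
    rw [hX, ← Real.exp_add]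
    refine Real.exp_le_exp.2 ?_
    have h6 := hP0 t ht₁
    linarith
  calc Real.exp (-(1 + α)⁻¹) / (4 * lam * sa * M) * y₀ * ((Real.sqrt (a t))⁻¹ *
        Real.exp (lam * A t))
      = c₁ / (4 * lam) * ((Real.sqrt (a t))⁻¹ * (Real.exp (-(1 + α)⁻¹)
        * Real.exp (lam * A t))) := by rw [hc₁]; field_simp
    _ ≤ c₁ / (4 * lam) * ((Real.sqrt (a t))⁻¹ * X) := by gcongr

end growth

/-! ### A test function estimate for the total mass -/

/-- If `F'' + b F' = U` with `|F| ≤ U ^ (1/p) V ^ (1/q)` on `[0, T]`, then `U` is, on the average,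
at most a multiple of `V T ^ (-2 q)`. In the proof, `τ = ∫ exp (-∫ b)` is the time in which the
damping disappears, and the equation is integrated against `(1 - τ / τ(T)) ^ (2 q)`. -/
theorem exists_average_le {p q M : ℝ} (hpq : p.HolderConjugate q) (hM : 1 ≤ M) :
    ∃ C : ℝ, 0 < C ∧ ∀ (b F F₁ F₂ U : ℝ → ℝ) (T V l : ℝ), 0 < T → 0 ≤ V →
      ContinuousOn b (Ici 0) → (∀ t, 0 ≤ t → 0 ≤ b t) →
      (∀ t, 0 ≤ t → Real.exp (∫ r in (0 : ℝ)..t, b r) ≤ M) →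
      (∀ t ∈ Icc 0 T, HasDerivWithinAt F (F₁ t) (Icc 0 T) t) →
      (∀ t ∈ Icc 0 T, HasDerivWithinAt F₁ (F₂ t) (Icc 0 T) t) →
      (∀ t ∈ Icc 0 T, F₂ t + b t * F₁ t = U t) → (∀ t ∈ Icc 0 T, 0 ≤ U t) →
      (∀ t ∈ Icc 0 T, F t ≤ U t ^ p⁻¹ * V ^ q⁻¹) → 0 ≤ F 0 → 0 ≤ F₁ 0 →
      (∀ t ∈ Icc (T / 4) (T / 2), l ≤ U t) → l ≤ C * V * T ^ (-(2 * q)) := by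
  have hM0 : 0 < M := by linarith
  have hq : 1 < q := hpq.symm.lt
  have hp : 1 < p := hpq.lt
  have hq0 : 0 < q := by linarith
  have hp0 : 0 < p := by linarith
  set k := 2 * q with hk
  have hk2 : 2 < k := by linarith
  have hk0 : 0 < k := by linarith
  refine ⟨4 * (k ^ 2 * M ^ 2) ^ q * (2 * M) ^ k, by positivity,
    fun b F F₁ F₂ U T V l hT hV hb hb0 hbM hF hF₁ hU hU0 hFU h0 h10 hl => ?_⟩
  set m : ℝ → ℝ := fun s => Real.exp (∫ r in (0 : ℝ)..s, b r) with hm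
  have hm0 : ∀ s, 0 < m s := fun s => Real.exp_pos _
  have hm1 : ∀ s, 0 ≤ s → 1 ≤ m s := fun s hs =>
    Real.one_le_exp (intervalIntegral.integral_nonneg hs fun r hr => hb0 r hr.1)
  have hmI : ∀ s, 0 ≤ s → HasDerivWithinAt m (m s * b s) (Ici 0) s := fun s hs =>
    (hasDerivWithinAt_primitive hb hs).exp
  have hsub : Icc 0 T ⊆ Ici 0 := Icc_subset_Ici_self
  have hmc : ContinuousOn (fun s => (m s)⁻¹) (Ici 0) :=
    ContinuousOn.inv₀ (fun s hs => (hmI s hs).continuousWithinAt) fun s _ => (hm0 s).ne'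
  set τ : ℝ → ℝ := fun s => ∫ r in (0 : ℝ)..s, (m r)⁻¹ with hτ
  have hτ' : ∀ s ∈ Icc 0 T, HasDerivWithinAt τ (m s)⁻¹ (Icc 0 T) s := fun s hs =>
    (hasDerivWithinAt_primitive hmc hs.1).mono hsub
  have hτ0 : τ 0 = 0 := by simp [hτ]
  have hτup : ∀ s ∈ Icc 0 T, ∀ t ∈ Icc 0 T, s ≤ t → τ t - τ s ≤ t - s := by
    intro s hs t ht hst
    have := monotoneOn_of_hasDerivWithinAt_Icc (fun x hx =>
      (hasDerivWithinAt_id x (Icc 0 T)).sub (hτ' x hx)) (fun x hx => by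
        rw [sub_nonneg]
        exact inv_le_one_of_one_le₀ (hm1 x hx.1.le)) hs ht hst
    simp only [Pi.sub_apply, id] at this
    linarith
  have hτlow : ∀ s ∈ Icc 0 T, ∀ t ∈ Icc 0 T, s ≤ t → M⁻¹ * (t - s) ≤ τ t - τ s := by
    intro s hs t ht hst
    have := monotoneOn_of_hasDerivWithinAt_Icc (fun x hx =>
      (hτ' x hx).sub ((hasDerivWithinAt_id x (Icc 0 T)).const_mul M⁻¹)) (fun x hx => by
        rw [sub_nonneg, mul_one]
        exact inv_anti₀ (hm0 x) (hbM x hx.1.le)) hs ht hst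
    simp only [Pi.sub_apply, id] at this
    linarith
  have h0T : (0 : ℝ) ∈ Icc 0 T := ⟨le_rfl, hT.le⟩
  have hTT : T ∈ Icc 0 T := ⟨hT.le, le_rfl⟩
  set τ₁ := τ T with hτ₁
  have hτ₁T : τ₁ ≤ T := by have := hτup 0 h0T T hTT hT.le; rw [hτ0] at this; linarith
  have hTτ₁ : M⁻¹ * T ≤ τ₁ := by have := hτlow 0 h0T T hTT hT.le; rw [hτ0] at this; linarith
  have hτ₁0 : 0 < τ₁ := lt_of_lt_of_le (by positivity) hTτ₁
  set x : ℝ → ℝ := fun s => 1 - τ s / τ₁ with hx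
  have hx' : ∀ s ∈ Icc 0 T, HasDerivWithinAt x (-((m s)⁻¹ / τ₁)) (Icc 0 T) s := fun s hs =>
    ((hτ' s hs).div_const τ₁).const_sub 1
  have hxlow : ∀ s ∈ Icc 0 T, M⁻¹ * (T - s) / T ≤ x s := fun s hs => by
    have h1 := hτlow s hs T hTT hs.2
    have h2 : x s = (τ₁ - τ s) / τ₁ := by simp only [hx]; field_simp
    have h3 : 0 ≤ M⁻¹ * (T - s) := mul_nonneg (by positivity) (by linarith [hs.2])
    rw [h2]
    exact div_le_div₀ (h3.trans h1) h1 hτ₁0 hτ₁T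
  have hx0 : ∀ s ∈ Icc 0 T, 0 ≤ x s := fun s hs =>
    le_trans (div_nonneg (mul_nonneg (by positivity) (by linarith [hs.2])) hT.le) (hxlow s hs)
  have hxT : x T = 0 := by simp only [hx]; rw [← hτ₁, div_self hτ₁0.ne', sub_self]
  -- the boundary terms left when `(m F')' = m U` is integrated twice by parts against `x ^ k`
  set Q : ℝ → ℝ := fun s => m s * F₁ s * x s ^ k + F s * (k / τ₁ * x s ^ (k - 1)) with hQ
  have hQ' : ∀ s ∈ Icc 0 T, HasDerivWithinAt Q
      (m s * U s * x s ^ k - F s * (k * (k - 1) / τ₁ ^ 2 * (m s)⁻¹ * x s ^ (k - 2)))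
      (Icc 0 T) s := fun s hs => by
    have d1 := ((hmI s hs.1).mono hsub).mul (hF₁ s hs)
    have d2 := (hx' s hs).rpow_const (p := k) (Or.inr (by linarith))
    have d3 := (hx' s hs).rpow_const (p := k - 1) (Or.inr (by linarith))
    refine ((d1.mul d2).add ((hF s hs).mul (d3.const_mul (k / τ₁)))).congr_deriv ?_
    have e1 : k - 1 - 1 = k - 2 := by ring
    have e2 := (hm0 s).ne'
    rw [← hU s hs, e1]
    simp only [Pi.mul_apply]
    field_simp
    ring
  set W := V * (k ^ 2 / τ₁ ^ 2) ^ q with hW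
  have hW0 : 0 ≤ W := by positivity
  -- Young's inequality absorbs the term with `F`
  have hyoung : ∀ s ∈ Icc 0 T, q⁻¹ * (U s * x s ^ k - W)
      ≤ m s * U s * x s ^ k - F s * (k * (k - 1) / τ₁ ^ 2 * (m s)⁻¹ * x s ^ (k - 2)) := by
    intro s hs
    have hUs := hU0 s hs
    have hxs := hx0 s hs
    have hxk : 0 ≤ x s ^ k := by positivity
    have y1 : (x s ^ k) ^ p⁻¹ = x s ^ (k - 2) := by
      rw [← Real.rpow_mul hxs]
      congr 1
      have := hpq.inv_add_inv_eq_one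
      have h2 : p⁻¹ = 1 - q⁻¹ := by linarith
      rw [h2, hk]
      field_simp
    have y2 : F s * (k * (k - 1) / τ₁ ^ 2 * (m s)⁻¹ * x s ^ (k - 2))
        ≤ (U s * x s ^ k) ^ p⁻¹ * (V ^ q⁻¹ * (k ^ 2 / τ₁ ^ 2)) := by
      have hk1 : 0 ≤ k - 1 := by linarith
      have hms := hm0 s
      have hxk2 : 0 ≤ x s ^ (k - 2) := by positivity
      rw [Real.mul_rpow hUs hxk, y1]
      calc F s * (k * (k - 1) / τ₁ ^ 2 * (m s)⁻¹ * x s ^ (k - 2))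
          ≤ (U s ^ p⁻¹ * V ^ q⁻¹) * (k * (k - 1) / τ₁ ^ 2 * (m s)⁻¹ * x s ^ (k - 2)) := by
            have := hFU s hs
            gcongr
        _ ≤ (U s ^ p⁻¹ * V ^ q⁻¹) * (k * k / τ₁ ^ 2 * 1 * x s ^ (k - 2)) := by
            gcongr
            · linarith
            · exact inv_le_one_of_one_le₀ (hm1 s hs.1)
        _ = _ := by ring
    have y3 := Real.young_inequality_of_nonneg (a := (U s * x s ^ k) ^ p⁻¹)
      (b := V ^ q⁻¹ * (k ^ 2 / τ₁ ^ 2)) (by positivity) (by positivity) hpq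
    rw [Real.rpow_inv_rpow (by positivity) hp0.ne', Real.mul_rpow (x := V ^ q⁻¹) (by positivity)
      (by positivity), Real.rpow_inv_rpow hV hq0.ne', ← hW] at y3
    have y4 : U s * x s ^ k ≤ m s * (U s * x s ^ k) :=
      le_mul_of_one_le_left (by positivity) (hm1 s hs.1)
    have y5 : U s * x s ^ k / p = U s * x s ^ k - q⁻¹ * (U s * x s ^ k) := by
      have := hpq.inv_add_inv_eq_one
      rw [div_eq_mul_inv, show p⁻¹ = 1 - q⁻¹ by linarith]
      ring
    rw [div_eq_inv_mul W] at y3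
    rw [mul_sub, mul_assoc (m s)]
    linarith
  have hmono : MonotoneOn (fun s => Q s + q⁻¹ * W * s) (Icc 0 T) := by
    refine monotoneOn_of_hasDerivWithinAt_Icc (fun s hs =>
      (hQ' s hs).add ((hasDerivWithinAt_id s _).const_mul (q⁻¹ * W))) fun s hs => ?_
    have hs' : s ∈ Icc 0 T := ⟨hs.1.le, hs.2.le⟩
    have h1 := hyoung s hs'
    have h2 : 0 ≤ q⁻¹ * (U s * x s ^ k) :=
      mul_nonneg (by positivity) (mul_nonneg (hU0 s hs') (Real.rpow_nonneg (hx0 s hs') _))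
    rw [mul_sub] at h1
    linarith
  set e := ((2 * M)⁻¹) ^ k with he
  have he0 : 0 < e := by positivity
  rcases le_or_gt l 0 with hl0 | hl0
  · exact hl0.trans (by positivity)
  have hss : Icc (T / 4) (T / 2) ⊆ Icc 0 T := Icc_subset_Icc (by positivity) (by linarith)
  have hmono2 : MonotoneOn (fun s => Q s + q⁻¹ * (W - l * e) * s) (Icc (T / 4) (T / 2)) := by
    refine monotoneOn_of_hasDerivWithinAt_Icc (fun s hs =>
      ((hQ' s (hss hs)).mono hss).add
        ((hasDerivWithinAt_id s _).const_mul (q⁻¹ * (W - l * e)))) fun s hs => ?_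
    have hs'' : s ∈ Icc (T / 4) (T / 2) := ⟨hs.1.le, hs.2.le⟩
    have hs' : s ∈ Icc 0 T := hss hs''
    have h1 := hyoung s hs'
    have h2 : e ≤ x s ^ k := by
      refine Real.rpow_le_rpow (by positivity) (le_trans ?_ (hxlow s hs')) hk0.le
      rw [mul_inv, mul_comm, mul_div_assoc]
      gcongr
      rw [inv_eq_one_div, div_le_div_iff₀ (by norm_num) hT]
      linarith [hs.2]
    have h3 : l * e ≤ U s * x s ^ k := mul_le_mul (hl s hs'') h2 he0.le (hU0 s hs')
    have h4 : q⁻¹ * (l * e) ≤ q⁻¹ * (U s * x s ^ k) := by gcongr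
    rw [mul_sub] at h1
    have h5 : q⁻¹ * (W - l * e) = q⁻¹ * W - q⁻¹ * (l * e) := by ring
    rw [mul_one, h5]
    linarith
  have m1 := hmono h0T (hss ⟨le_rfl, by linarith⟩) (by positivity)
  have m2 := hmono2 ⟨le_rfl, by linarith⟩ ⟨by linarith, le_rfl⟩ (by linarith)
  have m3 := hmono (hss ⟨by linarith, le_rfl⟩) hTT (by linarith)
  have hQ0 : 0 ≤ Q 0 := by
    have := hm0 0
    have h2 := hx0 0 h0T
    simp only [hQ]
    positivity
  have hQT : Q T = 0 := by
    simp only [hQ, hxT]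
    rw [Real.zero_rpow hk0.ne', Real.zero_rpow (by linarith)]
    ring
  simp only [hQT] at m1 m2 m3
  have h5 : q⁻¹ * (l * e * (T / 4)) ≤ q⁻¹ * (W * T) := by linarith
  have h6 := le_of_mul_le_mul_left h5 (by positivity)
  have h7 : l * e ≤ 4 * W := by
    refine le_of_mul_le_mul_right ?_ (show 0 < T / 4 by positivity)
    linarith
  have h8 : W ≤ V * ((k ^ 2 * M ^ 2) ^ q * T ^ (-k)) := by
    have e1 : (k ^ 2 * M ^ 2) ^ q * T ^ (-k) = (k ^ 2 * M ^ 2 / T ^ 2) ^ q := by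
      rw [Real.div_rpow (by positivity) (by positivity), Real.rpow_neg hT.le, div_eq_mul_inv,
        ← Real.rpow_natCast T 2, ← Real.rpow_mul hT.le, hk]
      norm_num
    rw [e1, hW]
    have : k ^ 2 / τ₁ ^ 2 ≤ k ^ 2 * M ^ 2 / T ^ 2 := by
      rw [div_le_div_iff₀ (by positivity) (by positivity)]
      have : T ≤ M * τ₁ := by rwa [inv_mul_le_iff₀ hM0] at hTτ₁
      calc k ^ 2 * T ^ 2 ≤ k ^ 2 * (M * τ₁) ^ 2 := by gcongr
        _ = _ := by ring
    gcongr
  have h9 : l ≤ 4 * W * (2 * M) ^ k := by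
    have : l = l * e * (2 * M) ^ k := by
      rw [he, Real.inv_rpow (by positivity), mul_assoc, inv_mul_cancel₀ (by positivity), mul_one]
    rw [this]
    gcongr
  calc l ≤ 4 * W * (2 * M) ^ k := h9
    _ ≤ 4 * (V * ((k ^ 2 * M ^ 2) ^ q * T ^ (-k))) * (2 * M) ^ k := by gcongr
    _ = _ := by ring

/-! ### The critical exponent -/

theorem gammaHWY_one {ν α : ℝ} (hα : -1 < α) : gammaHWY ν α 1 = 4 / (1 + α) := by
  have : 1 + α ≠ 0 := by linarith
  unfold gammaHWY
  field_simp
  ring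

/-- The set `{p ≥ 1 ; γ(p) > 0}` is an interval: `γ` is concave, or else all its coefficients are
positive. -/
theorem gammaHWY_pos_of_le {ν α p p' : ℝ} (hν : 1 ≤ ν) (hα : -1 < α) (hp : 1 ≤ p) (hpp' : p ≤ p')
    (h : 0 < gammaHWY ν α p') : 0 < gammaHWY ν α p := by
  have h1 : 0 < gammaHWY ν α 1 := by
    rw [gammaHWY_one hα]
    exact div_pos (by norm_num) (by linarith)
  have h3 : 3 * α / (1 + α) = 3 * (α / (1 + α)) := by ring
  unfold gammaHWY at *
  rw [h3] at h1 h ⊢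
  set μ := α / (1 + α)
  rcases le_or_gt 0 (ν - 1 + μ) with hA | hA
  · rcases hp.eq_or_lt with rfl | hp1
    · exact h1
    have hB : 0 < p' - 1 := by linarith
    refine (mul_pos_iff_of_pos_left hB).1 (lt_of_lt_of_le (b := (p' - p) *
      (2 + (ν + 1 - 3 * μ) * 1 - (ν - 1 + μ) * 1 ^ 2)
      + (p - 1) * (2 + (ν + 1 - 3 * μ) * p' - (ν - 1 + μ) * p' ^ 2)) ?_ ?_)
    · exact add_pos_of_nonneg_of_pos (mul_nonneg (by linarith) h1.le)
        (mul_pos (by linarith) h)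
    · have : 0 ≤ (ν - 1 + μ) * ((p - 1) * (p' - p) * (p' - 1)) := by
        refine mul_nonneg hA (mul_nonneg (mul_nonneg ?_ ?_) ?_) <;> linarith
      nlinarith
  · have h2 : 0 < (ν + 1 - 3 * μ) * p := mul_pos (by linarith) (by linarith)
    have h4 : 0 ≤ -(ν - 1 + μ) * p ^ 2 := mul_nonneg (by linarith) (sq_nonneg p)
    linarith

theorem lt_pHWY_iff {ν α p : ℝ} (hν : 1 ≤ ν) (hα : -1 < α) (hp : 1 < p) :
    (p : EReal) < pHWY ν α ↔ 0 < gammaHWY ν α p := by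
  rw [pHWY, lt_sSup_iff]
  constructor
  · rintro ⟨_, ⟨p', ⟨_, h2⟩, rfl⟩, h3⟩
    exact gammaHWY_pos_of_le hν hα hp.le (EReal.coe_lt_coe_iff.1 h3).le h2
  · intro h
    have hc : Continuous fun p => gammaHWY ν α p := by
      unfold gammaHWY
      fun_prop
    have h1 : ∀ᶠ x in 𝓝[>] p, 0 < gammaHWY ν α x :=
      (hc.continuousAt.eventually (lt_mem_nhds h)).filter_mono nhdsWithin_le_nhds
    obtain ⟨p', h2, h3⟩ := (h1.and self_mem_nhdsWithin).exists
    exact ⟨p', ⟨p', ⟨hp.trans h3, h2⟩, rfl⟩, EReal.coe_lt_coe_iff.2 h3⟩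

/-! ### Size of the cone of influence -/

theorem rpow_le_of_mul_le {c C s x e : ℝ} (hc : 0 < c) (hs : 0 < s) (h1 : c * s ≤ x)
    (h2 : x ≤ C * s) : x ^ e ≤ (c ^ e + C ^ e) * s ^ e := by
  have hC : 0 < C := by
    by_contra! hC
    nlinarith
  have hx : 0 < x := lt_of_lt_of_le (by positivity) h1
  rw [add_mul, ← Real.mul_rpow hc.le hs.le, ← Real.mul_rpow hC.le hs.le]
  rcases le_total 0 e with he | he
  · exact (Real.rpow_le_rpow hx.le h2 he).trans (le_add_of_nonneg_left (by positivity))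
  · exact (Real.rpow_le_rpow_of_nonpos (by positivity) h1 he).trans
      (le_add_of_nonneg_right (by positivity))

section cone

variable {a b : ℝ → ℝ} {α K : ℝ}

theorem hasDerivWithinAt_one_add_rpow (hα : -1 < α) {s t : ℝ} (hs : s ∈ Icc 0 t) :
    HasDerivWithinAt (fun s => (1 + α)⁻¹ * (1 + s) ^ (1 + α)) ((1 + s) ^ α) (Icc 0 t) s := by
  have h1 : (1 : ℝ) + s ≠ 0 := by linarith [hs.1]
  have h2 : 1 + α ≠ 0 := by linarith
  refine (((((hasDerivAt_id s).const_add 1).rpow_const (p := 1 + α) (Or.inl h1)).const_mul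
    (1 + α)⁻¹).congr_deriv ?_).hasDerivWithinAt
  simp only [id]
  rw [one_mul, ← mul_assoc, inv_mul_cancel₀ h2, one_mul, add_sub_cancel_left]

theorem SpeedBounds.primitive_le (hs : SpeedBounds a α K) (hab : AdmissibleCoeff a b)
    (hα : -1 < α) (hK : 1 ≤ K) {t : ℝ} (ht : 0 ≤ t) :
    ∫ r in (0 : ℝ)..t, a r ≤ K / (1 + α) * (1 + t) ^ (1 + α) := by
  have h1 := monotoneOn_of_hasDerivWithinAt_Icc (fun x hx =>
    ((hasDerivWithinAt_one_add_rpow hα hx).const_mul K).sub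
      ((hasDerivWithinAt_primitive hab.continuousOn_a hx.1).mono Icc_subset_Ici_self))
    (fun x hx => sub_nonneg.2 (hs.upper x hx.1.le)) ⟨le_rfl, ht⟩ ⟨ht, le_rfl⟩ ht
  have h2 : 0 < 1 + α := by linarith
  have h3 : 0 ≤ K * ((1 + α)⁻¹ * (1 + 0) ^ (1 + α)) := by positivity
  simp only [Pi.sub_apply, intervalIntegral.integral_same] at h1
  rw [div_eq_mul_inv, mul_assoc]
  linarith

theorem SpeedBounds.le_primitive (hs : SpeedBounds a α K) (hab : AdmissibleCoeff a b)
    (hα : -1 < α) {t : ℝ} (ht : 0 ≤ t) :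
    K⁻¹ / (1 + α) * ((1 + t) ^ (1 + α) - 1) ≤ ∫ r in (0 : ℝ)..t, a r := by
  have h1 := monotoneOn_of_hasDerivWithinAt_Icc (fun x hx =>
    ((hasDerivWithinAt_primitive hab.continuousOn_a hx.1).mono Icc_subset_Ici_self).sub
      ((hasDerivWithinAt_one_add_rpow hα hx).const_mul K⁻¹))
    (fun x hx => sub_nonneg.2 (hs.lower x hx.1.le)) ⟨le_rfl, ht⟩ ⟨ht, le_rfl⟩ ht
  simp only [Pi.sub_apply, intervalIntegral.integral_same, add_zero, Real.one_rpow] at h1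
  rw [div_eq_mul_inv, mul_assoc]
  linarith

/-- The radius of the cone of influence is comparable to `(1 + t) ^ (1 + α)`. -/
theorem SpeedBounds.exists_radius_bounds (hs : SpeedBounds a α K) (hab : AdmissibleCoeff a b)
    (hα : -1 < α) (hK : 1 ≤ K) {r : ℝ} (hr : 0 ≤ r) :
    ∃ c C : ℝ, 0 < c ∧ 0 < C ∧ ∀ t, 0 ≤ t →
      c * (1 + t) ^ (1 + α) ≤ 1 + (r + ∫ s in (0 : ℝ)..t, a s) ∧
      1 + (r + ∫ s in (0 : ℝ)..t, a s) ≤ C * (1 + t) ^ (1 + α) := by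
  have h2 : 0 < 1 + α := by linarith
  have hK0 : 0 < K := by linarith
  refine ⟨min 1 (K⁻¹ / (1 + α)), 1 + r + K / (1 + α), by positivity, by positivity,
    fun t ht => ?_⟩
  have h1 : 1 ≤ (1 + t) ^ (1 + α) := Real.one_le_rpow (by linarith) h2.le
  have h3 := hs.primitive_le hab hα hK ht
  have h4 := hs.le_primitive hab hα ht
  have h5 := min_le_left 1 (K⁻¹ / (1 + α))
  have h6 := min_le_right 1 (K⁻¹ / (1 + α))
  constructor
  · have := mul_le_mul_of_nonneg_right h6 (sub_nonneg.2 h1)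
    linarith
  · have := mul_le_mul_of_nonneg_left h1 (show 0 ≤ 1 + r by positivity)
    linarith

end cone

/-! ### Hölder's inequality on the cone -/

theorem integral_mul_le_of_ae_eq_zero {p q : ℝ} (hpq : p.HolderConjugate q) {w : L2 N} {R : ℝ}
    (hw : ∀ᵐ x : Space N, R < ‖x‖ → w x = 0) (hint : Integrable fun x => |w x| ^ p)
    {φ : Space N → ℝ} (hφ : Continuous φ) (hφ0 : ∀ x, 0 < φ x) :
    ∫ x, w x * φ x ≤ (∫ x, |w x| ^ p) ^ p⁻¹
      * (∫ x in Metric.closedBall (0 : Space N) R, φ x ^ q) ^ q⁻¹ := by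
  set B := Metric.closedBall (0 : Space N) R
  have hp0 : 0 < p := hpq.pos
  have hq0 : 0 < q := hpq.symm.pos
  have h1 : ∫ x, w x * φ x = ∫ x in B, w x * φ x := by
    refine (setIntegral_eq_integral_of_ae_compl_eq_zero ?_).symm
    filter_upwards [hw] with x hx hxB
    rw [hx (by simpa [B] using hxB), zero_mul]
  have hmeas : AEStronglyMeasurable (fun x => |w x|) volume := (Lp.aestronglyMeasurable w).norm
  have hm1 : MemLp (fun x => |w x|) (ENNReal.ofReal p) (volume.restrict B) := by
    refine MemLp.restrict B ((integrable_norm_rpow_iff hmeas (by simpa using hp0) (by simp)).1 ?_)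
    simpa [ENNReal.toReal_ofReal hp0.le] using hint
  have hm2 : MemLp φ (ENNReal.ofReal q) (volume.restrict B) := by
    refine (integrable_norm_rpow_iff hφ.aestronglyMeasurable (by simpa using hq0) (by simp)).1 ?_
    rw [ENNReal.toReal_ofReal hq0.le]
    exact (hφ.norm.rpow_const fun x => Or.inr hq0.le).continuousOn.integrableOn_compact
      (isCompact_closedBall 0 R)
  have h2 := integral_mul_le_Lp_mul_Lq_of_nonneg hpq (ae_of_all _ fun x => abs_nonneg (w x))
    (ae_of_all _ fun x => (hφ0 x).le) hm1 hm2
  rw [h1]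
  have hφ2 : MemLp φ 2 (volume.restrict B) := by
    refine (memLp_two_iff_integrable_sq hφ.aestronglyMeasurable).2 ?_
    exact (hφ.pow 2).continuousOn.integrableOn_compact (isCompact_closedBall 0 R)
  calc ∫ x in B, w x * φ x ≤ ∫ x in B, |w x| * φ x := by
        exact integral_mono (((Lp.memLp w).restrict B).integrable_mul hφ2)
          (((Lp.memLp w).norm.restrict B).integrable_mul hφ2)
          fun x => mul_le_mul_of_nonneg_right (le_abs_self _) (hφ0 x).le
    _ ≤ (∫ x in B, |w x| ^ p) ^ (1 / p) * (∫ x in B, φ x ^ q) ^ (1 / q) := h2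
    _ ≤ _ := by
        rw [one_div, one_div]
        refine mul_le_mul_of_nonneg_right ?_ (Real.rpow_nonneg (integral_nonneg fun x =>
          Real.rpow_nonneg (hφ0 x).le _) _)
        refine Real.rpow_le_rpow (integral_nonneg fun x => by positivity)
          (setIntegral_le_integral hint (ae_of_all _ fun x => by positivity)) (by positivity)

/-! ### Lower and upper bounds for the nonlinear mass -/

theorem SpeedBounds.of_weighted {a : ℝ → ℝ} {α K : ℝ}
    (ha : ∀ t : ℝ, 0 ≤ t → K⁻¹ ≤ (1 + t) ^ (-α) * a t ∧ (1 + t) ^ (-α) * a t ≤ K)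
    (ha' : ∀ t : ℝ, 0 ≤ t →
      (1 + t) ^ (1 - α) * |derivWithin a (Ici 0) t|
        + (1 + t) ^ (2 - α) * |iteratedDerivWithin 2 a (Ici 0) t| ≤ K) : SpeedBounds a α K := by
  have key : ∀ (t e x : ℝ), 0 ≤ t → x = (1 + t) ^ (-e) * x * (1 + t) ^ e := by
    intro t e x ht
    have h1 : (0 : ℝ) < 1 + t := by linarith
    rw [mul_right_comm, ← Real.rpow_add h1, neg_add_cancel, Real.rpow_zero, one_mul]
  have hpow : ∀ t e : ℝ, 0 ≤ t → 0 ≤ (1 + t) ^ e := fun t e ht =>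
    Real.rpow_nonneg (by linarith) _
  refine ⟨fun t ht => ?_, fun t ht => ?_, fun t ht => ?_, fun t ht => ?_⟩
  · rw [key t α (a t) ht]
    exact mul_le_mul_of_nonneg_right (ha t ht).1 (hpow t α ht)
  · rw [key t α (a t) ht]
    exact mul_le_mul_of_nonneg_right (ha t ht).2 (hpow t α ht)
  · rw [key t (α - 1) |_| ht, neg_sub]
    refine mul_le_mul_of_nonneg_right (le_trans ?_ (ha' t ht)) (hpow t _ ht)
    exact le_add_of_nonneg_right (mul_nonneg (hpow t _ ht) (abs_nonneg _))
  · rw [key t (α - 2) |_| ht, neg_sub]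
    refine mul_le_mul_of_nonneg_right (le_trans ?_ (ha' t ht)) (hpow t _ ht)
    exact le_add_of_nonneg_left (mul_nonneg (hpow t _ ht) (abs_nonneg _))

section blowup

variable {a b : ℝ → ℝ} {α K p q r : ℝ} {f : H2 N} {g : H1 N}

theorem integral_smul_toL2_mul (ε : ℝ) (w : L2 N) (φ : Space N → ℝ) :
    ∫ x, (ε • w : L2 N) x * φ x = ε * ∫ x, w x * φ x := by
  rw [← integral_const_mul]
  refine integral_congr_ae ?_
  filter_upwards [Lp.coeFn_smul ε w] with x hx
  rw [hx, Pi.smul_apply, smul_eq_mul, mul_assoc]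

theorem smul_data_eq_zero (hsupp : ∀ᵐ x : Space N, r ≤ ‖x‖ → f.toL2 x = 0 ∧ g.toL2 x = 0)
    (ε : ℝ) : ∀ᵐ x : Space N, r ≤ ‖x‖ → (ε • f).toL2 x = 0 ∧ (ε • g).toL2 x = 0 := by
  have h1 : (ε • f).toL2 = ε • f.toL2 := rfl
  have h2 : (ε • g).toL2 = ε • g.toL2 := rfl
  rw [h1, h2]
  filter_upwards [hsupp, Lp.coeFn_smul ε f.toL2, Lp.coeFn_smul ε g.toL2] with x hx h3 h4 hr
  rw [h3, h4, Pi.smul_apply, Pi.smul_apply, (hx hr).1, (hx hr).2, smul_zero]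
  exact ⟨rfl, rfl⟩

theorem integral_mul_nonneg_of_ae {w : L2 N} (hw : ∀ᵐ x : Space N, 0 ≤ w x) {φ : Space N → ℝ}
    (hφ : ∀ x, 0 ≤ φ x) : 0 ≤ ∫ x, w x * φ x := by
  refine integral_nonneg_of_ae ?_
  filter_upwards [hw] with x hx using mul_nonneg hx (hφ x)

/-- Nontrivial nonnegative data have a positive moment. -/
theorem integral_add_integral_pos (hf : ∀ᵐ x : Space N, 0 ≤ f.toL2 x)
    (hg : ∀ᵐ x : Space N, 0 ≤ g.toL2 x) (hfg : f.toL2 + g.toL2 ≠ 0)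
    (hsupp : ∀ᵐ x : Space N, r ≤ ‖x‖ → f.toL2 x = 0 ∧ g.toL2 x = 0) {φ : Space N → ℝ}
    (hφ : Continuous φ) (hφ0 : ∀ x, 0 < φ x) :
    0 < (∫ x, f.toL2 x * φ x) + ∫ x, g.toL2 x * φ x := by
  have i1 : Integrable fun x => f.toL2 x * φ x := integrable_mul_of_ae_eq_zero (R := r) (by
    filter_upwards [hsupp] with x hx h1 using (hx h1.le).1) hφ
  have i2 : Integrable fun x => g.toL2 x * φ x := integrable_mul_of_ae_eq_zero (R := r) (by
    filter_upwards [hsupp] with x hx h1 using (hx h1.le).2) hφ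
  rw [← integral_add i1 i2]
  have h0 : 0 ≤ᵐ[volume] fun x => f.toL2 x * φ x + g.toL2 x * φ x := by
    filter_upwards [hf, hg] with x h1 h2
    exact add_nonneg (mul_nonneg h1 (hφ0 x).le) (mul_nonneg h2 (hφ0 x).le)
  refine lt_of_le_of_ne (integral_nonneg_of_ae h0) fun h => hfg ?_
  have h1 := (integral_eq_zero_iff_of_nonneg_ae h0 (i1.add i2)).1 h.symm
  rw [Lp.eq_zero_iff_ae_eq_zero]
  filter_upwards [h1, Lp.coeFn_add f.toL2 g.toL2] with x h2 h3
  rw [h3, Pi.add_apply]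
  have h4 : (f.toL2 x + g.toL2 x) * φ x = 0 := by rw [add_mul]; exact h2
  exact (mul_eq_zero.1 h4).resolve_right (hφ0 x).ne'

/-- Testing with the exponentially growing eigenfunction shows that the solution spreads along the
light cone; this bounds the nonlinear mass from below. -/
theorem exists_mass_lower_bound (hN : 1 ≤ N) (hab : AdmissibleCoeff a b)
    (hs : SpeedBounds a α K) (hα : -1 < α) (hK : 1 ≤ K) (hpq : p.HolderConjugate q)
    (hpN : 5 ≤ N → p ≤ ((N : ℝ) - 2) / ((N : ℝ) - 4)) (hr : 0 ≤ r)
    (hf : ∀ᵐ x : Space N, 0 ≤ f.toL2 x) (hg : ∀ᵐ x : Space N, 0 ≤ g.toL2 x)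
    (hfg : f.toL2 + g.toL2 ≠ 0)
    (hsupp : ∀ᵐ x : Space N, r ≤ ‖x‖ → f.toL2 x = 0 ∧ g.toL2 x = 0) :
    ∃ C : ℝ, 0 < C ∧ ∀ ε : ℝ, 0 < ε → ∀ (T : ℝ) (u : ℝ → H2 N),
      IsStrongSolution a b p (ε • f) (ε • g) T u → ∀ t₁ ∈ Ico 0 T, ∀ t ∈ Icc 1 t₁,
      ε ≤ C * (∫ x, |(u t).toL2 x| ^ p) ^ p⁻¹
        * (1 + t) ^ (α / 2 + (1 + α) * ((N - 1 : ℝ) * (1 - q / 2) * q⁻¹)) := by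
  have hp : 1 < p := hpq.lt
  have hq : 1 < q := hpq.symm.lt
  have hq0 : 0 < q := by linarith
  have hK0 : 0 < K := by linarith
  have hN' : (1 : ℝ) ≤ N := by exact_mod_cast hN
  obtain ⟨lam₀, hgrow⟩ := exists_growth hab hs hα hK
  set lam := max lam₀ (max 1 (2 * ((N - 1 : ℝ) * |1 - q / 2|))) with hlam
  have hl1 : 1 ≤ lam := (le_max_left _ _).trans (le_max_right _ _)
  have hl2 : (N - 1 : ℝ) * |1 - q / 2| ≤ lam / 2 := by
    have : 2 * ((N - 1 : ℝ) * |1 - q / 2|) ≤ lam := (le_max_right _ _).trans (le_max_right _ _)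
    linarith
  obtain ⟨c, hc, hgrow⟩ := hgrow lam (le_max_left _ _)
  obtain ⟨C₁, hC₁, hφint⟩ := exists_setIntegral_eigenfunction_le hN hq hl1 hl2
  obtain ⟨c₂, C₂, hc₂, hC₂, hrad⟩ := hs.exists_radius_bounds hab hα hK hr
  set φ := eigenfunction N lam with hφ
  have hφs : ContDiff ℝ ∞ φ := contDiff_eigenfunction hN
  have hφ0 : ∀ x, 0 < φ x := eigenfunction_pos hN
  set I := (∫ x, f.toL2 x * φ x) + ∫ x, g.toL2 x * φ x with hI
  have hI0 : 0 < I := integral_add_integral_pos hf hg hfg hsupp hφs.continuous hφ0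
  set e := (N - 1 : ℝ) * (1 - q / 2) with he
  set D := c₂ ^ (e * q⁻¹) + C₂ ^ (e * q⁻¹) with hD
  have hD0 : 0 < D := by positivity
  refine ⟨C₁ ^ q⁻¹ * D * Real.exp (lam * r) * Real.sqrt K / (c * I), by positivity,
    fun ε hε T u h t₁ ht₁ t ht => ?_⟩
  have ht0 : 0 ≤ t := zero_le_one.trans ht.1
  have hsub : Icc 0 t₁ ⊆ Ico 0 T := fun x hx => ⟨hx.1, hx.2.trans_lt ht₁.2⟩
  have hcone : ∀ s ∈ Ico 0 T, ∀ᵐ x : Space N, r + (∫ y in (0 : ℝ)..s, a y) < ‖x‖ →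
      (u s).toL2 x = 0 := fun s hs' =>
    h.ae_eq_zero hab hp hpN (smul_data_eq_zero hsupp ε) hs'
  have hsmulg : ∀ᵐ x : Space N, r + (∫ y in (0 : ℝ)..t₁, a y) < ‖x‖ → (ε • g).toL2 x = 0 := by
    have h1 := hab.monotone_primitive le_rfl ht₁.1
    rw [intervalIntegral.integral_same] at h1
    filter_upwards [smul_data_eq_zero hsupp ε] with x hx h2 using (hx (by linarith)).2
  obtain ⟨H₁, H₂, _, d1, d2, heq, h10⟩ := h.exists_moment_deriv hp ht₁
    (R := r + ∫ y in (0 : ℝ)..t₁, a y) (fun s hs' => by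
      have h1 := hab.monotone_primitive hs'.1 hs'.2
      filter_upwards [hcone s (hsub hs')] with x hx h2 using hx (by linarith))
    hsmulg hφs (c := lam ^ 2) (laplacian_eigenfunction hN)
  set H : ℝ → ℝ := fun s => ∫ x, (u s).toL2 x * φ x with hH
  have e0 : H 0 = ε * ∫ x, f.toL2 x * φ x := by
    simp only [hH, h.initial_value]
    exact integral_smul_toL2_mul ε f.toL2 φ
  have e1 : H₁ 0 = ε * ∫ x, g.toL2 x * φ x := by
    rw [h10]
    exact integral_smul_toL2_mul ε g.toL2 φ
  have hpos : ∀ s, 0 ≤ ∫ x, |(u s).toL2 x| ^ p * φ x := fun s =>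
    integral_nonneg fun x => mul_nonneg (by positivity) (hφ0 x).le
  have hlow := hgrow t₁ H H₁ H₂ d1 d2 (fun s hs' => by
      rw [heq s hs']
      have := hpos s
      simp only [hH]
      linarith)
    (by rw [e0]; exact mul_nonneg hε.le (integral_mul_nonneg_of_ae hf fun x => (hφ0 x).le))
    (by rw [e1]; exact mul_nonneg hε.le (integral_mul_nonneg_of_ae hg fun x => (hφ0 x).le)) t ht
  have hsum : H 0 + H₁ 0 = ε * I := by rw [e0, e1, hI]; ring
  rw [hsum] at hlow
  have htT : t ∈ Ico 0 T := hsub ⟨ht0, ht.2⟩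
  set R := r + ∫ y in (0 : ℝ)..t, a y with hR
  set U := ∫ x, |(u t).toL2 x| ^ p with hU
  have hU0 : 0 ≤ U := integral_nonneg fun x => by positivity
  have hA0 : 0 ≤ ∫ y in (0 : ℝ)..t, a y := by
    have := hab.monotone_primitive le_rfl ht0
    rwa [intervalIntegral.integral_same] at this
  have hR0 : 0 ≤ R := by positivity
  have hint : Integrable fun x => |(u t).toL2 x| ^ p := by
    simpa using h.integrable_rpow_mul hp htT (hcone t htT) (continuous_const (y := (1 : ℝ)))
  have hup := integral_mul_le_of_ae_eq_zero hpq (hcone t htT) hint hφs.continuous hφ0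
  have hJ : (∫ x in Metric.closedBall (0 : Space N) R, φ x ^ q) ^ q⁻¹
      ≤ C₁ ^ q⁻¹ * (1 + R) ^ (e * q⁻¹) * Real.exp (lam * R) := by
    refine (Real.rpow_le_rpow (integral_nonneg fun x => Real.rpow_nonneg (hφ0 x).le _)
      (hφint R hR0) (by positivity)).trans (le_of_eq ?_)
    rw [Real.mul_rpow (by positivity) (by positivity), Real.mul_rpow hC₁.le (by positivity),
      ← Real.rpow_mul (by positivity), ← Real.exp_mul]
    congr 2
    field_simp
  have hRt : (1 + R) ^ (e * q⁻¹) ≤ D * (1 + t) ^ ((1 + α) * (e * q⁻¹)) := by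
    have := rpow_le_of_mul_le (e := e * q⁻¹) hc₂ (by positivity) (hrad t ht0).1 (hrad t ht0).2
    rwa [← Real.rpow_mul (by positivity)] at this
  have hat : 0 < a t := hab.a_pos t ht0
  have hsq : Real.sqrt (a t) ≤ Real.sqrt K * (1 + t) ^ (α / 2) := by
    refine Real.sqrt_le_iff.2 ⟨by positivity, ?_⟩
    rw [mul_pow, Real.sq_sqrt hK0.le, ← Real.rpow_natCast, ← Real.rpow_mul (by positivity)]
    convert hs.upper t ht0 using 3
    push_cast
    ring
  have hsq0 : 0 < Real.sqrt (a t) := Real.sqrt_pos.2 hat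
  set X := Real.exp (lam * ∫ y in (0 : ℝ)..t, a y) with hX
  have hX0 : 0 < X := Real.exp_pos _
  have hexp : Real.exp (lam * R) = Real.exp (lam * r) * X := by
    rw [hX, ← Real.exp_add, hR, mul_add]
  -- both sides grow like `exp (λ ∫ a)`, and this factor cancels
  have hchain : c * (ε * I) * X ≤ (U ^ p⁻¹ * (C₁ ^ q⁻¹ * (D * (1 + t) ^ ((1 + α) * (e * q⁻¹)))
      * Real.exp (lam * r)) * (Real.sqrt K * (1 + t) ^ (α / 2))) * X := by
    calc c * (ε * I) * X = c * (ε * I) * ((Real.sqrt (a t))⁻¹ * X) * Real.sqrt (a t) := by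
          field_simp
      _ ≤ (U ^ p⁻¹ * (C₁ ^ q⁻¹ * (D * (1 + t) ^ ((1 + α) * (e * q⁻¹))) * Real.exp (lam * R)))
          * (Real.sqrt K * (1 + t) ^ (α / 2)) := by
          refine mul_le_mul (hlow.trans (hup.trans ?_)) hsq hsq0.le (by positivity)
          gcongr
          exact hJ.trans (by gcongr)
      _ = _ := by rw [hexp]; ring
  have hfin := le_of_mul_le_mul_right hchain hX0
  rw [Real.rpow_add (by positivity)]
  rw [div_mul_eq_mul_div, div_mul_eq_mul_div, le_div_iff₀ (by positivity)]
  linarith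

/-- The mass of the solution being controlled by the nonlinear mass on the cone, the latter cannot
be large on the average. -/
theorem exists_mass_upper_bound (hab : AdmissibleCoeff a b)
    (hs : SpeedBounds a α K) (hα : -1 < α) (hK : 1 ≤ K) (hpq : p.HolderConjugate q)
    (hpN : 5 ≤ N → p ≤ ((N : ℝ) - 2) / ((N : ℝ) - 4)) (hr : 0 ≤ r)
    (hf : ∀ᵐ x : Space N, 0 ≤ f.toL2 x) (hg : ∀ᵐ x : Space N, 0 ≤ g.toL2 x)
    (hsupp : ∀ᵐ x : Space N, r ≤ ‖x‖ → f.toL2 x = 0 ∧ g.toL2 x = 0) :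
    ∃ C : ℝ, 0 < C ∧ ∀ ε : ℝ, 0 < ε → ∀ (T : ℝ) (u : ℝ → H2 N),
      IsStrongSolution a b p (ε • f) (ε • g) T u → ∀ t₁ ∈ Ico 0 T, 0 < t₁ → ∀ l : ℝ,
      (∀ t ∈ Icc (t₁ / 4) (t₁ / 2), l ≤ ∫ x, |(u t).toL2 x| ^ p) →
      l ≤ C * (1 + t₁) ^ ((1 + α) * N) * t₁ ^ (-(2 * q)) := by
  have hp : 1 < p := hpq.lt
  have hq0 : 0 < q := hpq.symm.pos
  set M := Real.exp (∫ x in Ioi (0 : ℝ), b x) with hM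
  have hM1 : 1 ≤ M := Real.one_le_exp (setIntegral_nonneg measurableSet_Ioi fun x hx =>
    hab.b_nonneg x (le_of_lt hx))
  obtain ⟨C₁, hC₁, havg⟩ := exists_average_le hpq hM1
  obtain ⟨c₂, C₂, hc₂, hC₂, hrad⟩ := hs.exists_radius_bounds hab hα hK hr
  set w := volume.real (Metric.ball (0 : Space N) 1) with hw
  have hw0 : 0 ≤ w := measureReal_nonneg
  refine ⟨C₁ * (C₂ ^ N * w) + 1, by positivity, fun ε hε T u h t₁ ht₁ ht₁0 l hl => ?_⟩
  have hsub : Icc 0 t₁ ⊆ Ico 0 T := fun x hx => ⟨hx.1, hx.2.trans_lt ht₁.2⟩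
  set R := r + ∫ y in (0 : ℝ)..t₁, a y with hR
  have hA0 : 0 ≤ ∫ y in (0 : ℝ)..t₁, a y := by
    have := hab.monotone_primitive le_rfl ht₁.1
    rwa [intervalIntegral.integral_same] at this
  have hR0 : 0 ≤ R := by positivity
  have hcone : ∀ s ∈ Icc 0 t₁, ∀ᵐ x : Space N, R < ‖x‖ → (u s).toL2 x = 0 := fun s hs' => by
    have h1 := hab.monotone_primitive hs'.1 hs'.2
    filter_upwards [h.ae_eq_zero hab hp hpN (smul_data_eq_zero hsupp ε) (hsub hs')] with x hx h2
      using hx (by linarith)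
  have hsmulg : ∀ᵐ x : Space N, R < ‖x‖ → (ε • g).toL2 x = 0 := by
    filter_upwards [smul_data_eq_zero hsupp ε] with x hx h2 using (hx (by linarith)).2
  obtain ⟨F₁, F₂, _, d1, d2, heq, h10⟩ := h.exists_moment_deriv hp ht₁ hcone hsmulg
    (φ := fun _ => 1) contDiff_const (c := 0) (fun x => by
      have : ∀ i : Fin N, partialDeriv i (fun _ : Space N => (1 : ℝ)) = fun _ => 0 := fun i => by
        ext y
        simp [partialDeriv]
      simp [this, partialDeriv])
  set V := ∫ _x in Metric.closedBall (0 : Space N) R, (1 : ℝ) ^ q with hV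
  have hVw : V = R ^ N * w := by
    rw [hV, Real.one_rpow, setIntegral_const, smul_eq_mul, mul_one,
      Measure.addHaar_real_closedBall volume _ hR0, finrank_euclideanSpace, Fintype.card_fin]
  have hV0 : 0 ≤ V := by rw [hVw]; positivity
  have key := havg b (fun s => ∫ x, (u s).toL2 x * 1) F₁ F₂ (fun s => ∫ x, |(u s).toL2 x| ^ p)
    t₁ V l ht₁0 hV0 hab.b_contDiff.continuousOn hab.b_nonneg
    (fun t ht => Real.exp_le_exp.2 (hab.integral_le ht)) d1 d2 (fun t ht => by
      rw [heq t ht]; simp) (fun t _ => integral_nonneg fun x => by positivity)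
    (fun t ht => integral_mul_le_of_ae_eq_zero hpq (hcone t ht) (by
        simpa using h.integrable_rpow_mul hp (hsub ht) (hcone t ht)
          (continuous_const (y := (1 : ℝ)))) continuous_const fun _ => one_pos)
    (by
      simp only [h.initial_value]
      rw [show (ε • f).toL2 = ε • f.toL2 from rfl, integral_smul_toL2_mul]
      exact mul_nonneg hε.le (integral_mul_nonneg_of_ae hf fun _ => zero_le_one))
    (by
      rw [h10, show (ε • g).toL2 = ε • g.toL2 from rfl, integral_smul_toL2_mul]
      exact mul_nonneg hε.le (integral_mul_nonneg_of_ae hg fun _ => zero_le_one)) hl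
  refine key.trans ?_
  have hVle : V ≤ C₂ ^ N * w * (1 + t₁) ^ ((1 + α) * N) := by
    have h1 := (hrad t₁ ht₁.1).2
    have h2 : R ^ N ≤ (C₂ * (1 + t₁) ^ (1 + α)) ^ N := pow_le_pow_left₀ hR0 (by linarith) N
    rw [hVw]
    calc R ^ N * w ≤ (C₂ * (1 + t₁) ^ (1 + α)) ^ N * w := by gcongr
      _ = _ := by
        rw [mul_pow, ← Real.rpow_natCast ((1 + t₁) ^ (1 + α)), ← Real.rpow_mul (by positivity)]
        ring
  have h3 : 0 ≤ (1 + t₁) ^ ((1 + α) * N) := by positivity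
  refine mul_le_mul_of_nonneg_right ?_ (by positivity)
  calc C₁ * V ≤ C₁ * (C₂ ^ N * w * (1 + t₁) ^ ((1 + α) * N)) := by gcongr
    _ ≤ (C₁ * (C₂ ^ N * w) + 1) * (1 + t₁) ^ ((1 + α) * N) := by linarith

/-- The two bounds for the nonlinear mass are incompatible for large times. -/
theorem exists_time_le (hN : 1 ≤ N) (hab : AdmissibleCoeff a b)
    (hs : SpeedBounds a α K) (hα : -1 < α) (hK : 1 ≤ K) (hp : 1 < p)
    (hpN : 5 ≤ N → p ≤ ((N : ℝ) - 2) / ((N : ℝ) - 4)) (hr : 0 ≤ r)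
    (hf : ∀ᵐ x : Space N, 0 ≤ f.toL2 x) (hg : ∀ᵐ x : Space N, 0 ≤ g.toL2 x)
    (hfg : f.toL2 + g.toL2 ≠ 0)
    (hsupp : ∀ᵐ x : Space N, r ≤ ‖x‖ → f.toL2 x = 0 ∧ g.toL2 x = 0)
    (hγ : 0 < gammaHWY N α p) :
    ∃ C : ℝ, 0 < C ∧ ∀ ε : ℝ, 0 < ε → ∀ (T : ℝ) (u : ℝ → H2 N),
      IsStrongSolution a b p (ε • f) (ε • g) T u → ∀ t₁ ∈ Ico 0 T, 4 ≤ t₁ →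
      t₁ ≤ C * ε ^ (-(2 * p * (p - 1) / ((1 + α) * gammaHWY N α p))) := by
  set q := p / (p - 1) with hq
  have hp1 : 0 < p - 1 := by linarith
  have hp0 : 0 < p := by linarith
  have hα1 : 0 < 1 + α := by linarith
  have hpq : p.HolderConjugate q := Real.HolderConjugate.conjExponent hp
  have hq0 : 0 < q := by positivity
  obtain ⟨C₁, hC₁, hlow⟩ := exists_mass_lower_bound hN hab hs hα hK hpq hpN hr hf hg hfg hsupp
  obtain ⟨C₂, hC₂, hup⟩ := exists_mass_upper_bound hab hs hα hK hpq hpN hr hf hg hsupp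
  set θ := α / 2 + (1 + α) * ((N - 1 : ℝ) * (1 - q / 2) * q⁻¹) with hθ
  set κ := (1 + α) * gammaHWY N α p / (2 * (p - 1)) with hκ
  have hκ0 : 0 < κ := by positivity
  -- the exponents balance
  have hexp : p * θ + (1 + α) * N + -(2 * q) = -κ := by
    rw [hθ, hκ, hq]
    unfold gammaHWY
    field_simp
    ring
  set B := (1 / 4 : ℝ) ^ θ + 1 ^ θ with hB
  have hB0 : 0 < B := by positivity
  set D := (C₁ * B) ^ p * (C₂ * 2 ^ ((1 + α) * N)) with hD
  have hD0 : 0 < D := by positivity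
  refine ⟨D ^ κ⁻¹, by positivity, fun ε hε T u h t₁ ht₁ h4 => ?_⟩
  have ht0 : 0 < t₁ := by linarith
  have hl : ∀ t ∈ Icc (t₁ / 4) (t₁ / 2), (ε / (C₁ * B * t₁ ^ θ)) ^ p
      ≤ ∫ x, |(u t).toL2 x| ^ p := by
    intro t ht
    have ht1 : 1 ≤ t := by linarith [ht.1]
    have h1 := hlow ε hε T u h t₁ ht₁ t ⟨ht1, by linarith [ht.2]⟩
    have h2 : (1 + t) ^ θ ≤ B * t₁ ^ θ := rpow_le_of_mul_le (by norm_num) ht0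
      (by linarith [ht.1]) (by linarith [ht.2])
    set U := ∫ x, |(u t).toL2 x| ^ p
    have hU0 : 0 ≤ U := integral_nonneg fun x => by positivity
    have h3 : ε / (C₁ * B * t₁ ^ θ) ≤ U ^ p⁻¹ := by
      rw [div_le_iff₀ (by positivity)]
      calc ε ≤ C₁ * U ^ p⁻¹ * (1 + t) ^ θ := h1
        _ ≤ C₁ * U ^ p⁻¹ * (B * t₁ ^ θ) := by gcongr
        _ = _ := by ring
    calc _ ≤ (U ^ p⁻¹) ^ p := Real.rpow_le_rpow (by positivity) h3 hp0.le
      _ = U := Real.rpow_inv_rpow hU0 hp0.ne'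
  have h5 := hup ε hε T u h t₁ ht₁ ht0 _ hl
  have h6 : (1 + t₁) ^ ((1 + α) * N) ≤ 2 ^ ((1 + α) * N) * t₁ ^ ((1 + α) * N) := by
    rw [← Real.mul_rpow (by norm_num) ht0.le]
    exact Real.rpow_le_rpow (by positivity) (by linarith) (by positivity)
  have h7 : ε ^ p ≤ D * t₁ ^ (-κ) := by
    rw [Real.div_rpow hε.le (by positivity), Real.mul_rpow (by positivity) (by positivity),
      ← Real.rpow_mul ht0.le, div_le_iff₀ (by positivity)] at h5
    calc ε ^ p ≤ C₂ * (1 + t₁) ^ ((1 + α) * N) * t₁ ^ (-(2 * q))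
          * ((C₁ * B) ^ p * t₁ ^ (θ * p)) := h5
      _ ≤ C₂ * (2 ^ ((1 + α) * N) * t₁ ^ ((1 + α) * N)) * t₁ ^ (-(2 * q))
          * ((C₁ * B) ^ p * t₁ ^ (θ * p)) := by gcongr
      _ = D * (t₁ ^ (p * θ) * t₁ ^ ((1 + α) * N) * t₁ ^ (-(2 * q))) := by
          rw [hD, mul_comm θ p]; ring
      _ = D * t₁ ^ (-κ) := by rw [← Real.rpow_add ht0, ← Real.rpow_add ht0, hexp]
  have h8 : t₁ ^ κ ≤ D * ε ^ (-p) := by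
    rw [Real.rpow_neg ht0.le, ← div_eq_mul_inv, le_div_iff₀ (by positivity)] at h7
    rw [Real.rpow_neg hε.le, ← div_eq_mul_inv, le_div_iff₀ (by positivity)]
    linarith
  calc t₁ = (t₁ ^ κ) ^ κ⁻¹ := (Real.rpow_rpow_inv ht0.le hκ0.ne').symm
    _ ≤ (D * ε ^ (-p)) ^ κ⁻¹ := Real.rpow_le_rpow (by positivity) h8 (by positivity)
    _ = _ := by
      rw [Real.mul_rpow hD0.le (by positivity), ← Real.rpow_mul hε.le]
      congr 2
      rw [hκ]
      field_simp

end blowup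

end SemilinearWave

theorem corollary1p2 (N : ℕ) (hN : 1 ≤ N) (a b : ℝ → ℝ) (hab : AdmissibleCoeff a b)
    (α β K : ℝ) (hα : -1 < α) (hβ : 1 < β) (hK : 1 ≤ K)
    (ha : ∀ t : ℝ, 0 ≤ t → K⁻¹ ≤ (1 + t) ^ (-α) * a t ∧ (1 + t) ^ (-α) * a t ≤ K)
    (ha' : ∀ t : ℝ, 0 ≤ t →
      (1 + t) ^ (1 - α) * |derivWithin a (Ici 0) t|
        + (1 + t) ^ (2 - α) * |iteratedDerivWithin 2 a (Ici 0) t| ≤ K)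
    (hb : ∀ t : ℝ, 0 ≤ t →
      (1 + t) ^ β * b t + (1 + t) ^ (1 + β) * |derivWithin b (Ici 0) t| ≤ K)
    (p : ℝ) (hp : 1 < p) (hpN : 5 ≤ N → p ≤ ((N : ℝ) - 2) / ((N : ℝ) - 4))
    (f : H2 N) (g : H1 N) (r₀ : ℝ)
    (hf : ∀ᵐ x : Space N, 0 ≤ f.toL2 x) (hg : ∀ᵐ x : Space N, 0 ≤ g.toL2 x)
    (hfg : f.toL2 + g.toL2 ≠ 0)
    (hsupp : ∀ᵐ x : Space N, r₀ ≤ ‖x‖ → f.toL2 x = 0 ∧ g.toL2 x = 0) :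
    ((p : EReal) < pHWY N α ↔ 0 < gammaHWY N α p) ∧
    ((p : EReal) < pHWY N α →
      ∃ C : ℝ, 0 < C ∧ ∃ ε₀ : ℝ, 0 < ε₀ ∧ ∀ ε : ℝ, 0 < ε → ε ≤ ε₀ →
        lifespan a b p f g ε ≤
          ENNReal.ofReal
            (C * ε ^ (-(2 * p * (p - 1) / ((1 + α) * gammaHWY N α p))))) := by
  have hN' : (1 : ℝ) ≤ N := by exact_mod_cast hN
  refine ⟨lt_pHWY_iff hN' hα hp, fun h => ?_⟩
  have hγ := (lt_pHWY_iff hN' hα hp).1 h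
  obtain ⟨C, hC, htime⟩ := exists_time_le (r := max r₀ 0) hN hab (SpeedBounds.of_weighted ha ha')
    hα hK hp hpN (le_max_right _ _) hf hg hfg (by
      filter_upwards [hsupp] with x hx h1 using hx ((le_max_left _ _).trans h1)) hγ
  refine ⟨4 + C, by positivity, 1, one_pos, fun ε hε hε1 => ?_⟩
  refine sSup_le ?_
  rintro _ ⟨T, ⟨_, u, hu⟩, rfl⟩
  refine ENNReal.ofReal_le_ofReal (le_of_forall_lt_imp_le_of_dense fun t ht => ?_)
  have hα1 : 0 < 1 + α := by linarith
  have hp1 : 0 < p - 1 := by linarith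
  set X := ε ^ (-(2 * p * (p - 1) / ((1 + α) * gammaHWY N α p))) with hX
  -- times below `4`, which the comparison does not reach, are absorbed by the constant
  have hX1 : 1 ≤ X := by
    refine Real.one_le_rpow_of_pos_of_le_one_of_nonpos hε hε1 (neg_nonpos.2 ?_)
    positivity
  rcases le_or_gt 4 t with h4 | h4
  · have := htime ε hε T u hu t ⟨by linarith, ht⟩ h4
    nlinarith
  · nlinarith
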